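/- Let $N$ be a connected, simply connected nilpotent Lie group and let $\varphi=(\varphi_t)_{t\in\mathbb R}$ be a smooth one-parameter group of automorphisms of $N$ that is expanding, i.e. $\varphi_{-t}(g)\to 1$ as $t\to\infty$ for every $g\in N$. Let $m\ge 2$ be an integer. *The millefeuille space.* Fix an inner product $q$ on $T_1N$. Let $G_\varphi=N\rtimes_\varphi\mathbb R$ carry the left-invariant Riemannian metric that is $q$ on $T_1N$ and for which $\partial_t$ is a unit vector orthogonal to $N$; its height function is $h_\varphi(g,t)=t$. Let $T_{m+1}$ be the $(m+1)$-valent tree with edges of length one, oriented so that each vertex has $m$ incoming edges and one outgoing edge, with a height function $h_m$, integer valued on vertices, that grows at unit speed along the orientation. Let $$X_{N,\varphi,m}=\{(x,y)\in G_\varphi\times T_{m+1} : h_\varphi(x)=h_m(y)\},$$ with the path metric induced from the $\ell^2$ product metric, rescaled by $1/\sqrt2$, and with height function $h(x,y)=h_\varphi(x)$. *Boundary metrics.* Let $\partial X$ be the set of unit-speed geodesic rays of $X=X_{N,\varphi,m}$ modulo bounded distance, and let $\infty\in\partial X$ be the point whose representatives are exactly the rays along which $h$ increases at unit speed. For $b\in\partial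 X-\{\infty\}$ let $t\mapsto b_t$ be the geodesic line from $b$ to $\infty$ with $h(b_0)=0$. The parabolic visual metric with base $m$ on $\partial X-\{\infty\}$ is $\bar d(b,c)=m^{t_0}$ for $b\ne c$, where $t_0$ is the smallest $t$ with $d_X(b_t,c_t)=1$, and $\bar d(b,b)=0$. The Euclid–Cygan metric with base $m$ is $d(b,c)=\lim_{t\to-\infty}m^{\frac12(2t+d_X(b_t,c_t))}$. *Model metrics.* Fix a left-invariant Riemannian metric on $N$, with distance $d_N$. For $x\neq y$ in $N$ put $d_\varphi(x,y)=m^{t_0}$, where $t_0$ is the smallest $t$ with $d_N(\varphi_{-t}(x),\varphi_{-t}(y))=1$, and $d_\varphi(x,x)=0$. Let $\mathbb Q_m$ be the set of $m$-adic numbers $\sum_i a_im^i$ (digits $a_i\in\{0,\dots,m-1\}$, $i\in\mathbb Z$, $a_i=0$ for all sufficiently negative $i$) with $d_{\mathbb Q_m}(x,y)=m^{-n}$, where $n$ is the first index at which the digits of $x\ne y$ differ, and $d_{\mathbb Q_m}(x,x)=0$. **Proposition.** There is $c_0>0$ such that for every $c\ge c_0$ the following holds for the rescaled group $\varphi'_t=\varphi_{ct}$.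 The function $d_{\varphi'}$ is bilipschitz equivalent to a metric on $N$. In $X=X_{N,\varphi',m}$ the point $\infty\in\partial X$ exists, every $b\in\partial X-\{\infty\}$ has exactly one geodesic line $b_t$ as above, and for $b\neq c$ the smallest $t_0$ and for all $b,c$ the limit in the definitions of $\bar d$ and $d$ exist. There is a bijection $F:N\times\mathbb Q_m\to\partial X-\{\infty\}$ that is bilipschitz from $$d_{\varphi',m}\big((g,x),(g',x')\big)=\max\{d_{\varphi'}(g,g'),\,d_{\mathbb Q_m}(x,x')\}$$ to the parabolic visual metric $\bar d$, and also to the Euclid–Cygan metric $d$. -/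

import Mathlib

open Set Filter Topology Manifold
open scoped ENNReal NNReal ContDiff

noncomputable section

/-! ## Expanding one-parameter groups of automorphisms -/

/-- A smooth one-parameter group `t ↦ φ_t` of automorphisms of a Lie group `N` which is expanding:
`φ_{-t}(g) → 1` as `t → ∞`, for every `g`. (Each `φ_t` is an automorphism, with inverse
`φ_{-t}`.) -/
structure ExpandingFlow (E N : Type*) [NormedAddCommGroup E] [NormedSpace ℝ E]
    [TopologicalSpace N] [ChartedSpace E N] [Group N] where
  /-- the automorphism `φ_t` -/
  toFun : ℝ → N →* N
  map_zero : toFun 0 = MonoidHom.id N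
  map_add : ∀ s t : ℝ, toFun (s + t) = (toFun s).comp (toFun t)
  contMDiff_uncurry : ContMDiff (𝓘(ℝ, ℝ).prod 𝓘(ℝ, E)) 𝓘(ℝ, E) ∞ fun p : ℝ × N => toFun p.1 p.2
  expanding : ∀ g : N, Tendsto (fun t : ℝ => toFun (-t) g) atTop (𝓝 1)

/-- The rescaled one-parameter group `t ↦ φ_{ct}`, where `c > 0`. -/
def ExpandingFlow.rescale {E N : Type*} [NormedAddCommGroup E] [NormedSpace ℝ E]
    [TopologicalSpace N] [ChartedSpace E N] [Group N] (φ : ExpandingFlow E N)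
    (c : ℝ) (hc : 0 < c) : ExpandingFlow E N where
  toFun t := φ.toFun (c * t)
  map_zero := by rw [mul_zero]; exact φ.map_zero
  map_add s t := by rw [mul_add]; exact φ.map_add _ _
  contMDiff_uncurry := by
    have h1 : ContMDiff 𝓘(ℝ, ℝ) 𝓘(ℝ, ℝ) ∞ fun t : ℝ => c * t :=
      (contDiff_const.mul contDiff_id).contMDiff
    have h : ContMDiff (𝓘(ℝ, ℝ).prod 𝓘(ℝ, E)) (𝓘(ℝ, ℝ).prod 𝓘(ℝ, E)) ∞
        fun p : ℝ × N => ((c * p.1, p.2) : ℝ × N) :=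
      (h1.comp contMDiff_fst).prodMk contMDiff_snd
    exact φ.contMDiff_uncurry.comp h
  expanding g := by
    have h := (φ.expanding g).comp ((tendsto_const_mul_atTop_of_pos hc).2 tendsto_id)
    refine h.congr fun t => ?_
    simp [mul_neg]

/-! ## Left-invariant metrics on `N` and on `G_φ = N ⋊_φ ℝ` -/

/-- An inner product on the Lie algebra `T_1 N`; it is the same thing as a left-invariant
Riemannian metric on `N`. -/
structure LieInner (E N : Type*) [NormedAddCommGroup E] [NormedSpace ℝ E]
    [TopologicalSpace N] [ChartedSpace E N] [Group N] where
  /-- the bilinear form -/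
  form : LinearMap.BilinForm ℝ (GroupLieAlgebra 𝓘(ℝ, E) N)
  symm : ∀ v w, form v w = form w v
  pos : ∀ v, v ≠ 0 → 0 < form v v

section Metrics

variable {E N : Type*} [NormedAddCommGroup E] [NormedSpace ℝ E]
  [TopologicalSpace N] [ChartedSpace E N] [Group N]

/-- The squared length, in the left-invariant Riemannian metric `q` on `N`, of a vector `v` tangent
to `N` at `g`: left translation by `g⁻¹` carries `v` to `T_1 N`, where `q` is evaluated. -/
def LieInner.sqNorm (q : LieInner E N) (g : N) (v : TangentSpace 𝓘(ℝ, E) g) : ℝ :=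
  let w : GroupLieAlgebra 𝓘(ℝ, E) N :=
    mfderiv 𝓘(ℝ, E) 𝓘(ℝ, E) (fun y : N => g⁻¹ * y) g v
  q.form w w

/-- The distance `d_N` on `N` of the left-invariant Riemannian metric `q`: the infimum of the
lengths of the `C¹` paths. -/
def LieInner.nDist (q : LieInner E N) (x y : N) : ℝ≥0∞ :=
  letI : ∀ g : N, ENorm (TangentSpace 𝓘(ℝ, E) g) :=
    fun g => ⟨fun v => ENNReal.ofReal (Real.sqrt (q.sqNorm g v))⟩
  riemannianEDist 𝓘(ℝ, E) x y

/-- The squared length of a vector `v` tangent at `x = (g, t)` to the group `G_φ = N ⋊_φ ℝ`, with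
product `(g, t) (g', t') = (g φ_t(g'), t + t')`, in the left-invariant Riemannian metric for which
`∂/∂t` is a unit vector orthogonal to `N` and which is `q` on `T_1 N`. Left translation by `x⁻¹` is
`(y, s) ↦ (φ_{-t}(g⁻¹ y), s - t)`, and its differential carries `v` to the identity of `G_φ`. -/
def heintzeSqNorm (φ : ExpandingFlow E N) (q : LieInner E N) (x : N × ℝ)
    (v : TangentSpace (𝓘(ℝ, E).prod 𝓘(ℝ, ℝ)) x) : ℝ :=
  let w : GroupLieAlgebra 𝓘(ℝ, E) N :=
    mfderiv (𝓘(ℝ, E).prod 𝓘(ℝ, ℝ)) 𝓘(ℝ, E)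
      (fun y : N × ℝ => φ.toFun (-x.2) (x.1⁻¹ * y.1)) x v
  let s : ℝ :=
    mfderiv (𝓘(ℝ, E).prod 𝓘(ℝ, ℝ)) 𝓘(ℝ, ℝ) (fun y : N × ℝ => y.2 - x.2) x v
  s ^ 2 + q.form w w

/-- The length of a tangent vector to `G_φ`. -/
abbrev heintzeENorm (φ : ExpandingFlow E N) (q : LieInner E N) (x : N × ℝ) :
    ENorm (TangentSpace (𝓘(ℝ, E).prod 𝓘(ℝ, ℝ)) x) :=
  ⟨fun v => ENNReal.ofReal (Real.sqrt (heintzeSqNorm φ q x v))⟩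

/-- The Riemannian distance on `G_φ`. -/
def heintzeEDist (φ : ExpandingFlow E N) (q : LieInner E N) (x y : N × ℝ) : ℝ≥0∞ :=
  letI := heintzeENorm φ q
  riemannianEDist (𝓘(ℝ, E).prod 𝓘(ℝ, ℝ)) x y

theorem heintzeENorm_smul (φ : ExpandingFlow E N) (q : LieInner E N) :
    let _ := heintzeENorm φ q
    ∀ x : N × ℝ, ENormSMulClass ℝ (TangentSpace (𝓘(ℝ, E).prod 𝓘(ℝ, ℝ)) x) := by
  intro _ x
  refine ⟨fun r v => ?_⟩
  change ENNReal.ofReal (Real.sqrt (heintzeSqNorm φ q x (r • v))) =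
    ‖r‖ₑ * ENNReal.ofReal (Real.sqrt (heintzeSqNorm φ q x v))
  have h : heintzeSqNorm φ q x (r • v) = r ^ 2 * heintzeSqNorm φ q x v := by
    have key : ∀ (w : GroupLieAlgebra 𝓘(ℝ, E) N) (s : ℝ),
        (r * s) ^ 2 + q.form (r • w) (r • w) = r ^ 2 * (s ^ 2 + q.form w w) := by
      intro w s
      rw [map_smul, map_smul, LinearMap.smul_apply, smul_eq_mul, smul_eq_mul]
      ring
    unfold heintzeSqNorm
    simp only [ContinuousLinearMap.map_smul]
    exact key _ _
  rw [h, Real.sqrt_mul (sq_nonneg r), Real.sqrt_sq_eq_abs,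
    ENNReal.ofReal_mul (abs_nonneg r), Real.enorm_eq_ofReal_abs]

/-- The Heintze group `G_φ = N ⋊_φ ℝ` with its left-invariant Riemannian distance. -/
@[ext] structure HeintzeGroup (φ : ExpandingFlow E N) (q : LieInner E N) where
  /-- the component in `N` -/
  base : N
  /-- the component in `ℝ`, which is the height -/
  height : ℝ

instance (φ : ExpandingFlow E N) (q : LieInner E N) : PseudoEMetricSpace (HeintzeGroup φ q) where
  edist x y := heintzeEDist φ q (x.base, x.height) (y.base, y.height)
  edist_self x := by
    let _ := heintzeENorm φ q
    have := heintzeENorm_smul φ q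
    exact riemannianEDist_self
  edist_comm x y := by
    let _ := heintzeENorm φ q
    have := heintzeENorm_smul φ q
    exact riemannianEDist_comm
  edist_triangle x y z := by
    let _ := heintzeENorm φ q
    have := heintzeENorm_smul φ q
    exact riemannianEDist_triangle

/-- The parabolic visual distance `d_φ` on `N` with base `a`: `d_φ(x, y) = a ^ t₀`, where `t₀` is
the smallest `t` with `d_N(φ_{-t}(x), φ_{-t}(y)) = 1`. -/
def dPhi (φ : ExpandingFlow E N) (q : LieInner E N) (a : ℝ) (x y : N) : ℝ :=
  open scoped Classical in
  if x = y then 0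
  else a ^ sInf {t : ℝ | q.nDist (φ.toFun (-t) x) (φ.toFun (-t) y) = 1}

end Metrics

/-! ## The oriented regular tree -/

/-- The `(m+1)`-valent tree with an orientation of its edges for which every vertex has one outgoing
edge (towards its parent) and `m` incoming edges, and a height function, which increases by one
along each oriented edge. -/
structure OrientedRegularTree (V : Type*) (m : ℕ) where
  graph : SimpleGraph V
  isTree : graph.IsTree
  parent : V → V
  adj_iff : ∀ v w, graph.Adj v w ↔ parent v = w ∨ parent w = v
  ncard_children : ∀ v, {w | parent w = v}.ncard = m
  height : V → ℤ
  height_parent : ∀ v, height (parent v) = height v + 1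

/-- A point of the geometric realization of the tree, with edges of length one. Every point lies on
exactly one half-open edge `[v, parent v)`, and is determined by `v` and its height. -/
@[ext] structure TreePoint {V : Type*} {m : ℕ} (T : OrientedRegularTree V m) where
  vertex : V
  height : ℝ
  floor_height : ⌊height⌋ = T.height vertex

section Tree

variable {V : Type*} {m : ℕ} {T : OrientedRegularTree V m}

/-- The ascending ray from `x` is at height `r` (for `r ≥ height x`) on the half-open edge that
starts at this vertex. -/
def TreePoint.ancestor (x : TreePoint T) (r : ℝ) : V :=
  T.parent^[(⌊r⌋ - T.height x.vertex).toNat] x.vertex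

/-- The ascending rays from `x` and from `y` coincide at height `r`. -/
def TreePoint.MeetAt (x y : TreePoint T) (r : ℝ) : Prop :=
  x.height ≤ r ∧ y.height ≤ r ∧ x.ancestor r = y.ancestor r

theorem TreePoint.ancestor_mono (x : TreePoint T) {r s : ℝ} (h : x.height ≤ r) (hrs : r ≤ s) :
    x.ancestor s = T.parent^[(⌊s⌋ - ⌊r⌋).toNat] (x.ancestor r) := by
  have h1 : T.height x.vertex ≤ ⌊r⌋ := x.floor_height ▸ Int.floor_le_floor h
  have h2 : ⌊r⌋ ≤ ⌊s⌋ := Int.floor_le_floor hrs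
  unfold TreePoint.ancestor
  rw [← Function.iterate_add_apply]
  congr 2
  omega

theorem TreePoint.MeetAt.mono {x y : TreePoint T} {r s : ℝ} (h : x.MeetAt y r) (hrs : r ≤ s) :
    x.MeetAt y s :=
  ⟨h.1.trans hrs, h.2.1.trans hrs, by
    rw [x.ancestor_mono h.1 hrs, y.ancestor_mono h.2.1 hrs, h.2.2]⟩

/-- The path metric of the tree: the geodesic from `x` to `y` ascends from `x` to the point where
the ascending rays from `x` and `y` first meet, and then descends to `y`. If `r` is the height of
that point, its length is `(r - height x) + (r - height y)`. -/
instance : PseudoEMetricSpace (TreePoint T) where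
  edist x y := ⨅ (r : ℝ) (_ : x.MeetAt y r), ENNReal.ofReal ((r - x.height) + (r - y.height))
  edist_self x := by
    refine le_antisymm (iInf₂_le_of_le x.height ⟨le_rfl, le_rfl, rfl⟩ ?_) bot_le
    simp
  edist_comm x y := by
    refine iInf_congr fun r => ?_
    have : x.MeetAt y r ↔ y.MeetAt x r :=
      ⟨fun h => ⟨h.2.1, h.1, h.2.2.symm⟩, fun h => ⟨h.2.1, h.1, h.2.2.symm⟩⟩
    refine iInf_congr_Prop this fun _ => ?_
    rw [add_comm]
  edist_triangle x y z := by
    simp only [ENNReal.iInf_add, ENNReal.add_iInf]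
    refine le_iInf fun s => le_iInf fun hs => le_iInf fun r => le_iInf fun hr => ?_
    have hr' := hr.mono (le_max_left r s)
    have hs' := hs.mono (le_max_right r s)
    refine iInf₂_le_of_le (max r s) ⟨hr'.1, hs'.2.1, hr'.2.2.trans hs'.2.2⟩ ?_
    rw [← ENNReal.ofReal_add (by linarith [hr.1, hr.2.1]) (by linarith [hs.1, hs.2.1])]
    refine ENNReal.ofReal_le_ofReal ?_
    have := min_add_max r s
    have := le_min hr.2.1 hs.1
    linarith

end Tree

/-! ## Induced path metrics and the millefeuille space -/

/-- The induced path metric on a subset `S` of a metric space: the infimum of the lengths of the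
continuous paths in `S`. -/
def inducedPathEDist {M : Type*} [PseudoEMetricSpace M] (S : Set M) (x y : S) : ℝ≥0∞ :=
  ⨅ γ : Path x y, eVariationOn (fun t => (γ t : M)) univ

theorem inducedPathEDist_self {M : Type*} [PseudoEMetricSpace M] (S : Set M) (x : S) :
    inducedPathEDist S x x = 0 := by
  refine le_antisymm (iInf_le_of_le (Path.refl x) ?_) bot_le
  rw [eVariationOn.constant_on]
  rintro _ ⟨a, _, rfl⟩ _ ⟨b, _, rfl⟩
  rfl

theorem inducedPathEDist_le_symm {M : Type*} [PseudoEMetricSpace M] (S : Set M) (x y : S) :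
    inducedPathEDist S x y ≤ inducedPathEDist S y x := by
  refine le_iInf fun γ => iInf_le_of_le γ.symm ?_
  exact eVariationOn.comp_le_of_antitoneOn (fun t => (γ t : M)) unitInterval.symm
    (fun a _ b _ h => by simpa using h) (fun _ _ => mem_univ _)

theorem inducedPathEDist_triangle {M : Type*} [PseudoEMetricSpace M] (S : Set M) (x y z : S) :
    inducedPathEDist S x z ≤ inducedPathEDist S x y + inducedPathEDist S y z := by
  simp only [inducedPathEDist, ENNReal.iInf_add, ENNReal.add_iInf]
  refine le_iInf fun δ => le_iInf fun γ => iInf_le_of_le (γ.trans δ) ?_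
  let c : unitInterval := ⟨1 / 2, by norm_num, by norm_num⟩
  have hu : eVariationOn (fun t => ((γ.trans δ) t : M)) univ =
      eVariationOn (fun t => ((γ.trans δ) t : M)) (Iic c) +
        eVariationOn (fun t => ((γ.trans δ) t : M)) (Ici c) := by
    rw [← eVariationOn.union _ (x := c) ⟨self_mem_Iic, fun _ h => h⟩
      ⟨self_mem_Ici, fun _ h => h⟩, Iic_union_Ici]
  rw [hu]
  refine add_le_add ?_ ?_
  · have h : EqOn (fun t => ((γ.trans δ) t : M))
        ((fun t => (γ t : M)) ∘ fun t : unitInterval => projIcc 0 1 zero_le_one (2 * (t : ℝ)))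
        (Iic c) := by
      intro t ht
      have ht' : (t : ℝ) ≤ 1 / 2 := ht
      simp only [Function.comp, Path.trans_apply, ht', dif_pos]
      congr 2
      rw [projIcc_of_mem]
    rw [eVariationOn.congr h]
    refine eVariationOn.comp_le_of_monotoneOn _ _ (fun a _ b _ hab => ?_) (fun _ _ => mem_univ _)
    exact monotone_projIcc _ (by have : (a : ℝ) ≤ b := hab; linarith)
  · have h : EqOn (fun t => ((γ.trans δ) t : M))
        ((fun t => (δ t : M)) ∘ fun t : unitInterval =>
          projIcc 0 1 zero_le_one (2 * (t : ℝ) - 1)) (Ici c) := by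
      intro t ht
      have ht' : 1 / 2 ≤ (t : ℝ) := ht
      have h1 := t.2.2
      simp only [Function.comp, Path.trans_apply]
      split_ifs with h2
      · have h3 : (t : ℝ) = 1 / 2 := le_antisymm h2 ht'
        have e2 : projIcc (0 : ℝ) 1 zero_le_one (2 * (t : ℝ) - 1) = 0 := by
          ext; simp [h3]
        rw [e2]
        simp [h3]
      · congr 2
        rw [projIcc_of_mem]
    rw [eVariationOn.congr h]
    refine eVariationOn.comp_le_of_monotoneOn _ _ (fun a _ b _ hab => ?_) (fun _ _ => mem_univ _)
    exact monotone_projIcc _ (by have : (a : ℝ) ≤ b := hab; linarith)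

section Millefeuille

variable {E N V : Type*} [NormedAddCommGroup E] [NormedSpace ℝ E]
  [TopologicalSpace N] [ChartedSpace E N] [Group N] {m : ℕ}

/-- The set of all `(x, y) ∈ G_φ × T_{m+1}` with equal heights; the product carries the `ℓ²` product
metric. -/
def millefeuilleSet (φ : ExpandingFlow E N) (q : LieInner E N) (T : OrientedRegularTree V m) :
    Set (WithLp 2 (HeintzeGroup φ q × TreePoint T)) :=
  {x | x.fst.height = x.snd.height}

/-- The millefeuille space `X_{N,φ,m}`, with the induced path metric rescaled by `1/√2`. -/
@[ext] structure Millefeuille (φ : ExpandingFlow E N) (q : LieInner E N)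
    (T : OrientedRegularTree V m) where
  /-- the point of `G_φ × T_{m+1}` -/
  pt : millefeuilleSet φ q T

/-- The height function of the millefeuille space. -/
def Millefeuille.height {φ : ExpandingFlow E N} {q : LieInner E N} {T : OrientedRegularTree V m}
    (x : Millefeuille φ q T) : ℝ :=
  x.pt.1.fst.height

instance (φ : ExpandingFlow E N) (q : LieInner E N) (T : OrientedRegularTree V m) :
    PseudoEMetricSpace (Millefeuille φ q T) where
  edist x y := ENNReal.ofReal (1 / Real.sqrt 2) * inducedPathEDist (millefeuilleSet φ q T) x.pt y.pt
  edist_self x := by rw [inducedPathEDist_self, mul_zero]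
  edist_comm x y := by
    rw [le_antisymm (inducedPathEDist_le_symm _ x.pt y.pt) (inducedPathEDist_le_symm _ y.pt x.pt)]
  edist_triangle x y z := by
    rw [← mul_add]
    gcongr
    exact inducedPathEDist_triangle _ x.pt y.pt z.pt

end Millefeuille

/-! ## Visual boundaries and their parabolic visual metrics -/

section Boundary

variable {X : Type*} [PseudoEMetricSpace X]

/-- Unit-speed geodesic rays. -/
def GeodesicRay (X : Type*) [PseudoEMetricSpace X] : Type _ := {ρ : ℝ≥0 → X // Isometry ρ}

/-- Two geodesic rays are asymptotic if they stay at bounded distance. -/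
instance GeodesicRay.setoid (X : Type*) [PseudoEMetricSpace X] : Setoid (GeodesicRay X) where
  r ρ σ := ∃ C : ℝ≥0, ∀ t, edist (ρ.1 t) (σ.1 t) ≤ C
  iseqv :=
    { refl := fun ρ => ⟨0, fun t => by simp⟩
      symm := fun ⟨C, h⟩ => ⟨C, fun t => by rw [edist_comm]; exact h t⟩
      trans := fun ⟨C, h⟩ ⟨D, k⟩ => ⟨C + D, fun t => by
        push_cast
        exact (edist_triangle _ _ _).trans (add_le_add (h t) (k t))⟩ }

/-- The visual boundary `∂X`: geodesic rays up to being asymptotic. -/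
def VisualBoundary (X : Type*) [PseudoEMetricSpace X] : Type _ := Quotient (GeodesicRay.setoid X)

/-- The endpoint of a geodesic ray. -/
def GeodesicRay.endpoint (ρ : GeodesicRay X) : VisualBoundary X := Quotient.mk _ ρ

/-- The endpoint at `+∞` of a geodesic line. -/
def posEnd (γ : ℝ → X) (hγ : Isometry γ) : VisualBoundary X :=
  GeodesicRay.endpoint ⟨fun t => γ t, hγ.comp isometry_subtype_coe⟩

/-- The endpoint at `-∞` of a geodesic line. -/
def negEnd (γ : ℝ → X) (hγ : Isometry γ) : VisualBoundary X :=
  GeodesicRay.endpoint ⟨fun t => γ (-t), hγ.comp ((IsometryEquiv.neg ℝ).isometry.comp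
    isometry_subtype_coe)⟩

/-- `ξ` is the boundary point at which the height `h` goes to `+∞`: the geodesic rays with endpoint
`ξ` are exactly those along which `h` increases at unit speed. -/
def IsUpperEnd (h : X → ℝ) (ξ : VisualBoundary X) : Prop :=
  ∀ ρ : GeodesicRay X, ρ.endpoint = ξ ↔ ∀ t : ℝ≥0, h (ρ.1 t) = h (ρ.1 0) + t

/-- The vertical geodesics `t ↦ b_t` of a boundary point `b`: the geodesic lines from `b` to `ξ`
with `b_0` on the horosphere `{h = 0}` centered at `ξ`. -/
def IsVerticalGeodesic (h : X → ℝ) (ξ b : VisualBoundary X) (γ : ℝ → X) : Prop :=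
  ∃ hγ : Isometry γ, negEnd γ hγ = b ∧ posEnd γ hγ = ξ ∧ h (γ 0) = 0

/-- `D` is the parabolic visual metric with base `a` on `∂X - {ξ}`, for the horosphere `{h = 0}`:
every boundary point has exactly one vertical geodesic, and `D b c = a ^ t₀` for `b ≠ c`, where `t₀`
is the smallest `t` with `d_X(b_t, c_t) = 1`. -/
structure IsParabolicVisualMetric (h : X → ℝ) (ξ : VisualBoundary X) (a : ℝ)
    (D : {b : VisualBoundary X // b ≠ ξ} → {b : VisualBoundary X // b ≠ ξ} → ℝ) : Prop where
  existsUnique : ∀ b : {b : VisualBoundary X // b ≠ ξ}, ∃! β, IsVerticalGeodesic h ξ b.1 β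
  self_eq_zero : ∀ b, D b b = 0
  eq_rpow : ∀ b c, b ≠ c → ∀ β γ, IsVerticalGeodesic h ξ b.1 β → IsVerticalGeodesic h ξ c.1 γ →
    ∃ t₀ : ℝ, IsLeast {t : ℝ | edist (β t) (γ t) = 1} t₀ ∧ D b c = a ^ t₀

/-- `D` is the Euclid-Cygan metric with base `a` on `∂X - {ξ}`, for the horosphere `{h = 0}`:
every boundary point has exactly one vertical geodesic, and
`D b c = lim_{t → -∞} a ^ ((2 t + d_X(b_t, c_t)) / 2)`. -/
structure IsEuclidCyganMetric (h : X → ℝ) (ξ : VisualBoundary X) (a : ℝ)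
    (D : {b : VisualBoundary X // b ≠ ξ} → {b : VisualBoundary X // b ≠ ξ} → ℝ) : Prop where
  existsUnique : ∀ b : {b : VisualBoundary X // b ≠ ξ}, ∃! β, IsVerticalGeodesic h ξ b.1 β
  edist_ne_top : ∀ b c β γ, IsVerticalGeodesic h ξ b β → IsVerticalGeodesic h ξ c γ →
    ∀ t : ℝ, edist (β t) (γ t) ≠ ⊤
  tendsto : ∀ b c β γ, IsVerticalGeodesic h ξ b.1 β → IsVerticalGeodesic h ξ c.1 γ →
    Tendsto (fun t : ℝ => a ^ ((1 / 2 : ℝ) * (2 * t + (edist (β t) (γ t)).toReal))) atBot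
      (𝓝 (D b c))

end Boundary

/-! ## The `m`-adics, metrics and bilipschitz maps -/

/-- The `m`-adics `ℚ_m`: series `∑ a_i m ^ i` over `i ∈ ℤ` with digits `a_i ∈ {0, …, m-1}` that
vanish for all sufficiently negative `i`. -/
def MAdic (m : ℕ) : Type := {a : ℤ → Fin m // ∃ k : ℤ, ∀ i < k, (a i : ℕ) = 0}

/-- The standard metric on `ℚ_m`: `m ^ (-n)`, where `n` is the first index at which the digits
differ. -/
def mAdicDist {m : ℕ} (x y : MAdic m) : ℝ :=
  open scoped Classical in
  if x = y then 0 else (m : ℝ) ^ (-sInf {i : ℤ | x.1 i ≠ y.1 i})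

/-- `d` is a metric. -/
structure IsMetric {Y : Type*} (d : Y → Y → ℝ) : Prop where
  eq_zero_iff : ∀ x y, d x y = 0 ↔ x = y
  symm : ∀ x y, d x y = d y x
  triangle : ∀ x y z, d x z ≤ d x y + d y z

/-- `F` is a bilipschitz embedding from `Y`, with distance `d`, to `Z`, with distance `d'`. -/
def IsBilipschitz {Y Z : Type*} (d : Y → Y → ℝ) (d' : Z → Z → ℝ) (F : Y → Z) : Prop :=
  ∃ a b : ℝ, 0 < a ∧ 0 < b ∧ ∀ x y, a * d x y ≤ d' (F x) (F y) ∧ d' (F x) (F y) ≤ b * d x y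

/-- The maximum `d_{φ,m}` of a distance on `N` and the standard metric on `ℚ_m`. -/
def maxDist {N : Type*} {m : ℕ} (d : N → N → ℝ) (x y : N × MAdic m) : ℝ :=
  max (d x.1 y.1) (mAdicDist x.2 y.2)

end

/-! Everything is governed by the gap of `g` and `g'` at height `H`, the distance in `N` of `φ_{-H}
g` and `φ_{-H} g'`. After rescaling, the gap drops by a factor 6 within a time `δ ≤ 1`, hence
exponentially in `H` (`ContractsBy.exists_gap_le_exp`), so two points have a critical height that is
well defined up to a bounded error.

Contraction. The hypothesis only gives `φ_{-t} g → 1` pointwise. Baire's theorem makes this uniform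
on compact sets. The powers of a small element run out linearly to a fixed size in a chart, and this
turns uniform convergence into `‖φ.lin (-t)‖ → 0` (`ExpandingFlow.exists_norm_lin_neg_le`). If
moreover `m ^ δ = 2`, three gaps of size `1/6` still add up to less than 1, so `d_φ` satisfies a
four-point inequality with constant 2, and chain metrization gives a bilipschitz equivalent metric.

Distances in `X`. The factor `1/√2` makes the height 1-Lipschitz and the vertical lines geodesic. A
path of length `L` from `x` to `y` stays below `P = (h x + h y + L) / 2`. Hence the tree components
have merged above `P` (`meetAt_of_edist_le`), and the gap there is bounded (`exists_gap_bound`),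
because a horizontal displacement at height `h` contributes only `O(e ^ (h - P))` at `P`, which is
integrable along each half of the path. Conversely, two points are joined by rising to a height
where the tree components agree, crossing the leaf, and descending (`exists_edist_le_of_meetAt`).

Boundary. By these two estimates a ray either ascends or eventually descends, up to a bounded loss
of height (`exists_coarse_dichotomy`). A coarsely ascending ray ascends exactly: far out the
remaining loss is `η ^ 2` and the drift in `N` is `O(η)`, so a vertical shortcut shows that the
total loss is `O(η)` (`height_eq_of_coarsely_ascending`). A coarsely descending ray follows a
vertical line, whose base comes from completeness of `N` and whose tree component comes from
merging. Thus `∂X - {∞}` is `N` times the set of ascending lines of the tree, and labelling the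
children of each vertex by digits identifies these lines with `ℚ_m`.

Comparison. The model distance is `m ^ τ`, where `τ` is, up to a bounded error, the height at which
the two vertical lines merge (`IsMergeHeight`). The distance estimates place both `t₀` and the limit
of `(2 t + d(b_t, c_t)) / 2` within a bounded distance of `τ`. An additive error in the exponent is
a bilipschitz constant. -/

open Set Filter Topology Manifold
open scoped ENNReal NNReal ContDiff

set_option linter.unusedSectionVars false

noncomputable section

/-! ### Lengths of curves in `N` through the left-logarithmic derivative -/

section Riemannian

open MeasureTheory

variable {E N : Type*} [NormedAddCommGroup E] [NormedSpace ℝ E]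
  [TopologicalSpace N] [ChartedSpace E N] [Group N]

/-- The length of a vector of the Lie algebra. -/
def LieInner.nrm (q : LieInner E N) (v : E) : ℝ := Real.sqrt (q.form v v)

/-- The left-logarithmic derivative of a curve in `N`. -/
def leftVelocity (γ : ℝ → N) (s : ℝ) : E :=
  mfderiv 𝓘(ℝ, ℝ) 𝓘(ℝ, E) (fun s' => (γ s)⁻¹ * γ s') s (1 : ℝ)

/-- The differential at the identity of `φ_t`. -/
def ExpandingFlow.lin (φ : ExpandingFlow E N) (t : ℝ) : E →L[ℝ] E :=
  mfderiv 𝓘(ℝ, E) 𝓘(ℝ, E) (φ.toFun t) (1 : N)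

theorem ExpandingFlow.contMDiff (φ : ExpandingFlow E N) (t : ℝ) :
    ContMDiff 𝓘(ℝ, E) 𝓘(ℝ, E) ∞ (φ.toFun t) :=
  φ.contMDiff_uncurry.comp (contMDiff_const.prodMk contMDiff_id)

theorem ExpandingFlow.apply_add (φ : ExpandingFlow E N) (s t : ℝ) (x : N) :
    φ.toFun (s + t) x = φ.toFun s (φ.toFun t x) := by rw [φ.map_add]; rfl

theorem ExpandingFlow.apply_zero (φ : ExpandingFlow E N) (x : N) : φ.toFun 0 x = x := by
  rw [φ.map_zero]; rfl

theorem ExpandingFlow.apply_neg_self (φ : ExpandingFlow E N) (t : ℝ) (x : N) :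
    φ.toFun t (φ.toFun (-t) x) = x := by
  rw [← φ.apply_add, add_neg_cancel, φ.apply_zero]

theorem LieInner.nrm_nonneg (q : LieInner E N) (v : E) : 0 ≤ q.nrm v := Real.sqrt_nonneg _

theorem LieInner.nrm_sq (q : LieInner E N) (v : E) : q.nrm v ^ 2 = q.form v v := by
  refine Real.sq_sqrt ?_
  by_cases h : v = 0
  · subst h
    exact (map_zero (q.form (0 : GroupLieAlgebra 𝓘(ℝ, E) N))).ge
  · exact (q.pos v h).le

theorem LieInner.nrm_smul (q : LieInner E N) (r : ℝ) (v : E) : q.nrm (r • v) = |r| * q.nrm v := by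
  have key : ∀ (w : GroupLieAlgebra 𝓘(ℝ, E) N), q.form (r • w) (r • w) = r ^ 2 * q.form w w := by
    intro w
    rw [map_smul, map_smul, LinearMap.smul_apply, smul_eq_mul, smul_eq_mul]; ring
  have : q.nrm (r • v) = Real.sqrt (r ^ 2 * q.form v v) := congrArg Real.sqrt (key v)
  rw [this, Real.sqrt_mul (sq_nonneg r), Real.sqrt_sq_eq_abs]; rfl

/-- All inner products on the finite-dimensional Lie algebra are equivalent to the norm of the
model space. -/
theorem LieInner.exists_nrm_bounds [FiniteDimensional ℝ E] (q : LieInner E N) :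
    ∃ a b : ℝ, 0 < a ∧ 0 < b ∧ ∀ v : E, a * ‖v‖ ≤ q.nrm v ∧ q.nrm v ≤ b * ‖v‖ := by
  let B : E →ₗ[ℝ] E →ₗ[ℝ] ℝ := q.form
  have hB : Continuous fun v : E => q.nrm v := by
    have h1 : Continuous fun v : E => (LinearMap.toContinuousLinearMap (B v)) v := by
      have h2 : Continuous fun v : E =>
          (LinearMap.toContinuousLinearMap (𝕜 := ℝ) (E := E) (F' := ℝ)) (B v) := by
        exact LinearMap.continuous_of_finiteDimensional
          ((LinearMap.toContinuousLinearMap (𝕜 := ℝ) (E := E) (F' := ℝ)).toLinearMap.comp B)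
      exact h2.clm_apply continuous_id
    exact Real.continuous_sqrt.comp h1
  have hpos : ∀ v : E, v ≠ 0 → 0 < q.nrm v := fun v hv => Real.sqrt_pos.2 (q.pos v hv)
  by_cases hE : ∃ v : E, v ≠ 0
  · obtain ⟨v₀, hv₀⟩ := hE
    have hs : (Metric.sphere (0 : E) 1).Nonempty :=
      ⟨‖v₀‖⁻¹ • v₀, by simp [norm_smul, norm_ne_zero_iff.2 hv₀]⟩
    have hc : IsCompact (Metric.sphere (0 : E) 1) := isCompact_sphere 0 1
    obtain ⟨x, hx, hxm⟩ := hc.exists_isMinOn hs hB.continuousOn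
    obtain ⟨y, hy, hym⟩ := hc.exists_isMaxOn hs hB.continuousOn
    have hx0 : x ≠ 0 := by rintro rfl; simp at hx
    have hy0 : y ≠ 0 := by rintro rfl; simp at hy
    refine ⟨q.nrm x, q.nrm y, hpos x hx0, hpos y hy0, fun v => ?_⟩
    by_cases hv : v = 0
    · subst hv
      have := q.nrm_smul 0 (0 : E)
      simp only [smul_zero, abs_zero, zero_mul] at this
      simp [this]
    · have hn : 0 < ‖v‖ := norm_pos_iff.2 hv
      have hm : ‖v‖⁻¹ • v ∈ Metric.sphere (0 : E) 1 := by simp [norm_smul, hn.ne']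
      have e : q.nrm v = ‖v‖ * q.nrm (‖v‖⁻¹ • v) := by
        rw [q.nrm_smul, abs_of_pos (inv_pos.2 hn), ← mul_assoc, mul_inv_cancel₀ hn.ne', one_mul]
      rw [e, mul_comm _ ‖v‖, mul_comm _ ‖v‖]
      exact ⟨mul_le_mul_of_nonneg_left (hxm hm) hn.le, mul_le_mul_of_nonneg_left (hym hm) hn.le⟩
  · push Not at hE
    refine ⟨1, 1, one_pos, one_pos, fun v => ?_⟩
    have := q.nrm_smul 0 (0 : E)
    simp only [smul_zero, abs_zero, zero_mul] at this
    simp [hE v, this]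

theorem LieInner.nrm_zero (q : LieInner E N) : q.nrm 0 = 0 := by
  have := q.nrm_smul 0 (0 : E)
  simpa using this

theorem ExpandingFlow.mdifferentiable (φ : ExpandingFlow E N) (t : ℝ) :
    MDifferentiable 𝓘(ℝ, E) 𝓘(ℝ, E) (φ.toFun t) :=
  (φ.contMDiff t).mdifferentiable (by simp)

/-- The base point `(γ s)⁻¹ * γ s` equals `1` only propositionally. The tangent spaces are all `E`
by definition, so the transport is harmless once the equality is substituted. -/
theorem mfderiv_congr_base {f : N → N} {p : N} (hp : p = 1) :
    (mfderiv 𝓘(ℝ, E) 𝓘(ℝ, E) f p : E →L[ℝ] E) = mfderiv 𝓘(ℝ, E) 𝓘(ℝ, E) f 1 := by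
  subst hp; rfl

theorem leftVelocity_mul_left (g : N) (γ : ℝ → N) (s : ℝ) :
    (leftVelocity (fun s => g * γ s) s : E) = leftVelocity γ s := by
  unfold leftVelocity
  have : (fun s' => (g * γ s)⁻¹ * (g * γ s')) = fun s' => (γ s)⁻¹ * γ s' := by
    ext s'; group
  rw [this]
  have e : (g * γ s)⁻¹ * (g * γ s) = (γ s)⁻¹ * γ s := by group
  rfl

/-- The length element of the left-invariant metric `q`. -/
abbrev LieInner.toENorm (q : LieInner E N) (g : N) : ENorm (TangentSpace 𝓘(ℝ, E) g) :=
  ⟨fun v => ENNReal.ofReal (Real.sqrt (q.sqNorm g v))⟩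

theorem LieInner.toENorm_smul (q : LieInner E N) :
    let _ := q.toENorm
    ∀ x : N, ENormSMulClass ℝ (TangentSpace 𝓘(ℝ, E) x) := by
  intro _ x
  refine ⟨fun r v => ?_⟩
  change ENNReal.ofReal (Real.sqrt (q.sqNorm x (r • v))) =
    ‖r‖ₑ * ENNReal.ofReal (Real.sqrt (q.sqNorm x v))
  have h : q.sqNorm x (r • v) = r ^ 2 * q.sqNorm x v := by
    have key : ∀ (w : GroupLieAlgebra 𝓘(ℝ, E) N), q.form (r • w) (r • w) = r ^ 2 * q.form w w := by
      intro w
      rw [map_smul, map_smul, LinearMap.smul_apply, smul_eq_mul, smul_eq_mul]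
      ring
    unfold LieInner.sqNorm
    simp only [ContinuousLinearMap.map_smul]
    exact key _
  rw [h, Real.sqrt_mul (sq_nonneg r), Real.sqrt_sq_eq_abs,
    ENNReal.ofReal_mul (abs_nonneg r), Real.enorm_eq_ofReal_abs]

theorem LieInner.nDist_self (q : LieInner E N) (x : N) : q.nDist x x = 0 := by
  let _ := q.toENorm
  have := q.toENorm_smul
  exact riemannianEDist_self

theorem LieInner.nDist_comm (q : LieInner E N) (x y : N) : q.nDist x y = q.nDist y x := by
  let _ := q.toENorm
  have := q.toENorm_smul
  exact riemannianEDist_comm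

theorem LieInner.nDist_triangle (q : LieInner E N) (x y z : N) :
    q.nDist x z ≤ q.nDist x y + q.nDist y z := by
  let _ := q.toENorm
  have := q.toENorm_smul
  exact riemannianEDist_triangle

variable [LieGroup 𝓘(ℝ, E) ∞ N]

theorem mdifferentiable_mul_left' (g : N) : MDifferentiable 𝓘(ℝ, E) 𝓘(ℝ, E) (fun y : N => g * y) :=
  (contMDiff_mul_left (I := 𝓘(ℝ, E)) (n := ∞) (a := g)).mdifferentiable (by simp)

theorem LieInner.sqNorm_mfderiv (q : LieInner E N) {γ : ℝ → N} {s : ℝ}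
    (h : MDifferentiableAt 𝓘(ℝ, ℝ) 𝓘(ℝ, E) γ s) :
    Real.sqrt (q.sqNorm (γ s) (mfderiv 𝓘(ℝ, ℝ) 𝓘(ℝ, E) γ s (1 : ℝ))) = q.nrm (leftVelocity γ s) := by
  have h1 := mfderiv_comp s (mdifferentiable_mul_left' (γ s)⁻¹ (γ s)) h
  have h2 : (leftVelocity γ s : E) = mfderiv 𝓘(ℝ, E) 𝓘(ℝ, E) (fun y : N => (γ s)⁻¹ * y) (γ s)
      (mfderiv 𝓘(ℝ, ℝ) 𝓘(ℝ, E) γ s (1 : ℝ)) :=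
    congrArg (fun L : ℝ →L[ℝ] E => L 1) h1
  unfold LieInner.nrm
  rw [h2]
  rfl

/-- A homomorphism intertwines left translations, so only its differential at the identity acts on
left velocities. -/
theorem ExpandingFlow.leftVelocity_comp (φ : ExpandingFlow E N) (t : ℝ) {γ : ℝ → N} {s : ℝ}
    (h : MDifferentiableAt 𝓘(ℝ, ℝ) 𝓘(ℝ, E) γ s) :
    (leftVelocity (fun s => φ.toFun t (γ s)) s : E) = φ.lin t (leftVelocity γ s) := by
  have hL : MDifferentiableAt 𝓘(ℝ, ℝ) 𝓘(ℝ, E) (fun s' => (γ s)⁻¹ * γ s') s :=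
    (mdifferentiable_mul_left' (γ s)⁻¹ (γ s)).comp s h
  have h1 := mfderiv_comp s (φ.mdifferentiable t _) hL
  have h2 : (fun s' => (φ.toFun t (γ s))⁻¹ * φ.toFun t (γ s')) =
      φ.toFun t ∘ fun s' => (γ s)⁻¹ * γ s' := by
    ext s'; simp
  have h3 : (leftVelocity (fun s => φ.toFun t (γ s)) s : E) =
      (mfderiv 𝓘(ℝ, E) 𝓘(ℝ, E) (φ.toFun t) ((γ s)⁻¹ * γ s) : E →L[ℝ] E) (leftVelocity (E := E) γ s) := by
    unfold leftVelocity
    rw [h2]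
    exact congrArg (fun L : ℝ →L[ℝ] E => L 1) h1
  rw [h3, mfderiv_congr_base (inv_mul_cancel _)]; rfl

theorem LieInner.nDist_le_lintegral (q : LieInner E N) {γ : ℝ → N} {a b : ℝ} (hab : a ≤ b)
    (hγ : ContMDiffOn 𝓘(ℝ, ℝ) 𝓘(ℝ, E) 1 γ (Icc a b)) :
    q.nDist (γ a) (γ b) ≤ ∫⁻ s in Ioo a b, ENNReal.ofReal (q.nrm (leftVelocity γ s)) := by
  let _ := q.toENorm
  have := q.toENorm_smul
  refine (riemannianEDist_le_pathELength hγ rfl rfl hab).trans_eq ?_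
  rw [pathELength_eq_lintegral_mfderiv_Ioo]
  refine setLIntegral_congr_fun measurableSet_Ioo fun s hs => ?_
  have h : MDifferentiableAt 𝓘(ℝ, ℝ) 𝓘(ℝ, E) γ s :=
    (hγ.mdifferentiableOn one_ne_zero s ⟨hs.1.le, hs.2.le⟩).mdifferentiableAt
      (Icc_mem_nhds hs.1 hs.2)
  exact congrArg ENNReal.ofReal (q.sqNorm_mfderiv h)

theorem LieInner.exists_path_of_nDist_lt (q : LieInner E N) {x y : N} {r : ℝ≥0∞}
    (h : q.nDist x y < r) : ∃ γ : ℝ → N, γ 0 = x ∧ γ 1 = y ∧ ContMDiff 𝓘(ℝ, ℝ) 𝓘(ℝ, E) 1 γ ∧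
      ∫⁻ s in Ioo (0 : ℝ) 1, ENNReal.ofReal (q.nrm (leftVelocity γ s)) < r := by
  let _ := q.toENorm
  have := q.toENorm_smul
  obtain ⟨γ, h0, h1, hγ, hl, -⟩ := exists_lt_locally_constant_of_riemannianEDist_lt h zero_lt_one
  refine ⟨γ, h0, h1, hγ, ?_⟩
  rw [pathELength_eq_lintegral_mfderiv_Ioo] at hl
  refine lt_of_eq_of_lt (setLIntegral_congr_fun measurableSet_Ioo fun s hs => ?_) hl
  exact (congrArg ENNReal.ofReal (q.sqNorm_mfderiv (hγ.mdifferentiable one_ne_zero s))).symm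

end Riemannian

/-! ### Lengths of curves in the Heintze group -/

section Heintze

open MeasureTheory

variable {E N : Type*} [NormedAddCommGroup E] [NormedSpace ℝ E]
  [TopologicalSpace N] [ChartedSpace E N] [Group N]

theorem ExpandingFlow.lin_zero (φ : ExpandingFlow E N) (v : E) : φ.lin 0 v = v := by
  have h : (φ.toFun 0 : N → N) = id := by rw [φ.map_zero]; rfl
  have : (mfderiv 𝓘(ℝ, E) 𝓘(ℝ, E) (id : N → N) 1 : E →L[ℝ] E) v = v := by
    rw [mfderiv_id]; rfl
  unfold ExpandingFlow.lin
  rw [h]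
  exact this

theorem ExpandingFlow.lin_add (φ : ExpandingFlow E N) (s t : ℝ) (v : E) :
    φ.lin (s + t) v = φ.lin s (φ.lin t v) := by
  have h : (φ.toFun (s + t) : N → N) = φ.toFun s ∘ φ.toFun t := by rw [φ.map_add]; rfl
  have h1 := mfderiv_comp (1 : N) (φ.mdifferentiable s _) (φ.mdifferentiable t 1)
  have h2 : φ.lin (s + t) v = (mfderiv 𝓘(ℝ, E) 𝓘(ℝ, E) (φ.toFun s) (φ.toFun t 1) : E →L[ℝ] E)
      (φ.lin t v) := by
    unfold ExpandingFlow.lin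
    rw [h]
    exact congrArg (fun L : E →L[ℝ] E => L v) h1
  rw [h2, mfderiv_congr_base (map_one _)]; rfl

variable [LieGroup 𝓘(ℝ, E) ∞ N]

/-- Left velocities are transformed by `φ.lin t`, so a bound on this linear map bounds the length of
the image of every path. Allowing two metrics `q` and `q'` also covers changes of the left-invariant
metric. -/
theorem LieInner.nDist_flow_le (φ : ExpandingFlow E N) (q q' : LieInner E N) (t : ℝ) {K : ℝ}
    (hK : ∀ v, q'.nrm (φ.lin t v) ≤ K * q.nrm v) (hK0 : 0 < K) (x y : N) :
    q'.nDist (φ.toFun t x) (φ.toFun t y) ≤ ENNReal.ofReal K * q.nDist x y := by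
  have hK' : ENNReal.ofReal K ≠ ⊤ := ENNReal.ofReal_ne_top
  have : ∀ r, q.nDist x y < r → q'.nDist (φ.toFun t x) (φ.toFun t y) ≤ ENNReal.ofReal K * r := by
    intro r hr
    obtain ⟨γ, rfl, rfl, hγ, hl⟩ := q.exists_path_of_nDist_lt hr
    refine (q'.nDist_le_lintegral zero_le_one
      (((φ.contMDiff t).of_le (by exact_mod_cast le_top)).comp hγ).contMDiffOn).trans ?_
    calc ∫⁻ s in Ioo (0 : ℝ) 1, ENNReal.ofReal (q'.nrm (leftVelocity (φ.toFun t ∘ γ) s))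
        ≤ ∫⁻ s in Ioo (0 : ℝ) 1, ENNReal.ofReal K * ENNReal.ofReal (q.nrm (leftVelocity γ s)) := by
          refine lintegral_mono fun s => ?_
          have := φ.leftVelocity_comp t (hγ.mdifferentiable one_ne_zero s)
          have e : q'.nrm (leftVelocity (φ.toFun t ∘ γ) s) = q'.nrm (φ.lin t (leftVelocity γ s)) :=
            congrArg q'.nrm this
          rw [e, ← ENNReal.ofReal_mul hK0.le]
          exact ENNReal.ofReal_le_ofReal (hK _)
      _ = ENNReal.ofReal K * ∫⁻ s in Ioo (0 : ℝ) 1, ENNReal.ofReal (q.nrm (leftVelocity γ s)) :=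
          lintegral_const_mul' _ _ hK'
      _ ≤ _ := by gcongr
  have hK1 : ENNReal.ofReal K ≠ 0 := (ENNReal.ofReal_pos.2 hK0).ne'
  rw [← ENNReal.div_le_iff' hK1 hK']
  refine le_of_forall_gt_imp_ge_of_dense fun r hr => ?_
  rw [ENNReal.div_le_iff' hK1 hK']
  exact this r hr

theorem LieInner.nDist_mul_left_le (q : LieInner E N) (g x y : N) :
    q.nDist (g * x) (g * y) ≤ q.nDist x y := by
  refine le_of_forall_gt fun r hr => ?_
  obtain ⟨γ, rfl, rfl, hγ, hl⟩ := q.exists_path_of_nDist_lt hr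
  refine (q.nDist_le_lintegral zero_le_one (γ := fun s => g * γ s) (((contMDiff_mul_left (I := 𝓘(ℝ, E))
    (n := ∞) (a := g)).of_le (by exact_mod_cast le_top)).comp hγ).contMDiffOn).trans_lt ?_
  refine lt_of_eq_of_lt (lintegral_congr fun s => ?_) hl
  rw [leftVelocity_mul_left]

theorem LieInner.nDist_mul_left (q : LieInner E N) (g x y : N) :
    q.nDist (g * x) (g * y) = q.nDist x y := by
  refine le_antisymm (q.nDist_mul_left_le g x y) ?_
  simpa using q.nDist_mul_left_le g⁻¹ (g * x) (g * y)

/-- Left translation by `(g, t)⁻¹` acts on the `N` component as `φ_{-t}` after translation by `g⁻¹`.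
The metric is thus `dt²` plus the metric of `N` distorted by `φ.lin (-t)`, and this is the only form
in which it is used afterwards. -/
theorem heintzeSqNorm_mfderiv (φ : ExpandingFlow E N) (q : LieInner E N) {γ : ℝ → N × ℝ} {s : ℝ}
    (h : MDifferentiableAt 𝓘(ℝ, ℝ) (𝓘(ℝ, E).prod 𝓘(ℝ, ℝ)) γ s) :
    heintzeSqNorm φ q (γ s) (mfderiv 𝓘(ℝ, ℝ) (𝓘(ℝ, E).prod 𝓘(ℝ, ℝ)) γ s (1 : ℝ)) =
      (deriv (fun s => (γ s).2) s) ^ 2 +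
        q.nrm (φ.lin (-(γ s).2) (leftVelocity (fun s => (γ s).1) s)) ^ 2 := by
  have hγ1 : MDifferentiableAt 𝓘(ℝ, ℝ) 𝓘(ℝ, E) (fun s => (γ s).1) s := h.fst
  have hγ2 : MDifferentiableAt 𝓘(ℝ, ℝ) 𝓘(ℝ, ℝ) (fun s => (γ s).2) s := h.snd
  have hd1 : MDifferentiableAt (𝓘(ℝ, E).prod 𝓘(ℝ, ℝ)) 𝓘(ℝ, E)
      (fun y : N × ℝ => φ.toFun (-(γ s).2) ((γ s).1⁻¹ * y.1)) (γ s) :=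
    (φ.mdifferentiable _ _).comp (γ s) ((mdifferentiable_mul_left' _ _).comp (γ s)
      mdifferentiableAt_fst)
  have hd2 : MDifferentiableAt (𝓘(ℝ, E).prod 𝓘(ℝ, ℝ)) 𝓘(ℝ, ℝ)
      (fun y : N × ℝ => y.2 - (γ s).2) (γ s) := by
    have : MDifferentiableAt 𝓘(ℝ, ℝ) 𝓘(ℝ, ℝ) (fun t : ℝ => t - (γ s).2) (γ s).2 :=
      (differentiableAt_id.sub_const _).mdifferentiableAt
    exact this.comp (γ s) mdifferentiableAt_snd
  have e1 := mfderiv_comp s hd1 h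
  have e2 := mfderiv_comp s hd2 h
  have hL : MDifferentiableAt 𝓘(ℝ, ℝ) 𝓘(ℝ, E) (fun s' => (γ s).1⁻¹ * (γ s').1) s :=
    (mdifferentiable_mul_left' (γ s).1⁻¹ (γ s).1).comp s hγ1
  have e3 := mfderiv_comp s (φ.mdifferentiable (-(γ s).2) _) hL
  have w1 : (mfderiv (𝓘(ℝ, E).prod 𝓘(ℝ, ℝ)) 𝓘(ℝ, E)
      (fun y : N × ℝ => φ.toFun (-(γ s).2) ((γ s).1⁻¹ * y.1)) (γ s)
        (mfderiv 𝓘(ℝ, ℝ) (𝓘(ℝ, E).prod 𝓘(ℝ, ℝ)) γ s (1 : ℝ)) : E) =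
      φ.lin (-(γ s).2) (leftVelocity (fun s => (γ s).1) s) := by
    have a1 := congrArg (fun L : ℝ →L[ℝ] E => L 1) e1
    have a3 := congrArg (fun L : ℝ →L[ℝ] E => L 1) e3
    have a4 : (mfderiv 𝓘(ℝ, E) 𝓘(ℝ, E) (φ.toFun (-(γ s).2)) ((γ s).1⁻¹ * (γ s).1) : E →L[ℝ] E)
        (leftVelocity (E := E) (fun s => (γ s).1) s) =
        φ.lin (-(γ s).2) (leftVelocity (fun s => (γ s).1) s) := by
      rw [mfderiv_congr_base (inv_mul_cancel _)]; rfl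
    exact (a1.symm.trans a3).trans a4
  have w2 : (mfderiv (𝓘(ℝ, E).prod 𝓘(ℝ, ℝ)) 𝓘(ℝ, ℝ) (fun y : N × ℝ => y.2 - (γ s).2) (γ s)
      (mfderiv 𝓘(ℝ, ℝ) (𝓘(ℝ, E).prod 𝓘(ℝ, ℝ)) γ s (1 : ℝ)) : ℝ) =
      deriv (fun s => (γ s).2) s := by
    have a1 := congrArg (fun L : ℝ →L[ℝ] ℝ => L 1) e2
    have a2 : (mfderiv 𝓘(ℝ, ℝ) 𝓘(ℝ, ℝ) ((fun y : N × ℝ => y.2 - (γ s).2) ∘ γ) s : ℝ →L[ℝ] ℝ) 1 =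
        deriv (fun s => (γ s).2) s := by
      rw [mfderiv_eq_fderiv]
      have : ((fun y : N × ℝ => y.2 - (γ s).2) ∘ γ) = fun s' => (γ s').2 - (γ s).2 := rfl
      rw [this]
      change deriv (fun s' => (γ s').2 - (γ s).2) s = _
      rw [deriv_sub_const]
    exact a1.symm.trans a2
  unfold heintzeSqNorm
  rw [q.nrm_sq]
  rw [← w1, ← w2]

theorem heintzeEDist_le_lintegral (φ : ExpandingFlow E N) (q : LieInner E N) {g : ℝ → N} {h : ℝ → ℝ}
    {a b : ℝ} (hab : a ≤ b) (hg : ContMDiffOn 𝓘(ℝ, ℝ) 𝓘(ℝ, E) 1 g (Icc a b))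
    (hh : ContDiffOn ℝ 1 h (Icc a b)) :
    heintzeEDist φ q (g a, h a) (g b, h b) ≤ ∫⁻ s in Ioo a b, ENNReal.ofReal
      (Real.sqrt ((deriv h s) ^ 2 + q.nrm (φ.lin (-h s) (leftVelocity g s)) ^ 2)) := by
  let _ := heintzeENorm φ q
  have := heintzeENorm_smul φ q
  have hγ : ContMDiffOn 𝓘(ℝ, ℝ) (𝓘(ℝ, E).prod 𝓘(ℝ, ℝ)) 1 (fun s => (g s, h s)) (Icc a b) :=
    hg.prodMk hh.contMDiffOn
  refine (riemannianEDist_le_pathELength hγ rfl rfl hab).trans_eq ?_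
  rw [pathELength_eq_lintegral_mfderiv_Ioo]
  refine setLIntegral_congr_fun measurableSet_Ioo fun s hs => ?_
  have h : MDifferentiableAt 𝓘(ℝ, ℝ) (𝓘(ℝ, E).prod 𝓘(ℝ, ℝ)) (fun s => (g s, h s)) s :=
    (hγ.mdifferentiableOn one_ne_zero s ⟨hs.1.le, hs.2.le⟩).mdifferentiableAt
      (Icc_mem_nhds hs.1 hs.2)
  exact congrArg (fun r => ENNReal.ofReal (Real.sqrt r)) (heintzeSqNorm_mfderiv φ q h)

theorem exists_path_of_heintzeEDist_lt (φ : ExpandingFlow E N) (q : LieInner E N) {x y : N × ℝ}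
    {r : ℝ≥0∞} (hr : heintzeEDist φ q x y < r) : ∃ (g : ℝ → N) (h : ℝ → ℝ),
      (g 0, h 0) = x ∧ (g 1, h 1) = y ∧ ContMDiff 𝓘(ℝ, ℝ) 𝓘(ℝ, E) 1 g ∧ ContDiff ℝ 1 h ∧
      ∫⁻ s in Ioo (0 : ℝ) 1, ENNReal.ofReal
        (Real.sqrt ((deriv h s) ^ 2 + q.nrm (φ.lin (-h s) (leftVelocity g s)) ^ 2)) < r := by
  let _ := heintzeENorm φ q
  have := heintzeENorm_smul φ q
  obtain ⟨γ, h0, h1, hγ, hl, -⟩ := exists_lt_locally_constant_of_riemannianEDist_lt hr zero_lt_one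
  refine ⟨fun s => (γ s).1, fun s => (γ s).2, h0, h1, hγ.fst, hγ.snd.contDiff, ?_⟩
  rw [pathELength_eq_lintegral_mfderiv_Ioo] at hl
  refine lt_of_eq_of_lt (setLIntegral_congr_fun measurableSet_Ioo fun s hs => ?_) hl
  exact (congrArg (fun r => ENNReal.ofReal (Real.sqrt r))
    (heintzeSqNorm_mfderiv φ q (hγ.mdifferentiable one_ne_zero s))).symm

/-- A Riemannian path of length less than `L` in the Heintze group moves by less than `L` in the
direction `(a, b)` of the plane spanned by the height and the distance in the leaf at the height
of the starting point. -/
theorem heintze_path_bound (φ : ExpandingFlow E N) (q q' : LieInner E N) {K : ℝ} (hK0 : 0 < K)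
    (hK : ∀ t, |t| ≤ 1 → ∀ v, q'.nrm (φ.lin t v) ≤ K * q.nrm v) {x y : N × ℝ} {L : ℝ}
    (hL1 : L ≤ 1) (hL : heintzeEDist φ q x y < ENNReal.ofReal L) {a b : ℝ} (ha : 0 ≤ a)
    (hb : 0 ≤ b) (hab : a ^ 2 + b ^ 2 ≤ 1) :
    ENNReal.ofReal (a * |y.2 - x.2|) + ENNReal.ofReal (b / K) *
      q'.nDist (φ.toFun (-x.2) x.1) (φ.toFun (-x.2) y.1) ≤ ENNReal.ofReal L := by
  obtain ⟨g, h, rfl, rfl, hg, hh, hl⟩ := exists_path_of_heintzeEDist_lt φ q hL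
  set F : ℝ → ℝ := fun s =>
    Real.sqrt ((deriv h s) ^ 2 + q.nrm (φ.lin (-h s) (leftVelocity g s)) ^ 2) with hF
  have hder : ∀ s, |deriv h s| ≤ F s := fun s => by
    rw [hF, ← Real.sqrt_sq_eq_abs]
    exact Real.sqrt_le_sqrt (le_add_of_nonneg_right (sq_nonneg _))
  have hheight : ∀ s ∈ Icc (0 : ℝ) 1, ENNReal.ofReal |h s - h 0| ≤
      ∫⁻ s in Ioo (0 : ℝ) s, ENNReal.ofReal |deriv h s| := by
    intro s hs
    have := enorm_sub_le_lintegral_deriv_of_contDiffOn_Icc (f := h) (a := 0) (b := s)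
      hh.contDiffOn hs.1
    rw [← restrict_Ioo_eq_restrict_Icc] at this
    simpa only [Real.enorm_eq_ofReal_abs] using this
  -- A path of length less than `L ≤ 1` stays within height 1 of its start, so `hK` applies to the
  -- flow between the current height and the starting height.
  have hwin : ∀ s ∈ Ioo (0 : ℝ) 1, |h s - h 0| ≤ 1 := by
    intro s hs
    have h1 := hheight s ⟨hs.1.le, hs.2.le⟩
    have h2 : ∫⁻ s in Ioo (0 : ℝ) s, ENNReal.ofReal |deriv h s| ≤
        ∫⁻ s in Ioo (0 : ℝ) 1, ENNReal.ofReal (F s) :=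
      (lintegral_mono_set (Ioo_subset_Ioo_right hs.2.le)).trans
        (lintegral_mono fun s => ENNReal.ofReal_le_ofReal (hder s))
    have h3 := (h1.trans h2).trans_lt hl
    exact ((ENNReal.ofReal_lt_ofReal_iff_of_nonneg (abs_nonneg _)).1 h3).le.trans hL1
  have hn : q'.nDist (φ.toFun (-h 0) (g 0)) (φ.toFun (-h 0) (g 1)) ≤
      ∫⁻ s in Ioo (0 : ℝ) 1,
        ENNReal.ofReal (q'.nrm (φ.lin (h s - h 0) (φ.lin (-h s) (leftVelocity g s)))) := by
    refine (q'.nDist_le_lintegral zero_le_one (γ := fun s => φ.toFun (-h 0) (g s))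
      (((φ.contMDiff (-h 0)).of_le (by exact_mod_cast le_top)).comp hg).contMDiffOn).trans_eq ?_
    refine lintegral_congr fun s => ?_
    rw [φ.leftVelocity_comp _ (hg.mdifferentiable one_ne_zero s), ← φ.lin_add]
    congr 4
    ring
  have hh1 := hheight 1 ⟨zero_le_one, le_rfl⟩
  calc ENNReal.ofReal (a * |h 1 - h 0|) + ENNReal.ofReal (b / K) *
        q'.nDist (φ.toFun (-h 0) (g 0)) (φ.toFun (-h 0) (g 1))
      ≤ ENNReal.ofReal a * (∫⁻ s in Ioo (0 : ℝ) 1, ENNReal.ofReal |deriv h s|) +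
        ENNReal.ofReal (b / K) * (∫⁻ s in Ioo (0 : ℝ) 1,
          ENNReal.ofReal (q'.nrm (φ.lin (h s - h 0) (φ.lin (-h s) (leftVelocity g s))))) := by
        rw [ENNReal.ofReal_mul ha]
        gcongr
    _ = (∫⁻ s in Ioo (0 : ℝ) 1, ENNReal.ofReal a * ENNReal.ofReal |deriv h s|) +
        (∫⁻ s in Ioo (0 : ℝ) 1, ENNReal.ofReal (b / K) *
          ENNReal.ofReal (q'.nrm (φ.lin (h s - h 0) (φ.lin (-h s) (leftVelocity g s))))) := by
        rw [lintegral_const_mul' _ _ ENNReal.ofReal_ne_top,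
          lintegral_const_mul' _ _ ENNReal.ofReal_ne_top]
    _ ≤ _ := le_lintegral_add _ _
    _ ≤ ∫⁻ s in Ioo (0 : ℝ) 1, ENNReal.ofReal (F s) := by
        refine setLIntegral_mono' measurableSet_Ioo fun s hs => ?_
        rw [← ENNReal.ofReal_mul ha, ← ENNReal.ofReal_mul (by positivity), ← ENNReal.ofReal_add
          (by positivity) (mul_nonneg (by positivity) (q'.nrm_nonneg _))]
        refine ENNReal.ofReal_le_ofReal ?_
        have h1 := hK _ (hwin s hs) (φ.lin (-h s) (leftVelocity g s))
        set W := q.nrm (φ.lin (-h s) (leftVelocity g s))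
        have hW : 0 ≤ W := q.nrm_nonneg _
        have h2 : b / K * q'.nrm (φ.lin (h s - h 0) (φ.lin (-h s) (leftVelocity g s))) ≤ b * W := by
          calc _ ≤ b / K * (K * W) := by gcongr
            _ = b * W := by field_simp
        refine (add_le_add_right h2 _).trans ?_
        -- Pointwise Cauchy–Schwarz for the direction `(a, b)`. Fixing a direction before
        -- integrating replaces an integral Minkowski inequality.
        refine Real.le_sqrt_of_sq_le ?_
        have h3 : |deriv h s| ^ 2 = deriv h s ^ 2 := sq_abs _
        nlinarith [sq_nonneg (a * W - b * |deriv h s|), sq_nonneg (deriv h s), sq_nonneg W,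
          mul_nonneg (sub_nonneg.2 hab) (add_nonneg (sq_nonneg (deriv h s)) (sq_nonneg W))]
    _ ≤ _ := hl.le

end Heintze

/-! ### A chart at the identity and the differential of the flow -/

section Chart

open MeasureTheory

variable {E N : Type*} [NormedAddCommGroup E] [NormedSpace ℝ E]
  [TopologicalSpace N] [ChartedSpace E N] [Group N]

/-- The coordinates near the identity given by the preferred chart, centered at `0`. -/
def chartLog (g : N) : E := extChartAt 𝓘(ℝ, E) (1 : N) g - extChartAt 𝓘(ℝ, E) (1 : N) 1

/-- The inverse of `chartLog`. -/
def chartExp (v : E) : N :=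
  (extChartAt 𝓘(ℝ, E) (1 : N)).symm (extChartAt 𝓘(ℝ, E) (1 : N) 1 + v)

variable (E N) in
/-- The domain of `chartExp`. -/
def chartDom : Set E := (fun v => extChartAt 𝓘(ℝ, E) (1 : N) 1 + v) ⁻¹'
  (extChartAt 𝓘(ℝ, E) (1 : N)).target

theorem chartLog_one : (chartLog (1 : N) : E) = 0 := sub_self _

theorem chartExp_zero : (chartExp (0 : E) : N) = 1 := by
  unfold chartExp
  rw [add_zero]
  exact extChartAt_to_inv 1

theorem isOpen_chartDom : IsOpen (chartDom E N) :=
  (isOpen_extChartAt_target (I := 𝓘(ℝ, E)) (1 : N)).preimage (by fun_prop)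

theorem zero_mem_chartDom : (0 : E) ∈ chartDom E N := by
  change extChartAt 𝓘(ℝ, E) (1 : N) 1 + (0 : E) ∈ (extChartAt 𝓘(ℝ, E) (1 : N)).target
  rw [add_zero]
  exact mem_extChartAt_target 1

theorem chartLog_chartExp {v : E} (hv : v ∈ chartDom E N) : chartLog (chartExp v : N) = v := by
  unfold chartLog chartExp
  rw [(extChartAt 𝓘(ℝ, E) (1 : N)).right_inv hv]
  simp

theorem chartExp_chartLog {g : N} (hg : g ∈ (chartAt E (1 : N)).source) :
    chartExp (chartLog g : E) = g := by
  unfold chartLog chartExp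
  rw [add_sub_cancel]
  exact (extChartAt 𝓘(ℝ, E) (1 : N)).left_inv (by rwa [extChartAt_source])

theorem chartExp_mem_source {v : E} (hv : v ∈ chartDom E N) :
    (chartExp v : N) ∈ (chartAt E (1 : N)).source := by
  rw [← extChartAt_source 𝓘(ℝ, E)]
  exact (extChartAt 𝓘(ℝ, E) (1 : N)).map_target hv

theorem source_mem_nhds_one : (chartAt E (1 : N)).source ∈ 𝓝 (1 : N) :=
  (chartAt E (1 : N)).open_source.mem_nhds (mem_chart_source E 1)

/-- At a point that `f` sends to `1`, the manifold derivative is by definition read in the chart at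
`1`. This turns derivatives into Fréchet derivatives of coordinates. -/
theorem mfderiv_eq_fderiv_chart {F : Type*} [NormedAddCommGroup F] [NormedSpace ℝ F] {f : F → N}
    {x : F} (hf : MDifferentiableAt 𝓘(ℝ, F) 𝓘(ℝ, E) f x) (hx : f x = 1) :
    HasFDerivAt (fun y => (chartLog (f y) : E)) (mfderiv 𝓘(ℝ, F) 𝓘(ℝ, E) f x : F →L[ℝ] E) x := by
  have h := hf.differentiableWithinAt_writtenInExtChartAt
  have e : (mfderiv 𝓘(ℝ, F) 𝓘(ℝ, E) f x : F →L[ℝ] E) =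
      fderiv ℝ (fun y => extChartAt 𝓘(ℝ, E) (f x) (f y)) x := by
    rw [hf.mfderiv]
    simp [writtenInExtChartAt, Function.comp_def, chartAt_self_eq]
    rfl
  rw [e]
  have h' : DifferentiableAt ℝ (fun y => extChartAt 𝓘(ℝ, E) (f x) (f y)) x := by
    simpa [writtenInExtChartAt, Function.comp_def, chartAt_self_eq, differentiableWithinAt_univ] using h
  rw [hx] at h' ⊢
  exact h'.hasFDerivAt.sub_const _

variable [LieGroup 𝓘(ℝ, E) ∞ N]

theorem t2Space_of_lieGroup (E N : Type*) [NormedAddCommGroup E] [NormedSpace ℝ E]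
    [TopologicalSpace N] [ChartedSpace E N] [Group N] [LieGroup 𝓘(ℝ, E) ∞ N] : T2Space N := by
  have : IsTopologicalGroup N := topologicalGroup_of_lieGroup 𝓘(ℝ, E) ∞
  have : T1Space N := ChartedSpace.t1Space E N
  infer_instance

theorem contMDiffAt_chartLog {g : N} (hg : g ∈ (chartAt E (1 : N)).source) :
    ContMDiffAt 𝓘(ℝ, E) 𝓘(ℝ, E) ∞ (chartLog : N → E) g := by
  have h1 : ContMDiffAt 𝓘(ℝ, E) 𝓘(ℝ, E) ∞ (extChartAt 𝓘(ℝ, E) (1 : N)) g :=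
    contMDiffAt_extChartAt' hg
  have h2 : ContMDiff 𝓘(ℝ, E) 𝓘(ℝ, E) ∞ (fun v : E => v - extChartAt 𝓘(ℝ, E) (1 : N) 1) :=
    (contDiff_id.sub contDiff_const).contMDiff
  exact h2.contMDiffAt.comp g h1

theorem contMDiffAt_chartExp {v : E} (hv : v ∈ chartDom E N) :
    ContMDiffAt 𝓘(ℝ, E) 𝓘(ℝ, E) ∞ (chartExp : E → N) v := by
  have h1 : ContMDiffAt 𝓘(ℝ, E) 𝓘(ℝ, E) ∞ (extChartAt 𝓘(ℝ, E) (1 : N)).symm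
      (extChartAt 𝓘(ℝ, E) (1 : N) 1 + v) :=
    (contMDiffOn_extChartAt_symm (1 : N)).contMDiffAt
      ((isOpen_extChartAt_target (I := 𝓘(ℝ, E)) (1 : N)).mem_nhds hv)
  have h2 : ContMDiff 𝓘(ℝ, E) 𝓘(ℝ, E) ∞ (fun v : E => extChartAt 𝓘(ℝ, E) (1 : N) 1 + v) :=
    (contDiff_const.add contDiff_id).contMDiff
  exact h1.comp v h2.contMDiffAt

theorem continuousAt_chartExp {v : E} (hv : v ∈ chartDom E N) :
    ContinuousAt (chartExp : E → N) v := (contMDiffAt_chartExp hv).continuousAt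

/-- Near the identity, the product is close to the sum of the coordinates. -/
theorem exists_chart_mul : ∃ ρ : ℝ, 0 < ρ ∧ Metric.closedBall (0 : E) ρ ⊆ chartDom E N ∧
    ∀ v w : E, ‖v‖ ≤ ρ → ‖w‖ ≤ ρ →
      (chartExp v * chartExp w : N) ∈ (chartAt E (1 : N)).source ∧
      ‖chartLog (chartExp v * chartExp w : N) - v - w‖ ≤ 1 / 2 * ‖w‖ := by
  have : IsTopologicalGroup N := topologicalGroup_of_lieGroup 𝓘(ℝ, E) ∞
  set M : E × E → E := fun p => chartLog (chartExp p.1 * chartExp p.2 : N) with hM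
  have h1 : ContMDiffAt 𝓘(ℝ, E × E) 𝓘(ℝ, E) ∞ (fun p : E × E => (chartExp p.1 : N)) 0 :=
    ContMDiffAt.comp (0 : E × E) (g := (chartExp : E → N)) (contMDiffAt_chartExp (v := (0 : E)) zero_mem_chartDom)
      contDiff_fst.contMDiff.contMDiffAt
  have h2 : ContMDiffAt 𝓘(ℝ, E × E) 𝓘(ℝ, E) ∞ (fun p : E × E => (chartExp p.2 : N)) 0 :=
    ContMDiffAt.comp (0 : E × E) (g := (chartExp : E → N)) (contMDiffAt_chartExp (v := (0 : E)) zero_mem_chartDom)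
      contDiff_snd.contMDiff.contMDiffAt
  have h3 := h1.mul h2
  have e0 : (chartExp (0 : E × E).1 * chartExp (0 : E × E).2 : N) = 1 := by
    simp [chartExp_zero]
  have hMs : ContDiffAt ℝ ∞ M 0 := by
    rw [← contMDiffAt_iff_contDiffAt]
    refine ContMDiffAt.comp (0 : E × E) (g := (chartLog : N → E)) ?_ h3
    rw [e0]
    exact contMDiffAt_chartLog (mem_chart_source E 1)
  have hstrict : HasStrictFDerivAt M (fderiv ℝ M 0) 0 := hMs.hasStrictFDerivAt (by simp)
  have hdom : ∀ᶠ v : E in 𝓝 0, v ∈ chartDom E N := isOpen_chartDom.mem_nhds zero_mem_chartDom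
  have hsnd : fderiv ℝ M 0 = ContinuousLinearMap.fst ℝ E E + ContinuousLinearMap.snd ℝ E E := by
    have k1 : HasFDerivAt (fun v : E => M (v, 0)) (ContinuousLinearMap.id ℝ E) 0 := by
      refine (hasFDerivAt_id (0 : E)).congr_of_eventuallyEq ?_
      filter_upwards [hdom] with v hv
      simp [hM, chartExp_zero, chartLog_chartExp hv]
    have k2 : HasFDerivAt (fun v : E => M (0, v)) (ContinuousLinearMap.id ℝ E) 0 := by
      refine (hasFDerivAt_id (0 : E)).congr_of_eventuallyEq ?_
      filter_upwards [hdom] with v hv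
      simp [hM, chartExp_zero, chartLog_chartExp hv]
    have l1 : HasFDerivAt (fun v : E => M (v, 0))
        ((fderiv ℝ M 0).comp (ContinuousLinearMap.inl ℝ E E)) 0 :=
      HasFDerivAt.comp (0 : E) (f := fun v : E => (v, (0 : E))) hstrict.hasFDerivAt
        (ContinuousLinearMap.inl ℝ E E).hasFDerivAt
    have l2 : HasFDerivAt (fun v : E => M (0, v))
        ((fderiv ℝ M 0).comp (ContinuousLinearMap.inr ℝ E E)) 0 :=
      HasFDerivAt.comp (0 : E) (f := fun v : E => ((0 : E), v)) hstrict.hasFDerivAt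
        (ContinuousLinearMap.inr ℝ E E).hasFDerivAt
    ext v
    · exact congrArg (fun L : E →L[ℝ] E => L v) (l1.unique k1) |>.trans (by simp)
    · exact congrArg (fun L : E →L[ℝ] E => L v) (l2.unique k2) |>.trans (by simp)
  have ho := hstrict.isLittleO.def (c := 1 / 2) (by norm_num)
  have hsrc : ∀ᶠ p : E × E in 𝓝 0, (chartExp p.1 * chartExp p.2 : N) ∈
      (chartAt E (1 : N)).source := by
    refine h3.continuousAt.eventually ?_
    change ∀ᶠ g in 𝓝 (chartExp (0 : E × E).1 * chartExp (0 : E × E).2 : N), _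
    rw [e0]
    exact source_mem_nhds_one
  obtain ⟨ρ₁, hρ₁, hb₁⟩ := Metric.eventually_nhds_iff_ball.1 ho
  obtain ⟨ρ₂, hρ₂, hb₂⟩ := Metric.eventually_nhds_iff_ball.1 hsrc
  obtain ⟨ρ₃, hρ₃, hb₃⟩ := Metric.eventually_nhds_iff_ball.1 hdom
  obtain ⟨ρ, hρ, hlt⟩ : ∃ ρ, 0 < ρ ∧ ρ < min ρ₁ (min ρ₂ ρ₃) :=
    exists_between (lt_min hρ₁ (lt_min hρ₂ hρ₃))
  rw [lt_min_iff, lt_min_iff] at hlt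
  refine ⟨ρ, hρ, fun v hv => hb₃ v ?_, fun v w hv hw => ⟨hb₂ (v, w) ?_, ?_⟩⟩
  · exact Metric.closedBall_subset_ball hlt.2.2 hv
  · rw [mem_ball_zero_iff, Prod.norm_def]
    exact (max_le hv hw).trans_lt hlt.2.1
  -- Strict differentiability is applied to the pair `(v, w)`, `(v, 0)`, whose difference has norm
  -- `‖w‖`. This makes the error proportional to `‖w‖` alone, also when `v` is much larger than `w`.
  · have hin : ((v, w), (v, (0 : E))) ∈ Metric.ball (0 : (E × E) × (E × E)) ρ₁ := by
      rw [mem_ball_zero_iff, Prod.norm_def, Prod.norm_def, Prod.norm_def]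
      refine lt_of_le_of_lt ?_ hlt.1
      simp [hv, hw]
    have h := hb₁ _ hin
    have hv' : v ∈ chartDom E N := hb₃ v (Metric.closedBall_subset_ball hlt.2.2
      (mem_closedBall_zero_iff.2 hv))
    have hMv : M (v, 0) = v := by simp [hM, chartExp_zero, chartLog_chartExp hv']
    simp only [hsnd] at h
    rw [hMv] at h
    have : ‖((v, w) : E × E) - (v, 0)‖ = ‖w‖ := by simp [Prod.norm_def]
    rw [this] at h
    simpa [hM] using h

theorem hasDerivAt_leftVelocity {γ : ℝ → N} {s : ℝ}
    (h : MDifferentiableAt 𝓘(ℝ, ℝ) 𝓘(ℝ, E) γ s) :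
    HasDerivAt (fun s' => (chartLog ((γ s)⁻¹ * γ s') : E)) (leftVelocity γ s) s := by
  have hL : MDifferentiableAt 𝓘(ℝ, ℝ) 𝓘(ℝ, E) (fun s' => (γ s)⁻¹ * γ s') s :=
    (mdifferentiable_mul_left' (γ s)⁻¹ (γ s)).comp s h
  let L : ℝ →L[ℝ] E := mfderiv 𝓘(ℝ, ℝ) 𝓘(ℝ, E) (fun s' => (γ s)⁻¹ * γ s') s
  have h2 : HasFDerivAt (fun s' => (chartLog ((γ s)⁻¹ * γ s') : E)) L s :=
    mfderiv_eq_fderiv_chart hL (inv_mul_cancel _)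
  exact h2.hasDerivAt

theorem ExpandingFlow.hasFDerivAt_lin (φ : ExpandingFlow E N) (t : ℝ) :
    HasFDerivAt (fun v : E => (chartLog (φ.toFun t (chartExp v)) : E)) (φ.lin t) 0 := by
  have h0 : MDifferentiableAt 𝓘(ℝ, E) 𝓘(ℝ, E) (chartExp : E → N) 0 :=
    (contMDiffAt_chartExp zero_mem_chartDom).mdifferentiableAt (by simp)
  have h1 := (φ.mdifferentiable t (chartExp (0 : E))).comp (0 : E) h0
  have h2 := mfderiv_eq_fderiv_chart h1 (by simp [chartExp_zero])
  have h3 := mfderiv_comp (0 : E) (φ.mdifferentiable t (chartExp (0 : E))) h0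
  let D : E →L[ℝ] E := mfderiv 𝓘(ℝ, E) 𝓘(ℝ, E) (chartExp : E → N) 0
  have h4 : D = ContinuousLinearMap.id ℝ E := by
    refine HasFDerivAt.unique (f := fun v : E => (chartLog (chartExp v : N) : E)) (x := 0)
      (mfderiv_eq_fderiv_chart h0 chartExp_zero) ?_
    refine (hasFDerivAt_id (0 : E)).congr_of_eventuallyEq ?_
    filter_upwards [isOpen_chartDom.mem_nhds (zero_mem_chartDom (E := E) (N := N))] with v hv
    simp [chartLog_chartExp hv]
  have h5 : (mfderiv 𝓘(ℝ, E) 𝓘(ℝ, E) (φ.toFun t ∘ chartExp) (0 : E) : E →L[ℝ] E) = φ.lin t := by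
    refine Eq.trans h3 ?_
    ext v
    change (mfderiv 𝓘(ℝ, E) 𝓘(ℝ, E) (φ.toFun t) (chartExp (0 : E)) : E →L[ℝ] E)
      (D v) = _
    rw [h4, mfderiv_congr_base chartExp_zero]
    rfl
  rw [← h5]
  exact h2

/-- The differentials `φ.lin t` are bounded on compact sets of times. -/
theorem ExpandingFlow.exists_norm_lin_le (φ : ExpandingFlow E N) (R : ℝ) :
    ∃ K : ℝ, 0 < K ∧ ∀ t, |t| ≤ R → ‖φ.lin t‖ ≤ K := by
  -- The flow in coordinates is jointly `C¹`, hence Lipschitz near `(t₀, 0)`, and a Lipschitz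
  -- constant in the second variable bounds the differential there. Continuity of `t ↦ φ.lin t` is
  -- not needed.
  have hloc : ∀ t₀ : ℝ, ∃ K : ℝ, ∃ U ∈ 𝓝 t₀, ∀ t ∈ U, ‖φ.lin t‖ ≤ K := by
    intro t₀
    set F : ℝ × E → E := fun p => chartLog (φ.toFun p.1 (chartExp p.2)) with hF
    have hFs : ContDiffAt ℝ ∞ F (t₀, 0) := by
      rw [← contMDiffAt_iff_contDiffAt]
      have h1 : ContMDiffAt 𝓘(ℝ, ℝ × E) 𝓘(ℝ, E) ∞ (fun p : ℝ × E => (chartExp p.2 : N)) (t₀, 0) :=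
        ContMDiffAt.comp (t₀, (0 : E)) (g := (chartExp : E → N)) (contMDiffAt_chartExp (v := (0 : E)) zero_mem_chartDom)
          contDiff_snd.contMDiff.contMDiffAt
      have h2 : ContMDiffAt 𝓘(ℝ, ℝ × E) 𝓘(ℝ, ℝ) ∞ (fun p : ℝ × E => p.1) (t₀, 0) :=
        contDiff_fst.contMDiff.contMDiffAt
      have h3 := φ.contMDiff_uncurry.contMDiffAt.comp (t₀, (0 : E)) (h2.prodMk h1)
      refine ContMDiffAt.comp (t₀, (0 : E)) (g := (chartLog : N → E)) ?_ h3
      have : (φ.toFun t₀ (chartExp (0 : E)) : N) = 1 := by simp [chartExp_zero]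
      change ContMDiffAt _ _ _ _ (φ.toFun t₀ (chartExp (0 : E)) : N)
      rw [this]
      exact contMDiffAt_chartLog (mem_chart_source E 1)
    obtain ⟨K, U, hU, hK⟩ := (hFs.of_le (by exact_mod_cast le_top)).exists_lipschitzOnWith
    obtain ⟨V, hV, W, hW, hVW⟩ := mem_nhds_prod_iff.1 hU
    refine ⟨K, V, hV, fun t ht => ?_⟩
    have : LipschitzOnWith K (fun v : E => (chartLog (φ.toFun t (chartExp v)) : E)) W := by
      intro v hv w hw
      have := hK (hVW (mk_mem_prod ht hv)) (hVW (mk_mem_prod ht hw))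
      simpa [Prod.edist_eq] using this
    exact (φ.hasFDerivAt_lin t).le_of_lipschitzOn hW this
  have : ∃ K : ℝ, ∀ t ∈ Icc (-R) R, ‖φ.lin t‖ ≤ K := by
    refine isCompact_Icc.induction_on (p := fun S => ∃ K : ℝ, ∀ t ∈ S, ‖φ.lin t‖ ≤ K) ?_ ?_ ?_ ?_
    · exact ⟨0, by simp⟩
    · rintro s t hst ⟨K, hK⟩
      exact ⟨K, fun x hx => hK x (hst hx)⟩
    · rintro s t ⟨K, hK⟩ ⟨K', hK'⟩
      refine ⟨max K K', fun x hx => ?_⟩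
      rcases hx with hx | hx
      · exact (hK x hx).trans (le_max_left _ _)
      · exact (hK' x hx).trans (le_max_right _ _)
    · intro t _
      obtain ⟨K, U, hU, hK⟩ := hloc t
      exact ⟨U, mem_nhdsWithin_of_mem_nhds hU, K, hK⟩
  obtain ⟨K, hK⟩ := this
  exact ⟨max K 1, by positivity, fun t ht => (hK t (abs_le.1 ht)).trans (le_max_left _ _)⟩

end Chart

/-! ### Local comparison of the Riemannian distance with coordinates -/

section Local

open MeasureTheory

variable {E N : Type*} [NormedAddCommGroup E] [NormedSpace ℝ E] [FiniteDimensional ℝ E]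
  [TopologicalSpace N] [ChartedSpace E N] [Group N] [LieGroup 𝓘(ℝ, E) ∞ N]

/-- Small coordinates bound the distance to the identity. -/
theorem LieInner.exists_nDist_chartExp_le (q : LieInner E N) : ∃ ρ C : ℝ, 0 < ρ ∧ 0 < C ∧
    ∀ v : E, ‖v‖ ≤ ρ → q.nDist 1 (chartExp v) ≤ ENNReal.ofReal (C * ‖v‖) := by
  have : IsTopologicalGroup N := topologicalGroup_of_lieGroup 𝓘(ℝ, E) ∞
  obtain ⟨ρ, hρ, hdom, hmul⟩ := exists_chart_mul (E := E) (N := N)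
  obtain ⟨a, b, ha, hb, hab⟩ := q.exists_nrm_bounds
  refine ⟨ρ, b * 2, hρ, by positivity, fun v hv => ?_⟩
  set γ : ℝ → N := fun s => chartExp (s • v) with hγ
  have hsv : ∀ s ∈ Icc (0 : ℝ) 1, ‖s • v‖ ≤ ρ := fun s hs => by
    rw [norm_smul, Real.norm_of_nonneg hs.1]
    exact (mul_le_of_le_one_left (norm_nonneg _) hs.2).trans hv
  have hmem : ∀ s ∈ Icc (0 : ℝ) 1, s • v ∈ chartDom E N := fun s hs =>
    hdom (mem_closedBall_zero_iff.2 (hsv s hs))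
  have hsm : ∀ s ∈ Icc (0 : ℝ) 1, ContMDiffAt 𝓘(ℝ, ℝ) 𝓘(ℝ, E) ∞ γ s := fun s hs =>
    ContMDiffAt.comp s (g := (chartExp : E → N)) (contMDiffAt_chartExp (hmem s hs))
      (contDiff_id.smul contDiff_const).contMDiff.contMDiffAt
  have hvel : ∀ s ∈ Ioo (0 : ℝ) 1, ‖(leftVelocity γ s : E)‖ ≤ 2 * ‖v‖ := by
    intro s hs
    have hs' : s ∈ Icc (0 : ℝ) 1 := ⟨hs.1.le, hs.2.le⟩
    have hd := hasDerivAt_leftVelocity ((hsm s hs').mdifferentiableAt (by simp))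
    refine hd.le_of_lip' (by positivity) ?_
    have hc : Tendsto (fun s' => (γ s)⁻¹ * γ s') (𝓝 s) (𝓝 1) := by
      have := (hsm s hs').continuousAt.tendsto.const_mul (γ s)⁻¹
      rwa [inv_mul_cancel] at this
    have hcl : Tendsto (fun s' => (chartLog ((γ s)⁻¹ * γ s') : E)) (𝓝 s) (𝓝 0) := by
      have := hd.continuousAt.tendsto
      rwa [inv_mul_cancel, chartLog_one] at this
    filter_upwards [hc.eventually (source_mem_nhds_one (E := E)),
      hcl.eventually (Metric.closedBall_mem_nhds 0 hρ), Ioo_mem_nhds hs.1 hs.2] with s' h1 h2 h3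
    have h3' : s' ∈ Icc (0 : ℝ) 1 := ⟨h3.1.le, h3.2.le⟩
    have k := (hmul (s • v) (chartLog ((γ s)⁻¹ * γ s')) (hsv s hs')
      (mem_closedBall_zero_iff.1 h2)).2
    rw [chartExp_chartLog h1, show (chartExp (s • v) : N) = γ s from rfl, mul_inv_cancel_left,
      show (γ s' : N) = chartExp (s' • v) from rfl, chartLog_chartExp (hmem s' h3')] at k
    rw [inv_mul_cancel, chartLog_one, sub_zero]
    rw [show chartExp (s' • v) = γ s' from rfl] at k
    -- If `u` denotes the coordinates of `(γ s)⁻¹ * γ s'`, then `k` says `‖s' • v - s • v - u‖ ≤ ‖u‖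
    -- / 2`. Absorbing `‖u‖ / 2` gives `‖u‖ ≤ 2 |s' - s| ‖v‖`.
    have h4 : ‖(chartLog ((γ s)⁻¹ * γ s') : E)‖ ≤ ‖s' • v - s • v‖ +
        ‖s' • v - s • v - chartLog ((γ s)⁻¹ * γ s')‖ := by
      have := norm_sub_le (s' • v - s • v) (s' • v - s • v - chartLog ((γ s)⁻¹ * γ s'))
      rwa [sub_sub_cancel] at this
    have h5 : ‖s' • v - s • v‖ = ‖s' - s‖ * ‖v‖ := by rw [← sub_smul, norm_smul]
    rw [h5] at h4
    nlinarith
  have h := q.nDist_le_lintegral zero_le_one (γ := γ) (a := 0) (b := 1)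
    (fun s hs => ((hsm s hs).of_le (by exact_mod_cast le_top)).contMDiffWithinAt)
  have e0 : γ 0 = 1 := by simp [hγ, chartExp_zero]
  have e1 : γ 1 = chartExp v := by simp [hγ]
  rw [e0, e1] at h
  refine h.trans ?_
  calc ∫⁻ s in Ioo (0 : ℝ) 1, ENNReal.ofReal (q.nrm (leftVelocity γ s))
      ≤ ∫⁻ _ in Ioo (0 : ℝ) 1, ENNReal.ofReal (b * 2 * ‖v‖) := by
        refine setLIntegral_mono' measurableSet_Ioo fun s hs => ENNReal.ofReal_le_ofReal ?_
        refine (hab _).2.trans ?_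
        rw [mul_assoc]
        exact mul_le_mul_of_nonneg_left (hvel s hs) hb.le
    _ = ENNReal.ofReal (b * 2 * ‖v‖) := by simp

/-- Near `s` the point `γ s'` is `γ s` times an increment with coordinates close to `(s' - s)` times
the left velocity, and multiplication changes coordinates by at most `3/2` of the size of the
increment. Together with the previous lemma, this makes length and coordinate norm comparable near
`1`. -/
theorem norm_deriv_chartLog_le {ρ : ℝ} (hρ : 0 < ρ)
    (hmul : ∀ v w : E, ‖v‖ ≤ ρ → ‖w‖ ≤ ρ →
      (chartExp v * chartExp w : N) ∈ (chartAt E (1 : N)).source ∧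
      ‖chartLog (chartExp v * chartExp w : N) - v - w‖ ≤ 1 / 2 * ‖w‖) {γ : ℝ → N} {s : ℝ}
    (h : MDifferentiableAt 𝓘(ℝ, ℝ) 𝓘(ℝ, E) γ s) (hs : γ s ∈ (chartAt E (1 : N)).source)
    (hn : ‖(chartLog (γ s) : E)‖ ≤ ρ) :
    ‖deriv (fun s => (chartLog (γ s) : E)) s‖ ≤ 2 * ‖(leftVelocity γ s : E)‖ := by
  have : IsTopologicalGroup N := topologicalGroup_of_lieGroup 𝓘(ℝ, E) ∞
  have hd := hasDerivAt_leftVelocity h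
  set l : E := leftVelocity γ s with hl
  have key : ∀ ε : ℝ, 0 < ε → ‖deriv (fun s => (chartLog (γ s) : E)) s‖ ≤ 3 / 2 * (‖l‖ + ε) := by
    intro ε hε
    refine norm_deriv_le_of_lip' (by positivity) ?_
    have hc : Tendsto (fun s' => (γ s)⁻¹ * γ s') (𝓝 s) (𝓝 1) := by
      have := h.continuousAt.tendsto.const_mul (γ s)⁻¹
      rwa [inv_mul_cancel] at this
    have hcl : Tendsto (fun s' => (chartLog ((γ s)⁻¹ * γ s') : E)) (𝓝 s) (𝓝 0) := by
      have := hd.continuousAt.tendsto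
      rwa [inv_mul_cancel, chartLog_one] at this
    have ho := hd.isLittleO.def hε
    filter_upwards [hc.eventually (source_mem_nhds_one (E := E)),
      hcl.eventually (Metric.closedBall_mem_nhds 0 hρ), ho] with s' h1 h2 h3
    have k := (hmul (chartLog (γ s)) (chartLog ((γ s)⁻¹ * γ s')) hn
      (mem_closedBall_zero_iff.1 h2)).2
    rw [chartExp_chartLog h1, chartExp_chartLog hs, mul_inv_cancel_left] at k
    rw [inv_mul_cancel, chartLog_one, sub_zero] at h3
    set u : E := chartLog ((γ s)⁻¹ * γ s')
    have h4 : ‖u‖ ≤ (‖l‖ + ε) * ‖s' - s‖ := by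
      have := norm_add_le (u - (s' - s) • l) ((s' - s) • l)
      rw [sub_add_cancel, norm_smul] at this
      linarith
    have h5 := norm_add_le (chartLog (γ s') - chartLog (γ s) - u) u
    rw [sub_add_cancel] at h5
    linarith
  have := le_of_forall_pos_le_add (a := ‖deriv (fun s => (chartLog (γ s) : E)) s‖)
    (b := 3 / 2 * ‖l‖) fun ε hε => by linarith [key (ε / 2) (by positivity)]
  linarith [norm_nonneg l]

/-- Points at small distance from the identity have small coordinates. -/
theorem LieInner.exists_chartExp_of_nDist_lt (q : LieInner E N) : ∃ ρ K : ℝ, 0 < ρ ∧ 0 < K ∧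
    Metric.closedBall (0 : E) ρ ⊆ chartDom E N ∧
    ∀ (r : ℝ) (x : N), 0 < r → r ≤ ρ → q.nDist 1 x < ENNReal.ofReal (r / K) →
      ∃ v : E, ‖v‖ ≤ r ∧ chartExp v = x := by
  have : T2Space N := t2Space_of_lieGroup E N
  obtain ⟨ρ, hρ, hdom, hmul⟩ := exists_chart_mul (E := E) (N := N)
  obtain ⟨a, b, ha, hb, hab⟩ := q.exists_nrm_bounds
  refine ⟨ρ, 2 / a, hρ, by positivity, hdom, fun r x hr0 hr h => ?_⟩
  obtain ⟨γ, h0, rfl, hγ, hl⟩ := q.exists_path_of_nDist_lt h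
  have hsub : Metric.closedBall (0 : E) r ⊆ chartDom E N :=
    (Metric.closedBall_subset_closedBall hr).trans hdom
  set B : Set N := chartExp '' Metric.closedBall (0 : E) r with hB
  have hBc : IsClosed B := ((isCompact_closedBall (0 : E) r).image_of_continuousOn fun v hv =>
    (continuousAt_chartExp (hsub hv)).continuousWithinAt).isClosed
  have hBsrc : ∀ g ∈ B, g ∈ (chartAt E (1 : N)).source ∧ ‖(chartLog g : E)‖ ≤ r := by
    rintro _ ⟨v, hv, rfl⟩
    refine ⟨chartExp_mem_source (hsub hv), ?_⟩
    rw [chartLog_chartExp (hsub hv)]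
    exact mem_closedBall_zero_iff.1 hv
  -- Continuous induction along the path: the derivative bound holds only while the path stays in
  -- `B`, and it is this bound that keeps the path in `B`.
  set S : Set ℝ := {s | ∀ s' ∈ Icc (0 : ℝ) s, γ s' ∈ B} with hS
  have hScl : IsClosed (S ∩ Icc 0 1) := by
    rw [isClosed_iff_clusterPt]
    intro t ht
    have htI : t ∈ Icc (0 : ℝ) 1 := isClosed_Icc.closure_subset_iff.2 inter_subset_right
      (mem_closure_iff_clusterPt.2 ht)
    refine ⟨fun s' hs' => ?_, htI⟩
    rcases hs'.2.lt_or_eq with hlt | rfl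
    · obtain ⟨u, hu1, hu2⟩ := mem_closure_iff.1 (mem_closure_iff_clusterPt.2 ht) (Ioi s')
        isOpen_Ioi hlt
      exact hu2.1 s' ⟨hs'.1, le_of_lt hu1⟩
    · by_contra hne
      have hopen : IsOpen (γ ⁻¹' Bᶜ) := hBc.isOpen_compl.preimage hγ.continuous
      obtain ⟨u, hu1, hu2⟩ := mem_closure_iff.1 (mem_closure_iff_clusterPt.2 ht) _ hopen hne
      exact hu1 (hu2.1 u ⟨hu2.2.1, le_rfl⟩)
  have hall : Icc (0 : ℝ) 1 ⊆ S := by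
    refine hScl.Icc_subset_of_forall_exists_gt ?_ ?_
    · rintro s' ⟨h1, h2⟩
      have : s' = 0 := le_antisymm h2 h1
      rw [this, h0]
      exact ⟨0, by simp [hr0.le], chartExp_zero⟩
    · rintro s ⟨hs, hs01⟩ t ht
      have hcd : ContDiffOn ℝ 1 (fun s => (chartLog (γ s) : E)) (Icc 0 s) := by
        rw [← contMDiffOn_iff_contDiffOn]
        intro s' hs'
        refine ContMDiffAt.contMDiffWithinAt ?_
        refine ContMDiffAt.comp s' (g := (chartLog : N → E)) ?_ hγ.contMDiffAt
        exact (contMDiffAt_chartLog (hBsrc _ (hs s' hs')).1).of_le (by exact_mod_cast le_top)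
      have h1 := enorm_sub_le_lintegral_deriv_of_contDiffOn_Icc hcd hs01.1
      rw [h0, chartLog_one, sub_zero] at h1
      -- The strict inequality comes from the strict length bound. It puts `γ s` in the interior of
      -- `B`, so the path remains in `B` for a little longer.
      have h2 : ‖(chartLog (γ s) : E)‖ₑ < ENNReal.ofReal r := by
        refine h1.trans_lt ?_
        calc ∫⁻ x in Icc 0 s, ‖deriv (fun s => (chartLog (γ s) : E)) x‖ₑ
            ≤ ∫⁻ x in Icc 0 s, ENNReal.ofReal (2 / a) *
                ENNReal.ofReal (q.nrm (leftVelocity γ x)) := by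
              refine setLIntegral_mono' measurableSet_Icc fun x hx => ?_
              obtain ⟨k1, k2⟩ := hBsrc _ (hs x hx)
              have k3 := norm_deriv_chartLog_le hρ hmul (hγ.mdifferentiable one_ne_zero x) k1
                (k2.trans hr)
              rw [← ofReal_norm, ← ENNReal.ofReal_mul (by positivity)]
              refine ENNReal.ofReal_le_ofReal (k3.trans ?_)
              have := (hab (leftVelocity γ x)).1
              rw [div_mul_eq_mul_div, le_div_iff₀ ha]
              linarith
          _ = ENNReal.ofReal (2 / a) * ∫⁻ x in Icc 0 s,
                ENNReal.ofReal (q.nrm (leftVelocity γ x)) :=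
              lintegral_const_mul' _ _ ENNReal.ofReal_ne_top
          _ ≤ ENNReal.ofReal (2 / a) * ∫⁻ x in Ioo (0 : ℝ) 1,
                ENNReal.ofReal (q.nrm (leftVelocity γ x)) := by
              rw [restrict_Ioo_eq_restrict_Icc]
              gcongr
              exact hs01.2.le
          _ < ENNReal.ofReal (2 / a) * ENNReal.ofReal (r / (2 / a)) := by
              gcongr
              · exact ENNReal.ofReal_ne_top
          _ = ENNReal.ofReal r := by
              rw [← ENNReal.ofReal_mul (by positivity)]
              congr 1
              field_simp
      rw [← ofReal_norm, ENNReal.ofReal_lt_ofReal_iff_of_nonneg (norm_nonneg _)] at h2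
      have hsrc := (hBsrc _ (hs s ⟨hs01.1, le_rfl⟩)).1
      have hcont : ContinuousAt (fun s => (chartLog (γ s) : E)) s :=
        ContinuousAt.comp (g := (chartLog : N → E)) (contMDiffAt_chartLog hsrc).continuousAt
          hγ.continuous.continuousAt
      have hev : ∀ᶠ s' in 𝓝 s, γ s' ∈ B := by
        filter_upwards [hcont.norm.eventually (gt_mem_nhds h2),
          hγ.continuous.continuousAt.eventually
            ((chartAt E (1 : N)).open_source.mem_nhds hsrc)] with s' k1 k2
        exact ⟨chartLog (γ s'), mem_closedBall_zero_iff.2 k1.le, chartExp_chartLog k2⟩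
      obtain ⟨δ, hδ, hball⟩ := Metric.eventually_nhds_iff_ball.1 hev
      have ht' : s < t := ht
      refine ⟨min t (s + δ / 2), fun s' hs' => ?_, lt_min ht' (by linarith), min_le_left _ _⟩
      rcases le_total s' s with hle | hle
      · exact hs s' ⟨hs'.1, hle⟩
      · refine hball s' ?_
        rw [Metric.mem_ball, Real.dist_eq, abs_of_nonneg (by linarith)]
        have := hs'.2.trans (min_le_right _ _)
        linarith
  obtain ⟨v, hv, hv'⟩ := hall (right_mem_Icc.2 zero_le_one) 1 (right_mem_Icc.2 zero_le_one)
  exact ⟨v, mem_closedBall_zero_iff.1 hv, hv'⟩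

end Local

/-! ### The left-invariant distance as a complete real-valued metric -/

section Distance

variable {E N : Type*} [NormedAddCommGroup E] [NormedSpace ℝ E] [FiniteDimensional ℝ E]
  [TopologicalSpace N] [ChartedSpace E N] [Group N] [LieGroup 𝓘(ℝ, E) ∞ N]

theorem LieInner.tendsto_nDist_one (q : LieInner E N) :
    Tendsto (fun g => q.nDist 1 g) (𝓝 1) (𝓝 0) := by
  obtain ⟨ρ, C, hρ, hC, h⟩ := q.exists_nDist_chartExp_le
  have hcl : Tendsto (fun g : N => (chartLog g : E)) (𝓝 1) (𝓝 0) := by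
    have := (contMDiffAt_chartLog (E := E) (mem_chart_source E (1 : N))).continuousAt.tendsto
    rwa [chartLog_one] at this
  have h1 : Tendsto (fun g : N => ENNReal.ofReal (C * ‖(chartLog g : E)‖)) (𝓝 1) (𝓝 0) := by
    have := ENNReal.tendsto_ofReal ((hcl.norm).const_mul C)
    simpa using this
  refine tendsto_of_tendsto_of_tendsto_of_le_of_le' tendsto_const_nhds h1
    (Eventually.of_forall fun _ => zero_le) ?_
  filter_upwards [hcl.eventually (Metric.closedBall_mem_nhds 0 hρ),
    source_mem_nhds_one (E := E)] with g h2 h3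
  have := h (chartLog g) (mem_closedBall_zero_iff.1 h2)
  rwa [chartExp_chartLog h3] at this

theorem LieInner.tendsto_nDist (q : LieInner E N) (x : N) :
    Tendsto (fun g => q.nDist x g) (𝓝 x) (𝓝 0) := by
  have : IsTopologicalGroup N := topologicalGroup_of_lieGroup 𝓘(ℝ, E) ∞
  have h1 : Tendsto (fun g => x⁻¹ * g) (𝓝 x) (𝓝 1) := by
    have := (continuous_const_mul x⁻¹).tendsto x
    rwa [inv_mul_cancel] at this
  refine (q.tendsto_nDist_one.comp h1).congr fun g => ?_
  have := q.nDist_mul_left x 1 (x⁻¹ * g)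
  simpa using this.symm

/-- The distance of a left-invariant Riemannian metric on `N`, as a real number. -/
def LieInner.rdist (q : LieInner E N) (x y : N) : ℝ := (q.nDist x y).toReal

theorem LieInner.rdist_nonneg (q : LieInner E N) (x y : N) : 0 ≤ q.rdist x y :=
  ENNReal.toReal_nonneg

theorem LieInner.rdist_self (q : LieInner E N) (x : N) : q.rdist x x = 0 := by
  simp [LieInner.rdist, q.nDist_self]

theorem LieInner.rdist_comm (q : LieInner E N) (x y : N) : q.rdist x y = q.rdist y x := by
  rw [LieInner.rdist, LieInner.rdist, q.nDist_comm]

variable [ConnectedSpace N]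

/-- Points at finite distance from `x` form a nonempty clopen set, and `N` is connected. -/
theorem LieInner.nDist_ne_top (q : LieInner E N) (x y : N) : q.nDist x y ≠ ⊤ := by
  have hU : ∀ x : N, ∀ᶠ g in 𝓝 x, q.nDist x g < ⊤ := fun x =>
    (q.tendsto_nDist x).eventually (gt_mem_nhds ENNReal.zero_lt_top)
  have hcl : IsClopen {g | q.nDist x g < ⊤} := by
    refine ⟨⟨isOpen_iff_mem_nhds.2 fun g hg => ?_⟩, isOpen_iff_mem_nhds.2 fun g hg => ?_⟩
    · filter_upwards [hU g] with g' hg' hlt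
      refine hg ((q.nDist_triangle x g' g).trans_lt ?_)
      rw [q.nDist_comm g' g]
      exact ENNReal.add_lt_top.2 ⟨hlt, hg'⟩
    · filter_upwards [hU g] with g' hg'
      exact (q.nDist_triangle x g g').trans_lt (ENNReal.add_lt_top.2 ⟨hg, hg'⟩)
  have := hcl.eq_univ ⟨x, by simp [q.nDist_self]⟩
  have hy : y ∈ {g | q.nDist x g < ⊤} := this ▸ mem_univ y
  exact hy.ne

theorem LieInner.ofReal_rdist (q : LieInner E N) (x y : N) :
    ENNReal.ofReal (q.rdist x y) = q.nDist x y := ENNReal.ofReal_toReal (q.nDist_ne_top x y)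

theorem LieInner.rdist_triangle (q : LieInner E N) (x y z : N) :
    q.rdist x z ≤ q.rdist x y + q.rdist y z := by
  rw [LieInner.rdist, LieInner.rdist, LieInner.rdist,
    ← ENNReal.toReal_add (q.nDist_ne_top _ _) (q.nDist_ne_top _ _)]
  exact ENNReal.toReal_mono (ENNReal.add_ne_top.2 ⟨q.nDist_ne_top _ _, q.nDist_ne_top _ _⟩)
    (q.nDist_triangle x y z)

theorem LieInner.rdist_flow_le (φ : ExpandingFlow E N) (q q' : LieInner E N) (t : ℝ) {K : ℝ}
    (hK0 : 0 < K) (hK : ∀ v, q'.nrm (φ.lin t v) ≤ K * q.nrm v) (x y : N) :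
    q'.rdist (φ.toFun t x) (φ.toFun t y) ≤ K * q.rdist x y := by
  have h := LieInner.nDist_flow_le φ q q' t hK hK0 x y
  rw [← q.ofReal_rdist, ← q'.ofReal_rdist, ← ENNReal.ofReal_mul hK0.le] at h
  exact (ENNReal.ofReal_le_ofReal_iff (mul_nonneg hK0.le (q.rdist_nonneg _ _))).1 h

theorem LieInner.tendsto_rdist (q : LieInner E N) (x : N) :
    Tendsto (fun g => q.rdist x g) (𝓝 x) (𝓝 0) := by
  have := (ENNReal.tendsto_toReal ENNReal.zero_ne_top).comp (q.tendsto_nDist x)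
  rwa [ENNReal.toReal_zero] at this

theorem LieInner.continuous_rdist (q : LieInner E N) {X : Type*} [TopologicalSpace X] {f g : X → N}
    (hf : Continuous f) (hg : Continuous g) : Continuous fun t => q.rdist (f t) (g t) := by
  rw [continuous_iff_continuousAt]
  intro t
  have h1 : Tendsto (fun s => q.rdist (f t) (f s) + q.rdist (g t) (g s)) (𝓝 t) (𝓝 0) := by
    have := ((q.tendsto_rdist (f t)).comp (hf.tendsto t)).add
      ((q.tendsto_rdist (g t)).comp (hg.tendsto t))
    simpa using this
  refine tendsto_iff_dist_tendsto_zero.2 (squeeze_zero (fun _ => dist_nonneg) (fun s => ?_) h1)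
  rw [Real.dist_eq, abs_le]
  have a1 := q.rdist_triangle (f s) (f t) (g s)
  have a2 := q.rdist_triangle (f t) (g t) (g s)
  have a3 := q.rdist_triangle (f t) (f s) (g t)
  have a4 := q.rdist_triangle (f s) (g s) (g t)
  rw [q.rdist_comm (f s) (f t)] at a1
  rw [q.rdist_comm (g s) (g t)] at a4
  constructor <;> linarith

theorem LieInner.rdist_mul_left (q : LieInner E N) (g x y : N) :
    q.rdist (g * x) (g * y) = q.rdist x y := by
  rw [LieInner.rdist, LieInner.rdist, q.nDist_mul_left]

/-- At distance zero, `x⁻¹ * y` has coordinates of arbitrarily small norm, and `chartExp` is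
injective on its domain, so these coordinates vanish. -/
theorem LieInner.eq_of_rdist_eq_zero (q : LieInner E N) {x y : N} (h : q.rdist x y = 0) :
    x = y := by
  have : T2Space N := t2Space_of_lieGroup E N
  obtain ⟨ρ, K, hρ, hK, hdom, hex⟩ := q.exists_chartExp_of_nDist_lt
  have h0 : q.nDist 1 (x⁻¹ * y) = 0 := by
    have h1 : q.nDist 1 (x⁻¹ * y) = q.nDist x y := by
      have := q.nDist_mul_left x 1 (x⁻¹ * y)
      simpa using this.symm
    rw [h1, ← q.ofReal_rdist, h, ENNReal.ofReal_zero]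
  have hv : ∀ r : ℝ, 0 < r → r ≤ ρ → ∃ v : E, ‖v‖ ≤ r ∧ chartExp v = x⁻¹ * y := fun r hr hr' =>
    hex r _ hr hr' (by rw [h0]; exact ENNReal.ofReal_pos.2 (by positivity))
  obtain ⟨v, hv1, hv2⟩ := hv ρ hρ le_rfl
  have hv0 : v = 0 := by
    by_contra hne
    have hpos := norm_pos_iff.2 hne
    obtain ⟨w, hw1, hw2⟩ := hv (‖v‖ / 2) (by positivity) (by linarith)
    have e : v = w := by
      rw [← chartLog_chartExp (hdom (mem_closedBall_zero_iff.2 hv1)), hv2, ← hw2,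
        chartLog_chartExp (hdom (mem_closedBall_zero_iff.2 (by linarith)))]
    rw [← e] at hw1
    linarith
  rw [hv0, chartExp_zero] at hv2
  exact (inv_mul_eq_one.1 hv2.symm)

/-- By left invariance the compact coordinate balls have a uniform radius: a tail of the sequence
lies in one translated ball and has a convergent subsequence. This limit supplies the base of the
vertical line followed by a descending ray. -/
theorem LieInner.exists_limit_of_cauchy (q : LieInner E N) (u : ℕ → N)
    (hu : ∀ ε : ℝ, 0 < ε → ∃ n₀ : ℕ, ∀ k ≥ n₀, ∀ l ≥ n₀, q.rdist (u k) (u l) < ε) :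
    ∃ g, Tendsto (fun n => q.rdist (u n) g) atTop (𝓝 0) := by
  obtain ⟨ρ, K, hρ, hK, hdom, hex⟩ := q.exists_chartExp_of_nDist_lt
  obtain ⟨n₀, hn₀⟩ := hu (ρ / K) (by positivity)
  have hv : ∀ n, ∃ v : E, ‖v‖ ≤ ρ ∧ chartExp v = (u n₀)⁻¹ * u (n₀ + n) := by
    intro n
    refine hex ρ _ hρ le_rfl ?_
    have h1 : q.nDist 1 ((u n₀)⁻¹ * u (n₀ + n)) = q.nDist (u n₀) (u (n₀ + n)) := by
      have := q.nDist_mul_left (u n₀) 1 ((u n₀)⁻¹ * u (n₀ + n))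
      simpa using this.symm
    rw [h1, ← q.ofReal_rdist]
    exact (ENNReal.ofReal_lt_ofReal_iff_of_nonneg (q.rdist_nonneg _ _)).2
      (hn₀ _ le_rfl _ (by simp))
  choose v hvn hvu using hv
  obtain ⟨w, hw, ψ, hψ, hlim⟩ := (isCompact_closedBall (0 : E) ρ).tendsto_subseq
    fun n => mem_closedBall_zero_iff.2 (hvn n)
  have hcont := (continuousAt_chartExp (N := N) (hdom hw)).tendsto.comp hlim
  set g : N := u n₀ * chartExp w with hg
  have hd : Tendsto (fun n => q.rdist g (u (n₀ + ψ n))) atTop (𝓝 0) := by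
    refine ((q.tendsto_rdist (chartExp w)).comp hcont).congr fun n => ?_
    have := q.rdist_mul_left (u n₀) (chartExp w) (chartExp (v (ψ n)))
    simp only [Function.comp_apply]
    rw [← this, hvu, mul_inv_cancel_left]
  refine ⟨g, Metric.tendsto_atTop.2 fun ε hε => ?_⟩
  obtain ⟨n₁, hn₁⟩ := hu (ε / 2) (by positivity)
  obtain ⟨n₂, hn₂⟩ := Metric.tendsto_atTop.1 hd (ε / 2) (by positivity)
  refine ⟨n₁, fun n hn => ?_⟩
  have h1 := hn₂ (max n₁ n₂) (le_max_right _ _)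
  have h2 := hn₁ n hn (n₀ + ψ (max n₁ n₂)) (by
    have := hψ.id_le (max n₁ n₂)
    have h3 : n₁ ≤ max n₁ n₂ := le_max_left _ _
    simp only [id] at this
    omega)
  rw [Real.dist_eq, sub_zero, abs_of_nonneg (q.rdist_nonneg _ _)] at h1 ⊢
  have h3 := q.rdist_triangle (u n) (u (n₀ + ψ (max n₁ n₂))) g
  rw [q.rdist_comm (u (n₀ + ψ (max n₁ n₂))) g] at h3
  linarith

end Distance

/-! ### From pointwise contraction of `N` to contraction of its Lie algebra -/

section Contraction

variable {E N : Type*} [NormedAddCommGroup E] [NormedSpace ℝ E] [FiniteDimensional ℝ E]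
  [TopologicalSpace N] [ChartedSpace E N] [Group N] [LieGroup 𝓘(ℝ, E) ∞ N]

/-- As long as the powers of a group element stay near the identity, their coordinates grow
linearly. -/
theorem norm_chartLog_pow_sub_le {ρ : ℝ}
    (hmul : ∀ v w : E, ‖v‖ ≤ ρ → ‖w‖ ≤ ρ →
      (chartExp v * chartExp w : N) ∈ (chartAt E (1 : N)).source ∧
      ‖chartLog (chartExp v * chartExp w : N) - v - w‖ ≤ 1 / 2 * ‖w‖) {v : E} (hv : ‖v‖ ≤ ρ) :
    ∀ n : ℕ, (∀ k < n, ‖(chartLog ((chartExp v : N) ^ k) : E)‖ ≤ ρ) →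
      ((chartExp v : N) ^ n) ∈ (chartAt E (1 : N)).source ∧
      ‖(chartLog ((chartExp v : N) ^ n) : E) - (n : ℝ) • v‖ ≤ n / 2 * ‖v‖ := by
  intro n
  induction n with
  | zero =>
    intro _
    simp [chartLog_one]
  | succ n ih =>
    intro h
    obtain ⟨h1, h2⟩ := ih fun k hk => h k (by omega)
    obtain ⟨h3, h4⟩ := hmul (chartLog ((chartExp v : N) ^ n)) v (h n (by omega)) hv
    rw [chartExp_chartLog h1, ← pow_succ] at h3 h4
    refine ⟨h3, ?_⟩
    have e : (chartLog ((chartExp v : N) ^ (n + 1)) : E) - ((n + 1 : ℕ) : ℝ) • v =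
        (chartLog ((chartExp v : N) ^ (n + 1)) - chartLog ((chartExp v : N) ^ n) - v) +
        (chartLog ((chartExp v : N) ^ n) - (n : ℝ) • v) := by
      push_cast
      rw [add_smul, one_smul]
      abel
    rw [e]
    refine (norm_add_le _ _).trans ?_
    push_cast
    linarith

/-- The maps `φ_{-t}`, for large `t`, are equicontinuous at the identity. -/
theorem ExpandingFlow.exists_nhds_mapsTo (φ : ExpandingFlow E N) {W : Set N} (hW : W ∈ 𝓝 1) :
    ∃ U ∈ 𝓝 (1 : N), ∃ T : ℝ, ∀ t ≥ T, ∀ g ∈ U, φ.toFun (-t) g ∈ W := by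
  have : IsTopologicalGroup N := topologicalGroup_of_lieGroup 𝓘(ℝ, E) ∞
  have : T2Space N := t2Space_of_lieGroup E N
  have : LocallyCompactSpace N := Manifold.locallyCompact_of_finiteDimensional 𝓘(ℝ, E)
  have hdiv : Tendsto (fun p : N × N => p.1⁻¹ * p.2) (𝓝 (1, 1)) (𝓝 1) := by
    have : Continuous fun p : N × N => p.1⁻¹ * p.2 := by fun_prop
    simpa using this.tendsto (1, 1)
  rw [nhds_prod_eq] at hdiv
  obtain ⟨W₁, hW₁, hW₁W⟩ := Filter.mem_prod_same_iff.1 (hdiv hW)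
  obtain ⟨W', hW', hcl, hsub⟩ := exists_mem_nhds_isClosed_subset hW₁
  -- Baire category: these closed sets cover `N`, so one of them is a neighbourhood of some `g₀`.
  -- Writing a point near the identity as `g₀⁻¹ * (g₀ * g)` moves the conclusion from `g₀` to `1`.
  set F : ℕ → Set N := fun n => {g | ∀ t : ℝ, (n : ℝ) ≤ t → φ.toFun (-t) g ∈ W'} with hF
  have hFc : ∀ n, IsClosed (F n) := by
    intro n
    have : F n = ⋂ t : Ici (n : ℝ), φ.toFun (-(t : ℝ)) ⁻¹' W' := by
      ext g
      simp only [hF, mem_iInter, mem_preimage, Subtype.forall, mem_Ici]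
      rfl
    rw [this]
    exact isClosed_iInter fun t => hcl.preimage (φ.contMDiff _).continuous
  have hU : ⋃ n, F n = univ := by
    refine eq_univ_of_forall fun g => ?_
    obtain ⟨T, hT⟩ := eventually_atTop.1 ((φ.expanding g).eventually hW')
    obtain ⟨n, hn⟩ := exists_nat_ge T
    exact mem_iUnion.2 ⟨n, fun t ht => hT t (hn.trans ht)⟩
  obtain ⟨n, g₀, hg₀⟩ := nonempty_interior_of_iUnion_of_closed hFc hU
  have hn : F n ∈ 𝓝 g₀ := mem_interior_iff_mem_nhds.1 hg₀
  refine ⟨(fun g => g₀ * g) ⁻¹' F n, ?_, n, fun t ht g hg => ?_⟩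
  · have : Tendsto (fun g => g₀ * g) (𝓝 1) (𝓝 g₀) := by
      simpa using (continuous_const_mul g₀).tendsto 1
    exact this hn
  · have h1 : φ.toFun (-t) (g₀ * g) ∈ W' := hg t ht
    have h2 : φ.toFun (-t) g₀ ∈ W' := mem_of_mem_nhds hn t ht
    have h3 : (φ.toFun (-t) g₀, φ.toFun (-t) (g₀ * g)) ∈ W₁ ×ˢ W₁ := ⟨hsub h2, hsub h1⟩
    have h4 := hW₁W h3
    simpa using h4

/-- Near `g₀` one has `φ_{-t} g = φ_{-t} g₀ * φ_{-t} (g₀⁻¹ * g)`. The first factor tends to `1` by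
hypothesis, the second is controlled by equicontinuity at the identity, and a finite cover makes the
time uniform. -/
theorem ExpandingFlow.exists_forall_compact_mapsTo (φ : ExpandingFlow E N) {C W : Set N}
    (hC : IsCompact C) (hW : W ∈ 𝓝 1) : ∃ T : ℝ, ∀ t ≥ T, ∀ g ∈ C, φ.toFun (-t) g ∈ W := by
  have : IsTopologicalGroup N := topologicalGroup_of_lieGroup 𝓘(ℝ, E) ∞
  have hm : Tendsto (fun p : N × N => p.1 * p.2) (𝓝 1 ×ˢ 𝓝 1) (𝓝 1) := by
    rw [← nhds_prod_eq]
    simpa using (continuous_mul (M := N)).tendsto (1, 1)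
  obtain ⟨W', hW', hW'W⟩ := Filter.mem_prod_same_iff.1 (hm hW)
  refine hC.induction_on (p := fun S => ∃ T : ℝ, ∀ t ≥ T, ∀ g ∈ S, φ.toFun (-t) g ∈ W)
    ⟨0, by simp⟩ ?_ ?_ ?_
  · rintro S S' h ⟨T, hT⟩
    exact ⟨T, fun t ht g hg => hT t ht g (h hg)⟩
  · rintro S S' ⟨T, hT⟩ ⟨T', hT'⟩
    refine ⟨max T T', fun t ht g hg => ?_⟩
    rcases hg with hg | hg
    · exact hT t ((le_max_left _ _).trans ht) g hg
    · exact hT' t ((le_max_right _ _).trans ht) g hg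
  · intro g₀ _
    obtain ⟨U, hU, T, hT⟩ := φ.exists_nhds_mapsTo hW'
    obtain ⟨T', hT'⟩ := eventually_atTop.1 ((φ.expanding g₀).eventually hW')
    refine ⟨(fun g => g₀⁻¹ * g) ⁻¹' U, mem_nhdsWithin_of_mem_nhds ?_, max T T',
      fun t ht g hg => ?_⟩
    · have : Tendsto (fun g => g₀⁻¹ * g) (𝓝 g₀) (𝓝 1) := by
        simpa using (continuous_const_mul g₀⁻¹).tendsto g₀
      exact this hU
    · have h1 := hT t ((le_max_left _ _).trans ht) _ hg
      have h2 := hT' t ((le_max_right _ _).trans ht)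
      have h3 : (φ.toFun (-t) g₀, φ.toFun (-t) (g₀⁻¹ * g)) ∈ W' ×ˢ W' := ⟨h2, h1⟩
      have h4 := hW'W h3
      simpa using h4

/-- The pointwise contraction of the group forces the contraction of its Lie algebra. -/
theorem ExpandingFlow.exists_norm_lin_neg_le (φ : ExpandingFlow E N) {ε : ℝ} (hε : 0 < ε) :
    ∃ T : ℝ, ∀ t ≥ T, ‖φ.lin (-t)‖ ≤ ε := by
  obtain ⟨ρ, hρ, hdom, hmul⟩ := exists_chart_mul (E := E) (N := N)
  -- If `n` powers of an element with coordinates `u` stay within size `r`, linear growth gives `n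
  -- ‖u‖ ≤ 2 r ≤ ε ρ / 4`, and `n` below is chosen with `n ‖v‖ ≥ ρ / 4`. Hence `‖u‖ ≤ ε ‖v‖`.
  set r : ℝ := min ρ (ε * ρ / 8) with hr
  have hr0 : 0 < r := lt_min hρ (by positivity)
  have hC : IsCompact ((chartExp : E → N) '' Metric.closedBall 0 ρ) :=
    (isCompact_closedBall (0 : E) ρ).image_of_continuousOn fun v hv =>
      (continuousAt_chartExp (hdom hv)).continuousWithinAt
  have hcl : Tendsto (fun g : N => (chartLog g : E)) (𝓝 1) (𝓝 0) := by
    have := (contMDiffAt_chartLog (E := E) (mem_chart_source E (1 : N))).continuousAt.tendsto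
    rwa [chartLog_one] at this
  have hW : {g : N | g ∈ (chartAt E (1 : N)).source ∧ ‖(chartLog g : E)‖ ≤ r} ∈ 𝓝 (1 : N) := by
    filter_upwards [source_mem_nhds_one (E := E),
      hcl.eventually (Metric.closedBall_mem_nhds 0 hr0)] with g h1 h2
    exact ⟨h1, mem_closedBall_zero_iff.1 h2⟩
  obtain ⟨T, hT⟩ := φ.exists_forall_compact_mapsTo hC hW
  refine ⟨T, fun t ht => (φ.hasFDerivAt_lin (-t)).le_of_lip' hε.le ?_⟩
  have hsmall : Metric.closedBall (0 : E) (ρ / 4) ∈ 𝓝 (0 : E) :=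
    Metric.closedBall_mem_nhds 0 (by positivity)
  filter_upwards [hsmall] with v hv
  rw [chartExp_zero, map_one, chartLog_one, sub_zero, sub_zero]
  have hv4 : ‖v‖ ≤ ρ / 4 := mem_closedBall_zero_iff.1 hv
  by_cases hv0 : v = 0
  · rw [hv0, chartExp_zero, map_one, chartLog_one]
    simp
  have hvp : 0 < ‖v‖ := norm_pos_iff.2 hv0
  have hvρ : ‖v‖ ≤ ρ := by linarith
  -- The number of powers of `chartExp v` for which `n ‖v‖ ≤ ρ / 2`: by linear growth their
  -- coordinates stay below `3 ρ / 4`, while `n ‖v‖` still reaches `ρ / 4`.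
  set n : ℕ := ⌊ρ / (2 * ‖v‖)⌋₊ with hn
  have hn1 : (n : ℝ) * ‖v‖ ≤ ρ / 2 := by
    have := Nat.floor_le (a := ρ / (2 * ‖v‖)) (by positivity)
    rw [le_div_iff₀ (by positivity)] at this
    linarith
  have hn2 : ρ / 4 ≤ n * ‖v‖ := by
    have := Nat.lt_floor_add_one (ρ / (2 * ‖v‖))
    rw [div_lt_iff₀ (by positivity), ← hn] at this
    nlinarith
  have hpow : ∀ k ≤ n, ‖(chartLog ((chartExp v : N) ^ k) : E)‖ ≤ ρ ∧
      (chartExp v : N) ^ k ∈ (chartAt E (1 : N)).source := by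
    intro k
    induction k using Nat.strong_induction_on with
    | _ k ih =>
      intro hk
      obtain ⟨h1, h2⟩ := norm_chartLog_pow_sub_le hmul hvρ k fun j hj =>
        (ih j hj (by omega)).1
      refine ⟨?_, h1⟩
      have h3 := norm_add_le ((chartLog ((chartExp v : N) ^ k) : E) - (k : ℝ) • v) ((k : ℝ) • v)
      rw [sub_add_cancel, norm_smul, Real.norm_natCast] at h3
      have h4 : (k : ℝ) * ‖v‖ ≤ n * ‖v‖ := by gcongr
      linarith
  have hWpow : ∀ k ≤ n, (φ.toFun (-t) (chartExp v)) ^ k ∈ (chartAt E (1 : N)).source ∧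
      ‖(chartLog ((φ.toFun (-t) (chartExp v)) ^ k) : E)‖ ≤ r := by
    intro k hk
    rw [← map_pow]
    refine hT t ht _ ⟨chartLog ((chartExp v : N) ^ k), ?_, chartExp_chartLog (hpow k hk).2⟩
    exact mem_closedBall_zero_iff.2 (hpow k hk).1
  have hn0 : 1 ≤ n := by
    by_contra h
    have : n = 0 := by omega
    rw [this] at hn2
    norm_num at hn2
    linarith
  set u : E := chartLog (φ.toFun (-t) (chartExp v)) with hu
  obtain ⟨hs1, hr1⟩ := hWpow 1 hn0
  rw [pow_one] at hs1 hr1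
  have hue : chartExp u = φ.toFun (-t) (chartExp v) := chartExp_chartLog hs1
  have hrρ : r ≤ ρ := min_le_left _ _
  obtain ⟨-, h5⟩ := norm_chartLog_pow_sub_le hmul (v := u) (hr1.trans hrρ) n fun k hk => by
    rw [hue]
    exact (hWpow k hk.le).2.trans hrρ
  rw [hue] at h5
  have h6 := norm_sub_le ((chartLog ((φ.toFun (-t) (chartExp v)) ^ n) : E))
    (chartLog ((φ.toFun (-t) (chartExp v)) ^ n) - (n : ℝ) • u)
  rw [sub_sub_cancel, norm_smul, Real.norm_natCast] at h6
  have h7 := (hWpow n le_rfl).2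
  have h8 : r ≤ ε * ρ / 8 := min_le_right _ _
  have h9 : (n : ℝ) * ‖u‖ ≤ ε * (n * ‖v‖) := by
    have : ε * (ρ / 4) ≤ ε * (n * ‖v‖) := by gcongr
    linarith
  have hnpos : (0 : ℝ) < n := by exact_mod_cast hn0
  nlinarith

end Contraction

/-! ### The gap function, critical heights and the metric on `N` -/

section Gap

variable {E N : Type*} [NormedAddCommGroup E] [NormedSpace ℝ E] [FiniteDimensional ℝ E]
  [TopologicalSpace N] [ChartedSpace E N] [Group N] [LieGroup 𝓘(ℝ, E) ∞ N]

theorem ExpandingFlow.exists_nrm_lin_le (φ : ExpandingFlow E N) (q q' : LieInner E N) (R : ℝ) :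
    ∃ K : ℝ, 0 < K ∧ ∀ t, |t| ≤ R → ∀ v, q'.nrm (φ.lin t v) ≤ K * q.nrm v := by
  obtain ⟨K, hK, h⟩ := φ.exists_norm_lin_le R
  obtain ⟨a, _, ha, _, hab⟩ := q.exists_nrm_bounds
  obtain ⟨_, b, _, hb, hab'⟩ := q'.exists_nrm_bounds
  refine ⟨b * K / a, by positivity, fun t ht v => ?_⟩
  calc q'.nrm (φ.lin t v) ≤ b * ‖φ.lin t v‖ := (hab' _).2
    _ ≤ b * (K * ‖v‖) := by
      gcongr
      exact ((φ.lin t).le_opNorm v).trans (by gcongr; exact h t ht)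
    _ = b * K / a * (a * ‖v‖) := by field_simp
    _ ≤ b * K / a * q.nrm v := by
      gcongr
      exact (hab v).1

/-- The flow contracts the metric `q` by the factor `6` in the time `δ`. -/
def ExpandingFlow.ContractsBy (φ : ExpandingFlow E N) (q : LieInner E N) (δ : ℝ) : Prop :=
  ∀ u ≥ δ, ∀ v, q.nrm (φ.lin (-u) v) ≤ 1 / 6 * q.nrm v

theorem ExpandingFlow.exists_contractsBy (φ : ExpandingFlow E N) (q : LieInner E N) :
    ∃ T : ℝ, 0 < T ∧ φ.ContractsBy q T := by
  obtain ⟨a, b, ha, hb, hab⟩ := q.exists_nrm_bounds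
  obtain ⟨T, hT⟩ := φ.exists_norm_lin_neg_le (ε := a / (6 * b)) (by positivity)
  refine ⟨max T 1, by positivity, fun u hu v => ?_⟩
  calc q.nrm (φ.lin (-u) v) ≤ b * ‖φ.lin (-u) v‖ := (hab _).2
    _ ≤ b * (a / (6 * b) * ‖v‖) := by
      gcongr
      exact ((φ.lin (-u)).le_opNorm v).trans
        (by gcongr; exact hT u ((le_max_left _ _).trans hu))
    _ = 1 / 6 * (a * ‖v‖) := by field_simp
    _ ≤ 1 / 6 * q.nrm v := by
      gcongr
      exact (hab v).1

theorem ExpandingFlow.rescale_lin (φ : ExpandingFlow E N) (c : ℝ) (hc : 0 < c) (t : ℝ) :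
    (φ.rescale c hc).lin t = φ.lin (c * t) := rfl

theorem ExpandingFlow.ContractsBy.rescale {φ : ExpandingFlow E N} {q : LieInner E N} {T c δ : ℝ}
    (h : φ.ContractsBy q T) (hc : 0 < c) (hT : T ≤ c * δ) :
    (φ.rescale c hc).ContractsBy q δ := fun u hu v => by
  rw [φ.rescale_lin, mul_neg]
  exact h _ (hT.trans (by gcongr)) v

/-- The distance of `g` and `g'` in the leaf at height `H`. -/
def ExpandingFlow.gap (φ : ExpandingFlow E N) (q : LieInner E N) (g g' : N) (H : ℝ) : ℝ :=
  q.rdist (φ.toFun (-H) g) (φ.toFun (-H) g')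

section
variable (φ : ExpandingFlow E N) (q : LieInner E N)

theorem ExpandingFlow.gap_nonneg (g g' : N) (H : ℝ) : 0 ≤ φ.gap q g g' H := q.rdist_nonneg _ _

theorem ExpandingFlow.gap_self (g : N) (H : ℝ) : φ.gap q g g H = 0 := q.rdist_self _

theorem ExpandingFlow.gap_comm (g g' : N) (H : ℝ) : φ.gap q g g' H = φ.gap q g' g H :=
  q.rdist_comm _ _

variable [ConnectedSpace N]

theorem ExpandingFlow.gap_triangle (g g' g'' : N) (H : ℝ) :
    φ.gap q g g'' H ≤ φ.gap q g g' H + φ.gap q g' g'' H := q.rdist_triangle _ _ _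

theorem ExpandingFlow.gap_flow_le (q' : LieInner E N) {H H' K : ℝ} (hK : 0 < K)
    (h : ∀ v, q'.nrm (φ.lin (-(H' - H)) v) ≤ K * q.nrm v) (g g' : N) :
    φ.gap q' g g' H' ≤ K * φ.gap q g g' H := by
  have := q.rdist_flow_le φ q' (-(H' - H)) hK h (φ.toFun (-H) g) (φ.toFun (-H) g')
  rw [← φ.apply_add, ← φ.apply_add] at this
  rwa [show -(H' - H) + -H = -H' by ring] at this

theorem ExpandingFlow.continuous_gap (g g' : N) : Continuous (φ.gap q g g') := by
  have h : ∀ g : N, Continuous fun H : ℝ => φ.toFun (-H) g := fun g =>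
    φ.contMDiff_uncurry.continuous.comp (continuous_neg.prodMk continuous_const)
  exact q.continuous_rdist (h g) (h g')

theorem ExpandingFlow.eq_of_gap_eq_zero {g g' : N} {H : ℝ} (h : φ.gap q g g' H = 0) : g = g' := by
  have := q.eq_of_rdist_eq_zero h
  rw [← φ.apply_neg_self H g, this, φ.apply_neg_self]

/-- The flow over bounded times distorts lengths boundedly. With `R = 0` this compares the metric
`q` of the model with the metric `q'` of the Heintze group in one leaf. -/
theorem ExpandingFlow.exists_gap_le (q q' : LieInner E N) (R : ℝ) : ∃ K : ℝ, 0 < K ∧ ∀ g g' H H',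
    |H' - H| ≤ R → φ.gap q' g g' H' ≤ K * φ.gap q g g' H := by
  obtain ⟨K, hK, h⟩ := φ.exists_nrm_lin_le q q' R
  exact ⟨K, hK, fun g g' H H' hH => φ.gap_flow_le q q' hK (h _ (by rwa [abs_neg])) g g'⟩

variable {φ q}

theorem ExpandingFlow.ContractsBy.gap_le {δ : ℝ} (h : φ.ContractsBy q δ) (g g' : N) {H H' : ℝ}
    (hH : H + δ ≤ H') : φ.gap q g g' H' ≤ 1 / 6 * φ.gap q g g' H :=
  φ.gap_flow_le q q (by norm_num) (h _ (by linarith)) g g'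

/-- Since `δ ≤ 1` and `1/6 ≤ e⁻¹`, each unit step contracts at least by `e⁻¹`. The last fractional
step costs a bounded factor, absorbed in `C`. -/
theorem ExpandingFlow.ContractsBy.exists_gap_le_exp {δ : ℝ} (h : φ.ContractsBy q δ) (hδ : δ ≤ 1) :
    ∃ C : ℝ, 0 < C ∧ ∀ g g' H H', H ≤ H' →
      φ.gap q g g' H' ≤ C * Real.exp (H - H') * φ.gap q g g' H := by
  obtain ⟨K, hK, hw⟩ := φ.exists_gap_le q q 1
  refine ⟨K * Real.exp 1, by positivity, fun g g' H H' hH => ?_⟩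
  have hn : ∀ n : ℕ, φ.gap q g g' (H + n) ≤ Real.exp (-n) * φ.gap q g g' H := by
    intro n
    induction n with
    | zero => simp
    | succ n ih =>
      have h1 := h.gap_le g g' (H := H + n) (H' := H + (n + 1 : ℕ)) (by push_cast; linarith)
      have h2 : (1 / 6 : ℝ) ≤ Real.exp (-1) := by
        rw [Real.exp_neg, one_div]
        exact inv_anti₀ (Real.exp_pos 1) (by linarith [Real.exp_one_lt_d9])
      have h3 : Real.exp (-((n + 1 : ℕ) : ℝ)) = Real.exp (-1) * Real.exp (-n) := by
        rw [← Real.exp_add]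
        congr 1
        push_cast
        ring
      rw [h3, mul_assoc]
      refine h1.trans ?_
      gcongr
      exact φ.gap_nonneg q _ _ _
  set n := ⌊H' - H⌋₊ with hnd
  have h1 : (n : ℝ) ≤ H' - H := Nat.floor_le (by linarith)
  have h2 : H' - H < n + 1 := Nat.lt_floor_add_one _
  have h3 := hw g g' (H + n) H' (by rw [abs_le]; constructor <;> linarith)
  calc φ.gap q g g' H' ≤ K * (Real.exp (-n) * φ.gap q g g' H) := h3.trans (by gcongr; exact hn n)
    _ ≤ K * ((Real.exp 1 * Real.exp (H - H')) * φ.gap q g g' H) := by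
      gcongr
      · exact φ.gap_nonneg q _ _ _
      · rw [← Real.exp_add]
        exact Real.exp_le_exp.2 (by linarith)
    _ = _ := by ring

theorem ExpandingFlow.ContractsBy.tendsto_gap_atTop {δ : ℝ} (h : φ.ContractsBy q δ) (hδ : δ ≤ 1)
    (g g' : N) : Tendsto (φ.gap q g g') atTop (𝓝 0) := by
  obtain ⟨C, hC, hg⟩ := h.exists_gap_le_exp hδ
  have h1 : Tendsto (fun H : ℝ => C * Real.exp (0 - H) * φ.gap q g g' 0) atTop (𝓝 0) := by
    have : Tendsto (fun H : ℝ => Real.exp (0 - H)) atTop (𝓝 0) := by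
      simpa using Real.tendsto_exp_neg_atTop_nhds_zero
    simpa using (this.const_mul C).mul_const (φ.gap q g g' 0)
  refine tendsto_of_tendsto_of_tendsto_of_le_of_le' tendsto_const_nhds h1
    (Eventually.of_forall fun _ => φ.gap_nonneg q _ _ _) ?_
  filter_upwards [eventually_ge_atTop 0] with H hH using hg g g' 0 H hH

/-- Exponential decay read backwards from height `0`, where the gap of distinct points is positive.
-/
theorem ExpandingFlow.ContractsBy.tendsto_gap_atBot {δ : ℝ} (h : φ.ContractsBy q δ) (hδ : δ ≤ 1)
    {g g' : N} (hne : g ≠ g') : Tendsto (φ.gap q g g') atBot atTop := by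
  obtain ⟨C, hC, hg⟩ := h.exists_gap_le_exp hδ
  have hpos : 0 < φ.gap q g g' 0 :=
    lt_of_le_of_ne (φ.gap_nonneg q _ _ _) fun h0 => hne (φ.eq_of_gap_eq_zero q h0.symm)
  have h1 : Tendsto (fun H : ℝ => φ.gap q g g' 0 / C * Real.exp (-H)) atBot atTop :=
    (Real.tendsto_exp_atTop.comp tendsto_neg_atBot_atTop).const_mul_atTop (by positivity)
  refine tendsto_atTop_mono' _ ?_ h1
  filter_upwards [eventually_le_atBot 0] with H hH
  have h2 := hg g g' H 0 hH
  rw [sub_zero] at h2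
  rw [div_mul_eq_mul_div, div_le_iff₀ hC, Real.exp_neg, mul_inv_le_iff₀ (Real.exp_pos H)]
  linarith

/-- The critical height of two points of `N`, at which their distance is one. -/
theorem ExpandingFlow.ContractsBy.exists_critical {δ : ℝ} (h : φ.ContractsBy q δ) (hδ : δ ≤ 1)
    {g g' : N} (hne : g ≠ g') (a : ℝ) : ∃ τ : ℝ, dPhi φ q a g g' = a ^ τ ∧ φ.gap q g g' τ = 1 ∧
      (∀ t, φ.gap q g g' t ≤ 1 → τ ≤ t) ∧ ∀ t, τ + δ ≤ t → φ.gap q g g' t ≤ 1 / 6 := by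
  set S : Set ℝ := {t | φ.gap q g g' t = 1} with hS
  have hcont := φ.continuous_gap q g g'
  -- The gap exceeds 1 far below `t`, so it takes the value 1 in between. The gap need not be
  -- monotone; this is what still makes the smallest solution a lower bound for all heights with gap
  -- at most 1.
  have hex : ∀ t, φ.gap q g g' t ≤ 1 → ∃ s ∈ S, s ≤ t := by
    intro t ht
    obtain ⟨s, hs1, hs2⟩ := ((h.tendsto_gap_atBot hδ hne).eventually_ge_atTop 1).and
      (eventually_le_atBot t) |>.exists
    obtain ⟨u, hu, hu'⟩ := intermediate_value_Icc' hs2 hcont.continuousOn ⟨ht, hs1⟩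
    exact ⟨u, hu', hu.2⟩
  have hne' : S.Nonempty := by
    obtain ⟨t, ht⟩ := ((h.tendsto_gap_atTop hδ g g').eventually (ge_mem_nhds one_pos)).exists
    obtain ⟨s, hs, -⟩ := hex t ht
    exact ⟨s, hs⟩
  have hbdd : BddBelow S := by
    obtain ⟨b, hb⟩ := eventually_atBot.1 ((h.tendsto_gap_atBot hδ hne).eventually_gt_atTop 1)
    refine ⟨b, fun t ht => ?_⟩
    by_contra hlt
    have := hb t (not_le.1 hlt).le
    rw [show φ.gap q g g' t = 1 from ht] at this
    exact lt_irrefl _ this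
  have hcl : IsClosed S := isClosed_eq hcont continuous_const
  have hmem : sInf S ∈ S := hcl.csInf_mem hne' hbdd
  refine ⟨sInf S, ?_, hmem, fun t ht => ?_, fun t ht => ?_⟩
  · unfold dPhi
    rw [if_neg hne]
    congr 2
    ext t
    have : φ.gap q g g' t = 1 ↔ q.nDist (φ.toFun (-t) g) (φ.toFun (-t) g') = 1 := by
      rw [← q.ofReal_rdist, ENNReal.ofReal_eq_one]
      rfl
    exact this.symm
  · obtain ⟨s, hs, hst⟩ := hex t ht
    exact (csInf_le hbdd hs).trans hst
  · have := h.gap_le g g' ht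
    rwa [show φ.gap q g g' (sInf S) = 1 from hmem, mul_one] at this

end

/-- In base `a`, a sufficiently contracting flow defines a quasi-metric with constant `2` on `N`,
which is bilipschitz to a metric. -/
theorem ExpandingFlow.ContractsBy.exists_metric [ConnectedSpace N] {φ : ExpandingFlow E N}
    {q : LieInner E N} {δ a : ℝ} (h : φ.ContractsBy q δ) (hδ : δ ≤ 1) (ha : 1 < a)
    (haδ : a ^ δ ≤ 2) : ∃ ρ : N → N → ℝ, IsMetric ρ ∧ IsBilipschitz ρ (dPhi φ q a) id := by
  have ha0 : 0 < a := by linarith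
  have hself : ∀ x, dPhi φ q a x x = 0 := fun x => by simp [dPhi]
  have hpos : ∀ x y, x ≠ y → 0 < dPhi φ q a x y := fun x y hxy => by
    obtain ⟨τ, h1, -⟩ := h.exists_critical hδ hxy a
    rw [h1]
    exact Real.rpow_pos_of_pos ha0 _
  have hnn : ∀ x y, 0 ≤ dPhi φ q a x y := fun x y => by
    by_cases hxy : x = y
    · rw [hxy, hself]
    · exact (hpos x y hxy).le
  have hcomm : ∀ x y, dPhi φ q a x y = dPhi φ q a y x := fun x y => by
    rcases eq_or_ne x y with rfl | hne
    · rfl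
    · unfold dPhi
      rw [if_neg hne, if_neg hne.symm]
      simp only [q.nDist_comm]
  -- the critical height bound as a statement about `dPhi`
  have hsmall : ∀ x y t, dPhi φ q a x y ≤ a ^ t → ∀ s, t + δ ≤ s → φ.gap q x y s ≤ 1 / 6 := by
    intro x y t hxy s hs
    by_cases he : x = y
    · rw [he, φ.gap_self]
      norm_num
    · obtain ⟨τ, h1, -, -, h4⟩ := h.exists_critical hδ he a
      rw [h1, Real.rpow_le_rpow_left_iff ha] at hxy
      exact h4 s (by linarith)
  set d : N → N → ℝ≥0 := fun x y => ⟨dPhi φ q a x y, hnn x y⟩ with hd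
  -- If the three distances are at most `a ^ t`, each gap is at most `1/6` at height `t + δ`. Their
  -- sum is at most `1/2`, so the critical height of the outer pair is at most `t + δ`, and `a ^ δ ≤
  -- 2`.
  have hquad : ∀ x₁ x₂ x₃ x₄, dPhi φ q a x₁ x₄ ≤
      2 * max (dPhi φ q a x₁ x₂) (max (dPhi φ q a x₂ x₃) (dPhi φ q a x₃ x₄)) := by
    intro x₁ x₂ x₃ x₄
    set M := max (dPhi φ q a x₁ x₂) (max (dPhi φ q a x₂ x₃) (dPhi φ q a x₃ x₄)) with hM
    by_cases h14 : x₁ = x₄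
    · rw [h14, hself]
      have : 0 ≤ M := (hnn _ _).trans (le_max_left _ _)
      positivity
    have hMpos : 0 < M := by
      by_contra hle
      have h0 : ∀ x y, dPhi φ q a x y ≤ M → x = y := fun x y hxy => by
        by_contra hne
        have := hpos x y hne
        linarith
      exact h14 (((h0 _ _ (le_max_left _ _)).trans
        (h0 _ _ ((le_max_left _ _).trans (le_max_right _ _)))).trans
        (h0 _ _ ((le_max_right _ _).trans (le_max_right _ _))))
    set t := Real.logb a M with ht
    have hMt : M = a ^ t := (Real.rpow_logb ha0 ha.ne' hMpos).symm
    have k1 := hsmall x₁ x₂ t (hMt ▸ le_max_left _ _) (t + δ) le_rfl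
    have k2 := hsmall x₂ x₃ t (hMt ▸ (le_max_left _ _).trans (le_max_right _ _)) (t + δ) le_rfl
    have k3 := hsmall x₃ x₄ t (hMt ▸ (le_max_right _ _).trans (le_max_right _ _)) (t + δ) le_rfl
    have k4 := φ.gap_triangle q x₁ x₂ x₄ (t + δ)
    have k5 := φ.gap_triangle q x₂ x₃ x₄ (t + δ)
    obtain ⟨τ, h1, -, h3, -⟩ := h.exists_critical hδ h14 a
    have hτ := h3 (t + δ) (by linarith)
    rw [h1, hMt]
    calc a ^ τ ≤ a ^ (t + δ) := Real.rpow_le_rpow_of_exponent_le ha.le hτ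
      _ = a ^ δ * a ^ t := by rw [Real.rpow_add ha0, mul_comm]
      _ ≤ 2 * a ^ t := by gcongr
  have hd0 : ∀ x, d x x = 0 := fun x => NNReal.eq (hself x)
  have hdc : ∀ x y, d x y = d y x := fun x y => NNReal.eq (hcomm x y)
  -- The chain metric, the infimum of sums of `d` along finite chains. The four-point inequality
  -- with constant 2 is exactly the hypothesis under which it loses only a factor 2.
  let P := PseudoMetricSpace.ofPreNNDist d hd0 hdc
  have hle : ∀ x y, P.dist x y ≤ dPhi φ q a x y := fun x y =>
    PseudoMetricSpace.dist_ofPreNNDist_le d hd0 hdc x y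
  have hge : ∀ x y, dPhi φ q a x y ≤ 2 * P.dist x y := fun x y =>
    PseudoMetricSpace.le_two_mul_dist_ofPreNNDist d hd0 hdc
      (fun x₁ x₂ x₃ x₄ => NNReal.coe_le_coe.1 (by
        push_cast
        exact hquad x₁ x₂ x₃ x₄)) x y
  refine ⟨fun x y => P.dist x y, ⟨fun x y => ⟨fun hxy => ?_, ?_⟩, P.dist_comm, P.dist_triangle⟩,
    1, 2, one_pos, two_pos, fun x y => ?_⟩
  · by_contra hne
    have := hpos x y hne
    have := hge x y
    rw [hxy] at this
    linarith
  · rintro rfl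
    exact P.dist_self x
  · rw [one_mul]
    exact ⟨hle x y, hge x y⟩

end Gap

/-! ### The `ℓ²` product distance and induced path metrics -/

section PathMetric

theorem WithLp.prod_edist_le_ofReal {α β : Type*} [PseudoEMetricSpace α] [PseudoEMetricSpace β]
    {x y : WithLp 2 (α × β)} {r s : ℝ} (hr : 0 ≤ r) (hs : 0 ≤ s)
    (h1 : edist x.fst y.fst ≤ ENNReal.ofReal r) (h2 : edist x.snd y.snd ≤ ENNReal.ofReal s) :
    edist x y ≤ ENNReal.ofReal (Real.sqrt (r ^ 2 + s ^ 2)) := by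
  rw [WithLp.prod_edist_eq_add (by norm_num)]
  simp only [ENNReal.toReal_ofNat, ENNReal.rpow_ofNat]
  calc (edist x.fst y.fst ^ 2 + edist x.snd y.snd ^ 2) ^ (1 / 2 : ℝ)
      ≤ (ENNReal.ofReal r ^ 2 + ENNReal.ofReal s ^ 2) ^ (1 / 2 : ℝ) := by gcongr
    _ = _ := by
      rw [← ENNReal.ofReal_pow hr, ← ENNReal.ofReal_pow hs, ← ENNReal.ofReal_add (sq_nonneg _)
        (sq_nonneg _), ENNReal.ofReal_rpow_of_nonneg (by positivity) (by norm_num),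
        Real.sqrt_eq_rpow]

theorem WithLp.exists_of_prod_edist_le {α β : Type*} [PseudoEMetricSpace α] [PseudoEMetricSpace β]
    {x y : WithLp 2 (α × β)} {D : ℝ} (hD : 0 ≤ D) (h : edist x y ≤ ENNReal.ofReal D) :
    ∃ r s : ℝ, 0 ≤ r ∧ 0 ≤ s ∧ edist x.fst y.fst = ENNReal.ofReal r ∧
      edist x.snd y.snd = ENNReal.ofReal s ∧ r ^ 2 + s ^ 2 ≤ D ^ 2 := by
  rw [WithLp.prod_edist_eq_add (by norm_num)] at h
  simp only [ENNReal.toReal_ofNat, ENNReal.rpow_ofNat] at h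
  rw [one_div, ENNReal.rpow_inv_le_iff (by norm_num)] at h
  simp only [ENNReal.rpow_ofNat] at h
  rw [← ENNReal.ofReal_pow hD] at h
  have hfin : edist x.fst y.fst ^ 2 + edist x.snd y.snd ^ 2 ≠ ⊤ :=
    ne_top_of_le_ne_top ENNReal.ofReal_ne_top h
  have h1 : edist x.fst y.fst ≠ ⊤ := fun h0 => by simp [h0] at hfin
  have h2 : edist x.snd y.snd ≠ ⊤ := fun h0 => by simp [h0] at hfin
  refine ⟨_, _, ENNReal.toReal_nonneg, ENNReal.toReal_nonneg, (ENNReal.ofReal_toReal h1).symm,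
    (ENNReal.ofReal_toReal h2).symm, ?_⟩
  rw [← ENNReal.ofReal_toReal h1, ← ENNReal.ofReal_toReal h2,
    ← ENNReal.ofReal_pow ENNReal.toReal_nonneg, ← ENNReal.ofReal_pow ENNReal.toReal_nonneg,
    ← ENNReal.ofReal_add (sq_nonneg _) (sq_nonneg _)] at h
  exact (ENNReal.ofReal_le_ofReal_iff (sq_nonneg _)).1 h

/-- A bound for the induced path metric from a path whose increments are bounded by those of a
function `A`. -/
theorem inducedPathEDist_le_of_increments {M : Type*} [PseudoEMetricSpace M] {S : Set M}
    {f : ℝ → M} (hS : ∀ s ∈ Icc (0 : ℝ) 1, f s ∈ S) (hf : ContinuousOn f (Icc 0 1)) {A : ℝ → ℝ≥0∞}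
    (hA : ∀ s t, 0 ≤ s → s ≤ t → t ≤ 1 → A s + edist (f s) (f t) ≤ A t) :
    inducedPathEDist S ⟨f 0, hS 0 ⟨le_rfl, zero_le_one⟩⟩ ⟨f 1, hS 1 ⟨zero_le_one, le_rfl⟩⟩ ≤ A 1 := by
  let γ : Path (X := S) ⟨f 0, hS 0 ⟨le_rfl, zero_le_one⟩⟩ ⟨f 1, hS 1 ⟨zero_le_one, le_rfl⟩⟩ :=
    { toFun := fun s => ⟨f s, hS s s.2⟩
      continuous_toFun := by
        refine Continuous.subtype_mk ?_ _
        exact hf.comp_continuous continuous_subtype_val fun s => s.2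
      source' := rfl
      target' := rfl }
  refine iInf_le_of_le γ (iSup_le ?_)
  rintro ⟨n, u, hu, -⟩
  have key : ∀ n : ℕ, A (u 0) + ∑ i ∈ Finset.range n, edist (f (u (i + 1))) (f (u i)) ≤ A (u n) := by
    intro n
    induction n with
    | zero => simp
    | succ n ih =>
      rw [Finset.sum_range_succ, ← add_assoc]
      have h1 := hA (u n) (u (n + 1)) (u n).2.1 (hu (Nat.le_succ n)) (u (n + 1)).2.2
      rw [edist_comm] at h1
      exact (add_le_add_left ih _).trans h1
  have h1 : A (u n) ≤ A 1 := le_self_add.trans (hA (u n) 1 (u n).2.1 (u n).2.2 le_rfl)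
  exact (le_add_self.trans (key n)).trans h1

end PathMetric

/-! ### Points of the tree and merging of ascending rays -/

section TreePoints

variable {V : Type*} {m : ℕ} {T : OrientedRegularTree V m}

theorem OrientedRegularTree.height_iterate (v : V) (n : ℕ) :
    T.height (T.parent^[n] v) = T.height v + n := by
  induction n with
  | zero => simp
  | succ n ih =>
    rw [Function.iterate_succ_apply', T.height_parent, ih]
    push_cast
    ring

theorem TreePoint.height_ancestor (x : TreePoint T) {r : ℝ} (h : x.height ≤ r) :
    ⌊r⌋ = T.height (x.ancestor r) := by
  have h1 : T.height x.vertex ≤ ⌊r⌋ := x.floor_height ▸ Int.floor_le_floor h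
  rw [TreePoint.ancestor, T.height_iterate]
  omega

/-- The point at height `r` of the ascending ray from `x`. -/
def TreePoint.up (x : TreePoint T) (r : ℝ) (h : x.height ≤ r) : TreePoint T :=
  ⟨x.ancestor r, r, x.height_ancestor h⟩

theorem TreePoint.ancestor_self (x : TreePoint T) : x.ancestor x.height = x.vertex := by
  simp [TreePoint.ancestor, x.floor_height]

theorem TreePoint.ancestor_up (x : TreePoint T) {r s : ℝ} (h : x.height ≤ r) (hs : r ≤ s) :
    (x.up r h).ancestor s = x.ancestor s := by
  rw [x.ancestor_mono h hs, (x.up r h).ancestor_mono le_rfl hs]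
  congr 1
  exact (x.up r h).ancestor_self

theorem TreePoint.MeetAt.refl (x : TreePoint T) {r : ℝ} (h : x.height ≤ r) : x.MeetAt x r :=
  ⟨h, h, rfl⟩

theorem TreePoint.MeetAt.symm {x y : TreePoint T} {r : ℝ} (h : x.MeetAt y r) : y.MeetAt x r :=
  ⟨h.2.1, h.1, h.2.2.symm⟩

theorem TreePoint.MeetAt.trans {x y z : TreePoint T} {r : ℝ} (h : x.MeetAt y r)
    (h' : y.MeetAt z r) : x.MeetAt z r :=
  ⟨h.1, h'.2.1, h.2.2.trans h'.2.2⟩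

theorem TreePoint.meetAt_up (x : TreePoint T) {r s : ℝ} (h : x.height ≤ r) (hs : r ≤ s) :
    x.MeetAt (x.up r h) s :=
  ⟨h.trans hs, hs, (x.ancestor_up h hs).symm⟩

theorem TreePoint.edist_le_of_meetAt {x y : TreePoint T} {r : ℝ} (h : x.MeetAt y r) :
    edist x y ≤ ENNReal.ofReal ((r - x.height) + (r - y.height)) := iInf₂_le r h

theorem TreePoint.edist_up_le (x : TreePoint T) {r : ℝ} (h : x.height ≤ r) :
    edist x (x.up r h) ≤ ENNReal.ofReal (r - x.height) := by
  refine (TreePoint.edist_le_of_meetAt (x.meetAt_up h le_rfl)).trans_eq ?_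
  simp [TreePoint.up]

theorem TreePoint.meetAt_of_edist_lt {x y : TreePoint T} {r : ℝ}
    (h : edist x y < ENNReal.ofReal ((r - x.height) + (r - y.height))) : x.MeetAt y r := by
  obtain ⟨s, hs⟩ := iInf_lt_iff.1 h
  obtain ⟨hs, hlt⟩ := iInf_lt_iff.1 hs
  refine hs.mono ?_
  by_contra hrs
  exact absurd hlt (not_lt.2 (ENNReal.ofReal_le_ofReal (by linarith [not_le.1 hrs])))

theorem TreePoint.ofReal_abs_height_le (x y : TreePoint T) :
    ENNReal.ofReal |y.height - x.height| ≤ edist x y := by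
  refine le_iInf₂ fun r hr => ENNReal.ofReal_le_ofReal ?_
  rw [abs_le]
  constructor <;> linarith [hr.1, hr.2.1]

/-- Two points of the tree have a common ancestor. -/
theorem OrientedRegularTree.exists_common_ancestor (T : OrientedRegularTree V m) (v w : V) :
    ∃ k l : ℕ, T.parent^[k] v = T.parent^[l] w := by
  obtain ⟨p⟩ := T.isTree.connected.preconnected v w
  induction p with
  | nil => exact ⟨0, 0, rfl⟩
  | cons h p ih =>
    obtain ⟨k, l, hkl⟩ := ih
    rcases (T.adj_iff _ _).1 h with h | h
    · exact ⟨k + 1, l, by rw [Function.iterate_succ_apply, h, hkl]⟩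
    · refine ⟨k, l + 1, ?_⟩
      rw [← h, ← Function.iterate_succ_apply T.parent k, Function.iterate_succ_apply', hkl,
        ← Function.iterate_succ_apply' T.parent l]

theorem TreePoint.exists_meetAt (x y : TreePoint T) : ∃ r, x.MeetAt y r := by
  obtain ⟨k, l, h⟩ := T.exists_common_ancestor x.vertex y.vertex
  have h1 := T.height_iterate x.vertex k
  have h2 := T.height_iterate y.vertex l
  have h3 : T.height x.vertex + k = T.height y.vertex + l := by rw [← h1, ← h2, h]
  have f1 := x.floor_height
  have f2 := y.floor_height
  have g1 := Int.lt_floor_add_one x.height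
  have g2 := Int.lt_floor_add_one y.height
  -- One level above the common ancestor, because a point lies strictly above its vertex if it is
  -- inside an edge, and then possibly above the ancestor itself.
  refine ⟨((T.height x.vertex + k + 1 : ℤ) : ℝ), ?_, ?_, ?_⟩
  · rw [f1] at g1
    push_cast
    have : (0 : ℝ) ≤ k := Nat.cast_nonneg k
    linarith
  · rw [f2] at g2
    rw [h3]
    push_cast
    have : (0 : ℝ) ≤ l := Nat.cast_nonneg l
    linarith
  · unfold TreePoint.ancestor
    have e1 : (⌊((T.height x.vertex + k + 1 : ℤ) : ℝ)⌋ - T.height x.vertex).toNat = k + 1 := by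
      rw [Int.floor_intCast]; omega
    have e2 : (⌊((T.height x.vertex + k + 1 : ℤ) : ℝ)⌋ - T.height y.vertex).toNat = l + 1 := by
      rw [Int.floor_intCast]; omega
    rw [e1, e2, Function.iterate_succ_apply', Function.iterate_succ_apply', h]

end TreePoints

/-! ### Local estimates in the Heintze group -/

section HeintzeDistance

open MeasureTheory

variable {E N : Type*} [NormedAddCommGroup E] [NormedSpace ℝ E]
  [TopologicalSpace N] [ChartedSpace E N] [Group N] [LieGroup 𝓘(ℝ, E) ∞ N]
  (φ : ExpandingFlow E N) (q : LieInner E N)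

theorem ofReal_abs_height_le_heintzeEDist (x y : N × ℝ) :
    ENNReal.ofReal |y.2 - x.2| ≤ heintzeEDist φ q x y := by
  refine le_of_forall_gt fun r hr => ?_
  obtain ⟨g, h, rfl, rfl, -, hh, hl⟩ := exists_path_of_heintzeEDist_lt φ q hr
  refine lt_of_le_of_lt ?_ hl
  have := enorm_sub_le_lintegral_deriv_of_contDiffOn_Icc (f := h) (a := 0) (b := 1)
    hh.contDiffOn zero_le_one
  rw [← restrict_Ioo_eq_restrict_Icc] at this
  simp only [Real.enorm_eq_ofReal_abs] at this
  refine this.trans (lintegral_mono fun s => ENNReal.ofReal_le_ofReal ?_)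
  rw [← Real.sqrt_sq_eq_abs]
  exact Real.sqrt_le_sqrt (le_add_of_nonneg_right (sq_nonneg _))

theorem leftVelocity_const (g : N) (s : ℝ) : (leftVelocity (fun _ => g) s : E) = 0 := by
  unfold leftVelocity
  rw [mfderiv_const]
  rfl

theorem heintzeEDist_vertical_le (g : N) {s t : ℝ} (h : s ≤ t) :
    heintzeEDist φ q (g, s) (g, t) ≤ ENNReal.ofReal (t - s) := by
  refine (heintzeEDist_le_lintegral φ q (g := fun _ => g) (h := id) h contMDiffOn_const
    contDiffOn_id).trans_eq ?_
  have : ∀ u : ℝ, ENNReal.ofReal (Real.sqrt ((deriv (id : ℝ → ℝ) u) ^ 2 +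
      q.nrm (φ.lin (-id u) (leftVelocity (fun _ => g) u)) ^ 2)) = 1 := by
    intro u
    rw [leftVelocity_const, map_zero, q.nrm_zero]
    simp
  rw [lintegral_congr this]
  simp

/-- The length of a horizontal curve at height `h`. -/
theorem heintzeEDist_horizontal_le {γ : ℝ → N} (hγ : ContMDiff 𝓘(ℝ, ℝ) 𝓘(ℝ, E) 1 γ) (h : ℝ)
    {s t : ℝ} (hst : s ≤ t) :
    heintzeEDist φ q (φ.toFun h (γ s), h) (φ.toFun h (γ t), h) ≤
      ∫⁻ u in Ioc s t, ENNReal.ofReal (q.nrm (leftVelocity γ u)) := by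
  have hc : ContMDiff 𝓘(ℝ, ℝ) 𝓘(ℝ, E) 1 fun u => φ.toFun h (γ u) :=
    ((φ.contMDiff h).of_le (by exact_mod_cast le_top)).comp hγ
  refine (heintzeEDist_le_lintegral φ q (g := fun u => φ.toFun h (γ u)) (h := fun _ => h) hst
    hc.contMDiffOn contDiffOn_const).trans_eq ?_
  rw [restrict_Ioo_eq_restrict_Ioc]
  refine lintegral_congr fun u => ?_
  rw [φ.leftVelocity_comp h (hγ.mdifferentiable one_ne_zero u), ← φ.lin_add, neg_add_cancel,
    φ.lin_zero, deriv_const, zero_pow two_ne_zero, zero_add, Real.sqrt_sq (q.nrm_nonneg _)]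

variable [FiniteDimensional ℝ E] [ConnectedSpace N]

/-- For points at distance less than one, the height and the distance in the leaves are
orthogonal up to constants. -/
theorem exists_heintze_local_bound (q' : LieInner E N) : ∃ κ : ℝ, 0 < κ ∧
    ∀ (x y : N × ℝ) (D : ℝ), 0 ≤ D → D < 1 → heintzeEDist φ q x y ≤ ENNReal.ofReal D →
      (y.2 - x.2) ^ 2 + (κ * φ.gap q' x.1 y.1 x.2) ^ 2 ≤ D ^ 2 := by
  obtain ⟨K, hK0, hK⟩ := φ.exists_nrm_lin_le q q' 1
  refine ⟨1 / K, by positivity, fun x y D hD hD1 h => ?_⟩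
  set u := |y.2 - x.2| with hu
  set w := 1 / K * φ.gap q' x.1 y.1 x.2 with hw
  have hu0 : 0 ≤ u := abs_nonneg _
  have hw0 : 0 ≤ w := mul_nonneg (by positivity) (φ.gap_nonneg q' _ _ _)
  rw [← sq_abs (y.2 - x.2), ← hu]
  set R := Real.sqrt (u ^ 2 + w ^ 2) with hR
  have hRsq : R ^ 2 = u ^ 2 + w ^ 2 := Real.sq_sqrt (by positivity)
  have hR0 : 0 ≤ R := Real.sqrt_nonneg _
  by_cases hRz : R = 0
  · rw [← hRsq, hRz, zero_pow two_ne_zero]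
    exact sq_nonneg D
  have hRp : 0 < R := lt_of_le_of_ne hR0 (Ne.symm hRz)
  -- The path bound is used in the direction `(u / R, w / R)` of the displacement itself, where the
  -- linear functional attains the norm `R`.
  have key : ∀ L, D < L → L ≤ 1 → R ≤ L := by
    intro L hDL hL1
    have h1 := heintze_path_bound φ q q' hK0 hK hL1
      (h.trans_lt ((ENNReal.ofReal_lt_ofReal_iff (by linarith)).2 hDL))
      (a := u / R) (b := w / R) (by positivity) (by positivity)
      (by rw [div_pow, div_pow, ← add_div, ← hRsq, div_self (by positivity)])
    rw [← q'.ofReal_rdist, ← ENNReal.ofReal_mul (by positivity), ← ENNReal.ofReal_add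
      (by positivity) (mul_nonneg (by positivity) (q'.rdist_nonneg _ _)),
      ENNReal.ofReal_le_ofReal_iff (by linarith)] at h1
    have h2 : w / R / K * q'.rdist (φ.toFun (-x.2) x.1) (φ.toFun (-x.2) y.1) = w / R * w := by
      rw [hw, ExpandingFlow.gap]
      ring
    rw [h2] at h1
    have h3 : u / R * |y.2 - x.2| + w / R * w = R := by
      rw [← hu]
      field_simp
      linarith
    linarith
  have hRD : R ≤ D := by
    refine le_of_forall_gt_imp_ge_of_dense fun L hL => ?_
    rcases le_total L 1 with hL1 | hL1
    · exact key L hL hL1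
    · exact (key 1 hD1 le_rfl).trans hL1
  rw [← hRsq]
  exact pow_le_pow_left₀ hR0 hRD 2

end HeintzeDistance

/-! ### Chords, vertical and horizontal paths, and fine chains in the millefeuille space -/

namespace Millefeuille

open MeasureTheory

variable {E N V : Type*} [NormedAddCommGroup E] [NormedSpace ℝ E] [FiniteDimensional ℝ E]
  [TopologicalSpace N] [ChartedSpace E N] [Group N] [LieGroup 𝓘(ℝ, E) ∞ N] [ConnectedSpace N]
  {m : ℕ} {φ : ExpandingFlow E N} {qG : LieInner E N} {T : OrientedRegularTree V m}

/-- The component in `N` of a point of the millefeuille space. -/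
def base (x : Millefeuille φ qG T) : N := x.pt.1.fst.base

/-- The component in the tree of a point of the millefeuille space. -/
def leaf (x : Millefeuille φ qG T) : TreePoint T := x.pt.1.snd

variable (φ qG) in
/-- The point of the millefeuille space over `g ∈ N` and a point of the tree. -/
def of (g : N) (y : TreePoint T) : Millefeuille φ qG T :=
  ⟨⟨WithLp.toLp 2 (⟨g, y.height⟩, y), rfl⟩⟩

theorem leaf_height (x : Millefeuille φ qG T) : x.leaf.height = x.height := x.pt.2.symm

theorem of_base_leaf (x : Millefeuille φ qG T) : of φ qG x.base x.leaf = x := by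
  have h := x.leaf_height
  refine Millefeuille.ext (Subtype.ext ?_)
  change WithLp.toLp 2 ((⟨x.base, x.leaf.height⟩ : HeintzeGroup φ qG), x.leaf) = x.pt.1
  rw [h]
  rfl

/-- The distance in the ambient product, rescaled like the metric of the millefeuille space. -/
def chordEDist (x y : Millefeuille φ qG T) : ℝ≥0∞ :=
  ENNReal.ofReal (1 / Real.sqrt 2) * edist x.pt.1 y.pt.1

/-- The local estimates hold for the ambient chord distance. Path lengths enter only through chains
of short chords. -/
theorem chordEDist_le_edist (x y : Millefeuille φ qG T) : chordEDist x y ≤ edist x y := by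
  refine mul_le_mul_right (le_iInf fun γ => ?_) _
  have := eVariationOn.edist_le (fun t => (γ t : WithLp 2 (HeintzeGroup φ qG × TreePoint T)))
    (mem_univ 0) (mem_univ 1)
  simpa using this

theorem edist_pt_le_of_chord {x y : Millefeuille φ qG T} {d : ℝ}
    (h : chordEDist x y ≤ ENNReal.ofReal d) :
    edist x.pt.1 y.pt.1 ≤ ENNReal.ofReal (Real.sqrt 2 * d) := by
  have h2 : (0 : ℝ) < Real.sqrt 2 := by positivity
  calc edist x.pt.1 y.pt.1 = ENNReal.ofReal (Real.sqrt 2) * chordEDist x y := by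
        rw [chordEDist, ← mul_assoc, ← ENNReal.ofReal_mul h2.le, mul_one_div_cancel h2.ne',
          ENNReal.ofReal_one, one_mul]
    _ ≤ ENNReal.ofReal (Real.sqrt 2) * ENNReal.ofReal d := by gcongr
    _ = _ := (ENNReal.ofReal_mul h2.le).symm

theorem exists_of_chord_le {x y : Millefeuille φ qG T} {d : ℝ} (hd : 0 ≤ d)
    (h : chordEDist x y ≤ ENNReal.ofReal d) : ∃ r s : ℝ, 0 ≤ r ∧ 0 ≤ s ∧
      heintzeEDist φ qG (x.base, x.height) (y.base, y.height) = ENNReal.ofReal r ∧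
      edist x.leaf y.leaf = ENNReal.ofReal s ∧ |y.height - x.height| ≤ r ∧
      |y.height - x.height| ≤ s ∧ r ^ 2 + s ^ 2 ≤ 2 * d ^ 2 := by
  obtain ⟨r, s, hr, hs, h1, h2, h3⟩ := WithLp.exists_of_prod_edist_le (by positivity)
    (edist_pt_le_of_chord h)
  rw [mul_pow, Real.sq_sqrt (by norm_num)] at h3
  refine ⟨r, s, hr, hs, h1, h2, ?_, ?_, h3⟩
  · have := (ofReal_abs_height_le_heintzeEDist φ qG (x.base, x.height) (y.base, y.height)).trans
      h1.le
    exact (ENNReal.ofReal_le_ofReal_iff hr).1 this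
  · have := (TreePoint.ofReal_abs_height_le x.leaf y.leaf).trans h2.le
    rw [x.leaf_height, y.leaf_height] at this
    exact (ENNReal.ofReal_le_ofReal_iff hs).1 this

/-- Both components change height by the same amount, so `2 (Δh)² ≤ r² + s² ≤ 2 d²`. The factor
`1/√2` is there to make the height 1-Lipschitz with constant exactly one. -/
theorem abs_height_le_of_chord {x y : Millefeuille φ qG T} {d : ℝ} (hd : 0 ≤ d)
    (h : chordEDist x y ≤ ENNReal.ofReal d) : |y.height - x.height| ≤ d := by
  obtain ⟨r, s, hr, hs, -, -, h1, h2, h3⟩ := exists_of_chord_le hd h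
  refine abs_le_of_sq_le_sq' ?_ hd |> abs_le.2
  have := abs_nonneg (y.height - x.height)
  nlinarith [sq_abs (y.height - x.height)]

/-- The tree component moves by at most `√2 d ≤ 2 d`, so the ascending rays have met once the detour
over height `r` is longer than that. -/
theorem meetAt_of_chord {x y : Millefeuille φ qG T} {d r : ℝ} (hd : 0 ≤ d)
    (h : chordEDist x y ≤ ENNReal.ofReal d) (hr : 2 * d < (r - x.height) + (r - y.height)) :
    x.leaf.MeetAt y.leaf r := by
  obtain ⟨r', s, hr', hs, -, h2, -, -, h3⟩ := exists_of_chord_le hd h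
  refine TreePoint.meetAt_of_edist_lt ?_
  rw [h2, x.leaf_height, y.leaf_height]
  refine (ENNReal.ofReal_lt_ofReal_iff (by linarith)).2 (lt_of_le_of_lt ?_ hr)
  refine abs_le_of_sq_le_sq' ?_ (by linarith) |>.2
  nlinarith [sq_nonneg r', sq_nonneg d]

-- The tree component already uses up `(Δh)²` of the budget `2 d²`, so the Heintze component has `r²
-- ≤ 2 d² - (Δh)²` left for height and gap. The bound `d ≤ 1/2` ensures `r < 1`.
variable (φ qG T) in
theorem exists_chord_local_bound (q : LieInner E N) : ∃ κ : ℝ, 0 < κ ∧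
    ∀ (x y : Millefeuille φ qG T) (d : ℝ), 0 ≤ d → d ≤ 1 / 2 → chordEDist x y ≤ ENNReal.ofReal d →
      (y.height - x.height) ^ 2 + (κ * φ.gap q x.base y.base x.height) ^ 2 ≤ d ^ 2 := by
  obtain ⟨κ, hκ, hloc⟩ := exists_heintze_local_bound φ qG q
  refine ⟨κ / 2, by positivity, fun x y d hd hd1 h => ?_⟩
  obtain ⟨r, s, hr, hs, h1, -, -, h2, h3⟩ := exists_of_chord_le hd h
  have hr1 : r < 1 := by
    by_contra hr1
    nlinarith [not_lt.1 hr1, sq_nonneg s]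
  have h4 := hloc (x.base, x.height) (y.base, y.height) r hr hr1 h1.le
  simp only at h4
  have h5 : (y.height - x.height) ^ 2 ≤ s ^ 2 := by
    rw [← sq_abs]
    exact pow_le_pow_left₀ (abs_nonneg _) h2 2
  nlinarith [sq_nonneg (κ * φ.gap q x.base y.base x.height)]

theorem ofReal_abs_height_le_edist (x y : Millefeuille φ qG T) :
    ENNReal.ofReal |y.height - x.height| ≤ edist x y := by
  by_cases hfin : edist x y = ⊤
  · rw [hfin]; exact le_top
  have h := chordEDist_le_edist x y
  rw [← ENNReal.ofReal_toReal hfin] at h ⊢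
  exact ENNReal.ofReal_le_ofReal (abs_height_le_of_chord ENNReal.toReal_nonneg h)

/-- Both components move vertically at the same speed, so the `ℓ²` length is `√2` times the height,
and the rescaling cancels the factor. -/
theorem edist_vertical_le (g : N) (y : TreePoint T) {r : ℝ} (h : y.height ≤ r) :
    edist (of φ qG g y) (of φ qG g (y.up r h)) ≤ ENNReal.ofReal (r - y.height) := by
  set l := r - y.height with hl
  have hl0 : 0 ≤ l := sub_nonneg.2 h
  have hs2 : (0 : ℝ) < Real.sqrt 2 := by positivity
  -- The truncation `max s 0` keeps `up` meaningful for negative parameters; only `s ∈ [0, 1]`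
  -- matters.
  have hht : ∀ s : ℝ, y.height ≤ y.height + max s 0 * l := fun s =>
    le_add_of_nonneg_right (mul_nonneg (le_max_right _ _) hl0)
  set f : ℝ → WithLp 2 (HeintzeGroup φ qG × TreePoint T) := fun s =>
    (of φ qG g (y.up (y.height + max s 0 * l) (hht s))).pt.1 with hf
  have hinc : ∀ s t, 0 ≤ s → s ≤ t → edist (f s) (f t) ≤
      ENNReal.ofReal (Real.sqrt 2 * l * (t - s)) := by
    intro s t hs hst
    have hmax : ∀ s : ℝ, 0 ≤ s → max s 0 = s := fun s => max_eq_left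
    have hle : y.height + max s 0 * l ≤ y.height + max t 0 * l := by
      gcongr
    have e1 : (t - s) * l = y.height + max t 0 * l - (y.height + max s 0 * l) := by
      rw [hmax s hs, hmax t (hs.trans hst)]; ring
    have h0 : 0 ≤ (t - s) * l := mul_nonneg (by linarith) hl0
    have h1 : edist (f s).fst (f t).fst ≤ ENNReal.ofReal ((t - s) * l) := by
      rw [e1]
      exact heintzeEDist_vertical_le φ qG g hle
    have h2 : edist (f s).snd (f t).snd ≤ ENNReal.ofReal ((t - s) * l) := by
      rw [e1]
      have h3 := TreePoint.edist_up_le (y.up _ (hht s)) hle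
      have h4 : (y.up _ (hht s)).up _ hle = y.up _ (hht t) :=
        TreePoint.ext (y.ancestor_up (hht s) hle) rfl
      rw [h4] at h3
      exact h3
    refine (WithLp.prod_edist_le_ofReal h0 h0 h1 h2).trans_eq ?_
    rw [← two_mul, Real.sqrt_mul (by norm_num), Real.sqrt_sq h0]
    congr 1
    ring
  have hcont : ContinuousOn f (Icc 0 1) := by
    intro s hs
    rw [ContinuousWithinAt, tendsto_iff_edist_tendsto_0]
    have h1 : Tendsto (fun t : ℝ => ENNReal.ofReal (Real.sqrt 2 * l * |t - s|)) (𝓝[Icc 0 1] s)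
        (𝓝 0) := by
      have : Continuous fun t : ℝ => ENNReal.ofReal (Real.sqrt 2 * l * |t - s|) :=
        ENNReal.continuous_ofReal.comp (by fun_prop)
      have h2 := this.tendsto s
      simp only [sub_self, abs_zero, mul_zero, ENNReal.ofReal_zero] at h2
      exact h2.mono_left nhdsWithin_le_nhds
    refine tendsto_of_tendsto_of_tendsto_of_le_of_le' tendsto_const_nhds h1
      (Eventually.of_forall fun _ => zero_le) ?_
    filter_upwards [self_mem_nhdsWithin] with t ht
    rcases le_total s t with hst | hst
    · rw [abs_of_nonneg (sub_nonneg.2 hst), edist_comm]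
      exact hinc s t hs.1 hst
    · rw [abs_sub_comm, abs_of_nonneg (sub_nonneg.2 hst)]
      exact hinc t s ht.1 hst
  have hmain := inducedPathEDist_le_of_increments (S := millefeuilleSet φ qG T) (f := f)
    (A := fun s => ENNReal.ofReal (Real.sqrt 2 * l * s))
    (fun s _ => (of φ qG g (y.up _ (hht s))).pt.2) hcont (fun s t hs hst _ => by
      have hc : 0 ≤ Real.sqrt 2 * l := by positivity
      refine (add_le_add_right (hinc s t hs hst) _).trans_eq ?_
      rw [← ENNReal.ofReal_add (mul_nonneg hc hs) (mul_nonneg hc (by linarith))]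
      congr 1
      ring)
  have e0 : (⟨f 0, (of φ qG g (y.up _ (hht 0))).pt.2⟩ : millefeuilleSet φ qG T) =
      (of φ qG g y).pt := by
    have : y.up _ (hht 0) = y := by
      refine TreePoint.ext ?_ ?_
      · change y.ancestor _ = _
        rw [show y.height + max (0 : ℝ) 0 * l = y.height by simp]
        exact y.ancestor_self
      · change y.height + max (0 : ℝ) 0 * l = y.height
        simp
    exact congrArg (fun z => (of φ qG g z).pt) this
  have e1 : (⟨f 1, (of φ qG g (y.up _ (hht 1))).pt.2⟩ : millefeuilleSet φ qG T) =
      (of φ qG g (y.up r h)).pt := by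
    have hr : y.height + max (1 : ℝ) 0 * l = r := by simp [hl]
    have : y.up _ (hht 1) = y.up r h := by
      refine TreePoint.ext ?_ hr
      change y.ancestor _ = y.ancestor _
      rw [hr]
    exact congrArg (fun z => (of φ qG g z).pt) this
  rw [e0, e1] at hmain
  refine (mul_le_mul_right hmain _).trans_eq ?_
  rw [← ENNReal.ofReal_mul (by positivity)]
  congr 1
  field_simp

/-- An almost shortest path in the leaf is transported to height `h` by `φ_h` while the tree
component stays fixed. The rescaling factor is at most one and is dropped. -/
theorem edist_horizontal_le (g g' : N) (y : TreePoint T) :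
    edist (of φ qG g y) (of φ qG g' y) ≤ ENNReal.ofReal (φ.gap qG g g' y.height) := by
  set h := y.height with hh
  rw [ExpandingFlow.gap, qG.ofReal_rdist]
  refine le_of_forall_gt fun r hr => ?_
  obtain ⟨γ, hγ0, hγ1, hγ, hl⟩ := qG.exists_path_of_nDist_lt hr
  have hind : inducedPathEDist (millefeuilleSet φ qG T) (of φ qG g y).pt (of φ qG g' y).pt ≤
      ∫⁻ u in Ioc (0 : ℝ) 1, ENNReal.ofReal (qG.nrm (leftVelocity γ u)) := by
    set f : ℝ → WithLp 2 (HeintzeGroup φ qG × TreePoint T) := fun s =>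
      (of φ qG (φ.toFun h (γ s)) y).pt.1 with hf
    have hinc : ∀ s t, s ≤ t → edist (f s) (f t) ≤
        ∫⁻ u in Ioc s t, ENNReal.ofReal (qG.nrm (leftVelocity γ u)) := by
      intro s t hst
      have h1 : edist (f s).fst (f t).fst ≤
          ∫⁻ u in Ioc s t, ENNReal.ofReal (qG.nrm (leftVelocity γ u)) :=
        heintzeEDist_horizontal_le φ qG hγ h hst
      have h2 : edist (f s).snd (f t).snd = 0 := edist_self y
      refine le_trans (le_of_eq ?_) h1
      rw [WithLp.prod_edist_eq_add (by norm_num), h2]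
      simp only [ENNReal.toReal_ofNat, ENNReal.rpow_ofNat]
      rw [zero_pow two_ne_zero, add_zero, ← ENNReal.rpow_natCast, ← ENNReal.rpow_mul]
      norm_num
    have hfin : ∫⁻ u in Ioc (0 : ℝ) 1, ENNReal.ofReal (qG.nrm (leftVelocity γ u)) ≠ ⊤ := by
      rw [← restrict_Ioo_eq_restrict_Ioc]
      exact hl.ne_top
    have hcont : ContinuousOn f (Icc 0 1) := by
      intro s hs
      rw [ContinuousWithinAt, tendsto_iff_edist_tendsto_0]
      -- Continuity of the lifted path follows from absolute continuity of the integral of its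
      -- finite length density.
      have h1 : Tendsto (fun t : ℝ => ∫⁻ u in uIoc s t,
          ENNReal.ofReal (qG.nrm (leftVelocity γ u)) ∂(volume.restrict (Ioc (0 : ℝ) 1)))
          (𝓝[Icc 0 1] s) (𝓝 0) := by
        refine tendsto_setLIntegral_zero hfin ?_
        have h2 : Tendsto (fun t : ℝ => ENNReal.ofReal |t - s|) (𝓝[Icc 0 1] s) (𝓝 0) := by
          have : Continuous fun t : ℝ => ENNReal.ofReal |t - s| :=
            ENNReal.continuous_ofReal.comp (by fun_prop)
          have h2 := this.tendsto s
          simp only [sub_self, abs_zero, ENNReal.ofReal_zero] at h2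
          exact h2.mono_left nhdsWithin_le_nhds
        refine tendsto_of_tendsto_of_tendsto_of_le_of_le tendsto_const_nhds h2
          (fun _ => zero_le) fun t => ?_
        refine (Measure.restrict_apply_le _ _).trans ?_
        rw [Real.volume_uIoc]
      refine tendsto_of_tendsto_of_tendsto_of_le_of_le' tendsto_const_nhds h1
        (Eventually.of_forall fun _ => zero_le) ?_
      filter_upwards [self_mem_nhdsWithin] with t ht
      rw [Measure.restrict_restrict measurableSet_uIoc]
      rcases le_total s t with hst | hst
      · rw [uIoc_of_le hst, inter_eq_left.2 (Ioc_subset_Ioc hs.1 ht.2), edist_comm]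
        exact hinc s t hst
      · rw [uIoc_of_ge hst, inter_eq_left.2 (Ioc_subset_Ioc ht.1 hs.2)]
        exact hinc t s hst
    have hmain := inducedPathEDist_le_of_increments (S := millefeuilleSet φ qG T) (f := f)
      (A := fun s => ∫⁻ u in Ioc 0 s, ENNReal.ofReal (qG.nrm (leftVelocity γ u)))
      (fun s _ => (of φ qG _ y).pt.2) hcont (fun s t hs hst _ => by
        refine (add_le_add_right (hinc s t hst) _).trans_eq ?_
        rw [← lintegral_union measurableSet_Ioc, Ioc_union_Ioc_eq_Ioc hs hst]
        exact Ioc_disjoint_Ioc_of_le le_rfl)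
    have e0 : (⟨f 0, (of φ qG (φ.toFun h (γ 0)) y).pt.2⟩ : millefeuilleSet φ qG T) =
        (of φ qG g y).pt := by
      have : φ.toFun h (γ 0) = g := by rw [hγ0, φ.apply_neg_self]
      exact congrArg (fun z => (of φ qG z y).pt) this
    have e1 : (⟨f 1, (of φ qG (φ.toFun h (γ 1)) y).pt.2⟩ : millefeuilleSet φ qG T) =
        (of φ qG g' y).pt := by
      have : φ.toFun h (γ 1) = g' := by rw [hγ1, φ.apply_neg_self]
      exact congrArg (fun z => (of φ qG z y).pt) this
    rw [e0, e1] at hmain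
    exact hmain
  rw [← restrict_Ioo_eq_restrict_Ioc] at hind
  refine lt_of_le_of_lt ?_ hl
  have h1 : ENNReal.ofReal (1 / Real.sqrt 2) ≤ 1 := by
    rw [ENNReal.ofReal_le_one, div_le_one (by positivity)]
    exact Real.one_le_sqrt.2 (by norm_num)
  exact (mul_le_mul' h1 hind).trans_eq (one_mul _)

/-- A fine chain of points along an almost shortest path. -/
theorem exists_chain {x y : Millefeuille φ qG T} {L : ℝ} (h : edist x y < ENNReal.ofReal L)
    {η : ℝ} (hη : 0 < η) : ∃ (n : ℕ) (p : ℕ → Millefeuille φ qG T) (d : ℕ → ℝ), p 0 = x ∧ p n = y ∧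
      (∀ i, 0 ≤ d i ∧ d i ≤ η ∧ chordEDist (p i) (p (i + 1)) ≤ ENNReal.ofReal (d i)) ∧
      ∑ i ∈ Finset.range n, d i ≤ L := by
  have hs2 : (0 : ℝ) < Real.sqrt 2 := by positivity
  have h1 : inducedPathEDist (millefeuilleSet φ qG T) x.pt y.pt <
      ENNReal.ofReal (Real.sqrt 2 * L) := by
    have e : ENNReal.ofReal (Real.sqrt 2) * edist x y =
        inducedPathEDist (millefeuilleSet φ qG T) x.pt y.pt := by
      change ENNReal.ofReal (Real.sqrt 2) * (ENNReal.ofReal (1 / Real.sqrt 2) * _) = _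
      rw [← mul_assoc, ← ENNReal.ofReal_mul hs2.le, mul_one_div_cancel hs2.ne',
        ENNReal.ofReal_one, one_mul]
    rw [← e, ENNReal.ofReal_mul hs2.le]
    have := ENNReal.mul_lt_mul_right (ENNReal.ofReal_pos.2 hs2).ne' ENNReal.ofReal_ne_top h
    exact this
  obtain ⟨γ, hγ⟩ := iInf_lt_iff.1 h1
  have huc : UniformContinuous (fun t : unitInterval =>
      (γ t : WithLp 2 (HeintzeGroup φ qG × TreePoint T))) :=
    CompactSpace.uniformContinuous_of_continuous (continuous_subtype_val.comp γ.continuous)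
  obtain ⟨δ, hδ, hδη⟩ := (Metric.uniformity_basis_dist.uniformContinuous_iff
    uniformity_basis_edist).1 huc (ENNReal.ofReal (Real.sqrt 2 * η))
    (ENNReal.ofReal_pos.2 (by positivity))
  obtain ⟨n, hn⟩ := exists_nat_gt (1 / δ)
  have hn0 : (0 : ℝ) < n := lt_trans (by positivity) hn
  set u : ℕ → unitInterval := fun i => projIcc 0 1 zero_le_one ((i : ℝ) / n) with hu
  have hmono : Monotone u := fun i j hij => monotone_projIcc _ (by gcongr)
  have hu0 : u 0 = 0 := by
    have : u 0 = projIcc (0 : ℝ) 1 zero_le_one 0 := by simp [hu]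
    rw [this, projIcc_left]
    rfl
  have hun : u n = 1 := by
    have : u n = projIcc (0 : ℝ) 1 zero_le_one 1 := by simp [hu, div_self hn0.ne']
    rw [this, projIcc_right]
    rfl
  have hclose : ∀ i, edist (γ (u i)).1 (γ (u (i + 1))).1 ≤ ENNReal.ofReal (Real.sqrt 2 * η) := by
    intro i
    refine le_of_lt (hδη (u i) (u (i + 1)) ?_)
    have h2 : dist (u i) (u (i + 1)) ≤ dist ((i : ℝ) / n) (((i + 1 : ℕ) : ℝ) / n) := by
      have := LipschitzWith.projIcc (h := (zero_le_one : (0 : ℝ) ≤ 1)) |>.dist_le_mul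
        ((i : ℝ) / n) (((i + 1 : ℕ) : ℝ) / n)
      simpa [hu] using this
    refine h2.trans_lt ?_
    rw [Real.dist_eq, ← sub_div, abs_div, abs_of_pos hn0]
    push_cast
    rw [show (i : ℝ) - (i + 1) = -1 by ring, abs_neg, abs_one]
    exact (one_div_lt hδ hn0).1 hn
  have hne : ∀ i, edist (γ (u i)).1 (γ (u (i + 1))).1 ≠ ⊤ := fun i =>
    ne_top_of_le_ne_top ENNReal.ofReal_ne_top (hclose i)
  refine ⟨n, fun i => ⟨γ (u i)⟩, fun i => 1 / Real.sqrt 2 *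
    (edist (γ (u i)).1 (γ (u (i + 1))).1).toReal, ?_, ?_, fun i => ⟨by positivity, ?_, ?_⟩, ?_⟩
  · simp [hu0]
  · simp [hun]
  · have := ENNReal.toReal_le_of_le_ofReal (by positivity) (hclose i)
    rw [one_div, inv_mul_le_iff₀ hs2]
    exact this
  · rw [ENNReal.ofReal_mul (by positivity), ENNReal.ofReal_toReal (hne i)]
    rfl
  · rw [← Finset.mul_sum, ← ENNReal.toReal_sum fun i _ => hne i, one_div, inv_mul_le_iff₀ hs2]
    refine ENNReal.toReal_le_of_le_ofReal ?_ ?_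
    · by_contra hneg
      rw [ENNReal.ofReal_of_nonpos (not_le.1 hneg).le] at hγ
      exact not_lt_bot hγ
    · refine le_trans (le_of_eq ?_) ((eVariationOn.sum_le (f := fun t => (γ t).1) (s := univ)
        (n := n) hmono fun _ => mem_univ _).trans hγ.le)
      exact Finset.sum_congr rfl fun i _ => edist_comm _ _

end Millefeuille

/-! ### The two global distance estimates -/

namespace Millefeuille

variable {E N V : Type*} [NormedAddCommGroup E] [NormedSpace ℝ E] [FiniteDimensional ℝ E]
  [TopologicalSpace N] [ChartedSpace E N] [Group N] [LieGroup 𝓘(ℝ, E) ∞ N] [ConnectedSpace N]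
  {m : ℕ} {φ : ExpandingFlow E N} {qG q : LieInner E N} {T : OrientedRegularTree V m}

/-- A chain of points with steps of size at most `η` and total length `l`. -/
inductive Chain (η : ℝ) : Millefeuille φ qG T → Millefeuille φ qG T → ℝ → Prop
  | refl (x : Millefeuille φ qG T) : Chain η x x 0
  | step {x y z : Millefeuille φ qG T} {l d : ℝ} (h : Chain η x y l) (h0 : 0 ≤ d) (hd : d ≤ η)
    (hyz : chordEDist y z ≤ ENNReal.ofReal d) : Chain η x z (l + d)

theorem chordEDist_comm (x y : Millefeuille φ qG T) : chordEDist x y = chordEDist y x := by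
  rw [chordEDist, chordEDist, edist_comm]

theorem Chain.trans {η l l' : ℝ} {x y z : Millefeuille φ qG T} (h : Chain η x y l)
    (h' : Chain η y z l') : Chain η x z (l + l') := by
  induction h' with
  | refl => rwa [add_zero]
  | step _ h0 hd hyz ih =>
    rw [← add_assoc]
    exact ih.step h0 hd hyz

theorem Chain.symm {η l : ℝ} {x y : Millefeuille φ qG T} (h : Chain η x y l) : Chain η y x l := by
  induction h with
  | refl => exact .refl _
  | step _ h0 hd hyz ih =>
    rw [chordEDist_comm] at hyz
    have := ((Chain.refl _).step h0 hd hyz).trans ih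
    rwa [zero_add, add_comm] at this

/-- Cutting at length `a` isolates the single step that crosses `a`, so both remaining pieces can be
estimated from their own ends. -/
theorem Chain.split {η l : ℝ} {x y : Millefeuille φ qG T} (h : Chain η x y l) {a : ℝ}
    (ha : 0 ≤ a) : l ≤ a ∨ ∃ z w l₁ d l₂, Chain η x z l₁ ∧ 0 ≤ d ∧ d ≤ η ∧
      chordEDist z w ≤ ENNReal.ofReal d ∧ Chain η w y l₂ ∧ l₁ ≤ a ∧ a < l₁ + d ∧
      l = l₁ + d + l₂ := by
  induction h with
  | refl => exact Or.inl ha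
  | @step y z l d h0 hd0 hd hyz ih =>
    rcases ih with ih | ⟨u, w, l₁, d', l₂, h1, h2, h3, h4, h5, h6, h7, rfl⟩
    · by_cases hle : l + d ≤ a
      · exact Or.inl hle
      · exact Or.inr ⟨y, z, l, d, 0, h0, hd0, hd, hyz, .refl _, ih, not_le.1 hle, by ring⟩
    · exact Or.inr ⟨u, w, l₁, d', l₂ + d, h1, h2, h3, h4, h5.step hd0 hd hyz, h6, h7, by ring⟩

theorem Chain.height_le {η l : ℝ} {x y : Millefeuille φ qG T} (h : Chain η x y l) :
    y.height ≤ x.height + l := by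
  induction h with
  | refl => simp
  | step _ h0 _ hyz ih =>
    have := (abs_le.1 (abs_height_le_of_chord h0 hyz)).2
    linarith

theorem exists_chain_lt {x y : Millefeuille φ qG T} {L : ℝ} (h : edist x y < ENNReal.ofReal L)
    {η : ℝ} (hη : 0 < η) : ∃ l ≤ L, Chain η x y l := by
  obtain ⟨n, p, d, rfl, rfl, hd, hsum⟩ := exists_chain h hη
  refine ⟨_, hsum, ?_⟩
  clear hsum h
  induction n with
  | zero => simpa using Chain.refl _
  | succ n ih =>
    rw [Finset.sum_range_succ]
    exact ih.step (hd n).1 (hd n).2.1 (hd n).2.2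

theorem Chain.meetAt {η l : ℝ} {x y : Millefeuille φ qG T} (h : Chain η x y l) (hη : 0 < η) {r : ℝ}
    (hr : x.height + l + 2 * η < r) : x.leaf.MeetAt y.leaf r := by
  induction h with
  | refl => exact TreePoint.MeetAt.refl _ (by rw [leaf_height]; linarith)
  | step h h0 hd hyz ih =>
    have h1 := h.height_le
    have h2 := (abs_le.1 (abs_height_le_of_chord h0 hyz)).2
    exact (ih (by linarith)).trans (meetAt_of_chord h0 hyz (by linarith))

/-- The points of the tree below two points at distance less than `L` have merged above the
highest point that a path of length `L` can reach. -/
theorem meetAt_of_edist_le {x y : Millefeuille φ qG T} {L r : ℝ} (h : edist x y ≤ ENNReal.ofReal L)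
    (hr : (x.height + y.height + L) / 2 < r) (hL : 0 ≤ L) : x.leaf.MeetAt y.leaf r := by
  set P := (x.height + y.height + L) / 2 with hP
  -- The chain may exceed `L` by `2 η`. Cut at length `P + η - x.height`, it has both pieces below
  -- height `P + η`, which leaves room under `r` for the step size and for the margin of
  -- `Chain.meetAt`.
  set η := (r - P) / 8 with hη
  have hη0 : 0 < η := by rw [hη]; linarith
  obtain ⟨l, hl, hc⟩ := exists_chain_lt (L := L + 2 * η)
    (h.trans_lt ((ENNReal.ofReal_lt_ofReal_iff (by linarith)).2 (by linarith))) hη0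
  have h1 := abs_le.1 (abs_height_le_of_chord hL ((chordEDist_le_edist x y).trans h))
  rcases hc.split (a := P + η - x.height) (by linarith) with hle | ⟨z, w, l₁, d, l₂, c1, d0, dη, hd,
    c2, k1, k2, k3⟩
  · exact hc.meetAt hη0 (by linarith)
  · have e1 := c1.meetAt hη0 (r := r) (by linarith)
    have e2 := c2.symm.meetAt hη0 (r := r) (by linarith)
    have g1 := c1.height_le
    have g2 := c2.symm.height_le
    exact (e1.trans (meetAt_of_chord d0 hd (by linarith))).trans e2.symm

/-- Two points at distance `L` are at bounded distance in the leaf at the height of the highest point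
that a path of length `L` can reach. -/
theorem exists_gap_bound {δ : ℝ} (h : φ.ContractsBy q δ) (hδ : δ ≤ 1) : ∃ K : ℝ, 0 < K ∧
    ∀ (x y : Millefeuille φ qG T) (L P : ℝ), edist x y ≤ ENNReal.ofReal L → 0 ≤ L →
      (x.height + y.height + L) / 2 < P → φ.gap q x.base y.base P ≤ K := by
  obtain ⟨C, hC, hexp⟩ := h.exists_gap_le_exp hδ
  obtain ⟨κ, hκ, hloc⟩ := exists_chord_local_bound φ qG T q
  have hstep : ∀ (x y : Millefeuille φ qG T) (d P : ℝ), 0 ≤ d → d ≤ 1 / 2 →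
      chordEDist x y ≤ ENNReal.ofReal d → x.height ≤ P →
      φ.gap q x.base y.base P ≤ C / κ * (d * Real.exp (x.height - P)) := by
    intro x y d P hd0 hd hxy hP
    have h1 := hloc x y d hd0 hd hxy
    have h2 : κ * φ.gap q x.base y.base x.height ≤ d := by
      refine abs_le_of_sq_le_sq' ?_ hd0 |>.2
      nlinarith [sq_nonneg (y.height - x.height)]
    calc φ.gap q x.base y.base P
        ≤ C * Real.exp (x.height - P) * φ.gap q x.base y.base x.height := hexp _ _ _ _ hP
      _ = C / κ * Real.exp (x.height - P) * (κ * φ.gap q x.base y.base x.height) := by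
        field_simp
      _ ≤ C / κ * Real.exp (x.height - P) * d := by gcongr
      _ = _ := by ring
  -- After length `l` the height is at most `x.height + l`, so a step `d` adds at most `C / κ * d *
  -- exp (x.height + l - P)` to the gap at `P`. This is at most an increment of the exponential, and
  -- the sum telescopes.
  have hside : ∀ (x y : Millefeuille φ qG T) (l P : ℝ), Chain (1 / 2) x y l → x.height + l ≤ P →
      φ.gap q x.base y.base P ≤
        C / κ * (Real.exp (x.height + l - P) - Real.exp (x.height - P)) := by
    intro x y l P hc
    induction hc with
    | refl => intro _; rw [φ.gap_self]; simp
    | @step y z l d hc h0 hd hyz ih =>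
      intro hP
      have h1 := ih (by linarith)
      have h2 := hc.height_le
      have h3 := hstep y z d P h0 hd hyz (by linarith)
      have h4 := φ.gap_triangle q x.base y.base z.base P
      have h5 : d * Real.exp (y.height - P) ≤ d * Real.exp (x.height + l - P) := by
        gcongr
      have h6 : Real.exp (x.height + (l + d) - P) =
          Real.exp (x.height + l - P) * Real.exp d := by
        rw [← Real.exp_add]; congr 1; ring
      have h7 := Real.add_one_le_exp d
      have h8 : d * Real.exp (x.height + l - P) ≤
          Real.exp (x.height + (l + d) - P) - Real.exp (x.height + l - P) := by
        rw [h6]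
        nlinarith [Real.exp_pos (x.height + l - P)]
      have h9 : C / κ * (d * Real.exp (y.height - P)) ≤ C / κ *
          (Real.exp (x.height + (l + d) - P) - Real.exp (x.height + l - P)) := by
        gcongr
        exact h5.trans h8
      linarith
  have hside' : ∀ (x y : Millefeuille φ qG T) (l P : ℝ), Chain (1 / 2) x y l → x.height + l ≤ P →
      φ.gap q x.base y.base P ≤ C / κ := by
    intro x y l P hc hP
    refine (hside x y l P hc hP).trans ?_
    have h1 : Real.exp (x.height + l - P) ≤ 1 := Real.exp_le_one_iff.2 (by linarith)
    have h2 := Real.exp_pos (x.height - P)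
    have h3 : 0 < C / κ := by positivity
    nlinarith
  refine ⟨3 * (C / κ), by positivity, fun x y L P hxy hL hP => ?_⟩
  have hCκ : 0 < C / κ := by positivity
  -- With this total length, cutting at `P - x.height` leaves at most `P - y.height` for the piece
  -- from `y`. Neither piece can rise above `P`, and the crossing step adds one more `C / κ`.
  obtain ⟨l, hl, hc⟩ := exists_chain_lt (L := 2 * P - x.height - y.height) (η := 1 / 2)
    (hxy.trans_lt ((ENNReal.ofReal_lt_ofReal_iff (by linarith)).2 (by linarith))) (by norm_num)
  have h1 := abs_le.1 (abs_height_le_of_chord hL ((chordEDist_le_edist x y).trans hxy))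
  rcases hc.split (a := P - x.height) (by linarith) with hle | ⟨z, w, l₁, d, l₂, c1, d0, dη, hd,
    c2, k1, k2, k3⟩
  · have := hside' x y l P hc (by linarith)
    linarith
  · have e1 := hside' x z l₁ P c1 (by linarith)
    have e2 := hside' y w l₂ P c2.symm (by linarith)
    have g1 := c1.height_le
    have e3 := hstep z w d P d0 dη hd (by linarith)
    have e4 : d * Real.exp (z.height - P) ≤ 1 := by
      have : Real.exp (z.height - P) ≤ 1 := Real.exp_le_one_iff.2 (by linarith)
      nlinarith [Real.exp_pos (z.height - P)]
    have e5 : C / κ * (d * Real.exp (z.height - P)) ≤ C / κ * 1 := by gcongr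
    have t1 := φ.gap_triangle q x.base z.base y.base P
    have t2 := φ.gap_triangle q z.base w.base y.base P
    rw [φ.gap_comm q w.base y.base] at t2
    linarith

variable (φ qG T q) in
/-- Two points whose ascending rays have merged in the tree at height `H` can be connected through
the leaf at that height. -/
theorem exists_edist_le_of_meetAt : ∃ C : ℝ, 0 < C ∧ ∀ (x y : Millefeuille φ qG T) (H : ℝ),
    x.leaf.MeetAt y.leaf H → edist x y ≤ ENNReal.ofReal
      ((H - x.height) + (H - y.height) + C * φ.gap q x.base y.base H) := by
  obtain ⟨C, hC, hle⟩ := φ.exists_gap_le q qG 0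
  refine ⟨C, hC, fun x y H hm => ?_⟩
  have hx : x.leaf.height ≤ H := hm.1
  have hy : y.leaf.height ≤ H := hm.2.1
  have e : y.leaf.up H hy = x.leaf.up H hx := TreePoint.ext hm.2.2.symm rfl
  have h1 := edist_vertical_le (φ := φ) (qG := qG) x.base x.leaf hx
  have h2 := edist_vertical_le (φ := φ) (qG := qG) y.base y.leaf hy
  have h3 := edist_horizontal_le (φ := φ) (qG := qG) x.base y.base (x.leaf.up H hx)
  rw [of_base_leaf, leaf_height] at h1 h2
  rw [e, edist_comm] at h2
  have h4 : φ.gap qG x.base y.base (x.leaf.up H hx).height ≤ C * φ.gap q x.base y.base H :=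
    hle x.base y.base H H (by simp)
  rw [leaf_height] at hx hy
  calc edist x y ≤ _ := edist_triangle4 _ _ _ _
    _ ≤ ENNReal.ofReal (H - x.height) + ENNReal.ofReal (C * φ.gap q x.base y.base H) +
        ENNReal.ofReal (H - y.height) := by
      refine add_le_add (add_le_add h1 (h3.trans (ENNReal.ofReal_le_ofReal h4))) h2
    _ = _ := by
      have h5 : 0 ≤ C * φ.gap q x.base y.base H := mul_nonneg hC.le (φ.gap_nonneg q _ _ _)
      rw [← ENNReal.ofReal_add (by linarith) h5, ← ENNReal.ofReal_add (by linarith) (by linarith)]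
      congr 1
      ring

theorem edist_ne_top (x y : Millefeuille φ qG T) : edist x y ≠ ⊤ := by
  obtain ⟨C, -, h⟩ := exists_edist_le_of_meetAt φ qG qG T
  obtain ⟨r, hr⟩ := x.leaf.exists_meetAt y.leaf
  exact ne_top_of_le_ne_top ENNReal.ofReal_ne_top (h x y r hr)

end Millefeuille

/-! ### Ascending lines of the tree and the `m`-adics -/

section TreeLines

variable {V : Type*} {m : ℕ} {T : OrientedRegularTree V m}

/-- An ascending line of the tree, given by its vertex at each height. -/
@[ext] structure AscendingLine (T : OrientedRegularTree V m) where
  /-- the vertex at height `i` -/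
  vertex : ℤ → V
  parent_vertex : ∀ i, T.parent (vertex i) = vertex (i + 1)
  height_vertex : ∀ i, T.height (vertex i) = i

namespace AscendingLine

theorem iterate_parent (ℓ : AscendingLine T) (i : ℤ) (n : ℕ) :
    T.parent^[n] (ℓ.vertex i) = ℓ.vertex (i + n) := by
  induction n with
  | zero => simp
  | succ n ih =>
    rw [Function.iterate_succ_apply', ih, ℓ.parent_vertex]
    congr 1
    push_cast
    ring

/-- The point at height `t` of an ascending line. -/
def point (ℓ : AscendingLine T) (t : ℝ) : TreePoint T := ⟨ℓ.vertex ⌊t⌋, t, (ℓ.height_vertex _).symm⟩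

theorem ancestor_point (ℓ : AscendingLine T) {t r : ℝ} (h : t ≤ r) :
    (ℓ.point t).ancestor r = ℓ.vertex ⌊r⌋ := by
  have h1 := Int.floor_le_floor h
  have e : (ℓ.point t).ancestor r = T.parent^[(⌊r⌋ - T.height (ℓ.vertex ⌊t⌋)).toNat] (ℓ.vertex ⌊t⌋) := rfl
  rw [e, ℓ.height_vertex, ℓ.iterate_parent]
  congr 1
  omega

theorem up_point (ℓ : AscendingLine T) {t r : ℝ} (h : t ≤ r) :
    (ℓ.point t).up r h = ℓ.point r := TreePoint.ext (ℓ.ancestor_point h) rfl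

theorem meetAt_point_iff (ℓ ℓ' : AscendingLine T) {s t r : ℝ} (hs : s ≤ r) (ht : t ≤ r) :
    (ℓ.point s).MeetAt (ℓ'.point t) r ↔ ℓ.vertex ⌊r⌋ = ℓ'.vertex ⌊r⌋ := by
  rw [TreePoint.MeetAt, ancestor_point _ hs, ancestor_point _ ht]
  exact ⟨fun h => h.2.2, fun h => ⟨hs, ht, h⟩⟩

theorem eq_of_le {ℓ ℓ' : AscendingLine T} {i j : ℤ} (h : ℓ.vertex i = ℓ'.vertex i) (hij : i ≤ j) :
    ℓ.vertex j = ℓ'.vertex j := by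
  have h1 := ℓ.iterate_parent i (j - i).toNat
  have h2 := ℓ'.iterate_parent i (j - i).toNat
  have e : i + ((j - i).toNat : ℤ) = j := by omega
  rw [e] at h1 h2
  rw [← h1, ← h2, h]

theorem exists_eq (ℓ ℓ' : AscendingLine T) : ∃ i, ℓ.vertex i = ℓ'.vertex i := by
  obtain ⟨r, h⟩ := (ℓ.point 0).exists_meetAt (ℓ'.point 0)
  exact ⟨_, (ℓ.meetAt_point_iff ℓ' h.1 h.2.1).1 h⟩

end AscendingLine

namespace OrientedRegularTree

variable (T)

theorem exists_child (hm : 2 ≤ m) (v : V) : ∃ w, T.parent w = v := by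
  have h := T.ncard_children v
  exact (Set.nonempty_of_ncard_ne_zero (by omega) : {w | T.parent w = v}.Nonempty)

/-- A downward sequence of vertices can be continued upwards. -/
theorem exists_ascendingLine (d : ℕ → V) (hd : ∀ n, T.parent (d (n + 1)) = d n) (u : ℤ → V)
    (j : ℤ) (hj : T.height (d 0) = j) (hu : u j = d 0) (hp : ∀ i, j ≤ i → T.parent (u i) = u (i + 1)) :
    ∃ ℓ : AscendingLine T, (∀ i, j ≤ i → ℓ.vertex i = u i) ∧ ∀ n : ℕ, ℓ.vertex (j - n) = d n := by
  have hhu : ∀ n : ℕ, T.height (u (j + n)) = j + n := by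
    intro n
    induction n with
    | zero => simp [hu, hj]
    | succ n ih =>
      have := T.height_parent (u (j + n))
      rw [hp _ (by omega), ih] at this
      push_cast
      rw [← add_assoc, this]
  have hhd : ∀ n : ℕ, T.height (d n) = j - n := by
    intro n
    induction n with
    | zero => simp [hj]
    | succ n ih =>
      have := T.height_parent (d (n + 1))
      rw [hd, ih] at this
      push_cast
      linarith
  refine ⟨⟨fun i => if j ≤ i then u i else d (j - i).toNat, fun i => ?_, fun i => ?_⟩,
    fun i hi => if_pos hi, fun n => ?_⟩
  · by_cases h : j ≤ i
    · rw [if_pos h, if_pos (by omega), hp i h]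
    · rw [if_neg h]
      have e : (j - i).toNat = (j - (i + 1)).toNat + 1 := by omega
      rw [e, hd]
      by_cases h' : j ≤ i + 1
      · have : i + 1 = j := by omega
        rw [if_pos h', this, hu]
        simp
      · rw [if_neg h']
  · by_cases h : j ≤ i
    · rw [if_pos h]
      have := hhu (i - j).toNat
      have e : j + ((i - j).toNat : ℤ) = i := by omega
      rwa [e] at this
    · rw [if_neg h, hhd]
      omega
  · change (if j ≤ j - (n : ℤ) then u (j - n) else d (j - (j - (n : ℤ))).toNat) = d n
    by_cases h : j ≤ j - (n : ℤ)
    · have : n = 0 := by omega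
      subst this
      rw [if_pos h]
      simp [hu]
    · rw [if_neg h]
      congr 1
      omega

theorem nonempty_ascendingLine (hm : 2 ≤ m) : Nonempty (AscendingLine T) := by
  obtain ⟨v⟩ := T.isTree.connected.nonempty
  choose ch hch using T.exists_child hm
  obtain ⟨ℓ, -⟩ := T.exists_ascendingLine (fun n => ch^[n] v)
    (fun n => by rw [Function.iterate_succ_apply', hch])
    (fun i => T.parent^[(i - T.height v).toNat] v) (T.height v) rfl (by simp)
    (fun i hi => by
      rw [← Function.iterate_succ_apply' T.parent]
      congr 2
      omega)
  exact ⟨ℓ⟩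

/-- The vertices can be labelled by digits so that the children of each vertex carry different
labels, and the vertices of a given line carry the label zero. -/
theorem exists_label (hm : 2 ≤ m) (ℓ₀ : AscendingLine T) : ∃ lab : V → Fin m,
    (∀ v w, T.parent v = T.parent w → lab v = lab w → v = w) ∧
    (∀ v j, ∃ w, T.parent w = v ∧ lab w = j) ∧ ∀ i, (lab (ℓ₀.vertex i) : ℕ) = 0 := by
  classical
  have hex : ∀ v, ∃ e : {w | T.parent w = v} ≃ Fin m,
      ∀ i (h : T.parent (ℓ₀.vertex i) = v), (e ⟨ℓ₀.vertex i, h⟩ : ℕ) = 0 := by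
    intro v
    have hcard : Nat.card {w | T.parent w = v} = m := T.ncard_children v
    have : Finite {w | T.parent w = v} := Nat.finite_of_card_ne_zero (by omega)
    let e := Finite.equivFinOfCardEq hcard
    by_cases hv : ∃ i, T.parent (ℓ₀.vertex i) = v
    · obtain ⟨i, hi⟩ := hv
      -- The heights show that at most one vertex of `ℓ₀` is a child of `v`, so one transposition
      -- suffices to give it the label zero.
      refine ⟨e.trans (Equiv.swap (e ⟨ℓ₀.vertex i, hi⟩) ⟨0, by omega⟩), fun k hk => ?_⟩
      have : k = i := by
        have h := congrArg T.height (hk.trans hi.symm)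
        rw [T.height_parent, T.height_parent, ℓ₀.height_vertex, ℓ₀.height_vertex] at h
        omega
      subst this
      simp
    · exact ⟨e, fun i hi => absurd ⟨i, hi⟩ hv⟩
  choose e he using hex
  refine ⟨fun v => e (T.parent v) ⟨v, rfl⟩, fun v w hp h => ?_, fun v j => ?_, fun i => he _ i rfl⟩
  · have key : ∀ (a : V) (ha : T.parent w = a), e a ⟨w, ha⟩ = e (T.parent w) ⟨w, rfl⟩ := by
      rintro a rfl; rfl
    have h' : e (T.parent v) ⟨v, rfl⟩ = e (T.parent w) ⟨w, rfl⟩ := h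
    rw [← key _ hp.symm] at h'
    exact congrArg Subtype.val ((e _).injective h')
  · refine ⟨((e v).symm j).1, ((e v).symm j).2, ?_⟩
    have key : ∀ (w : V) (hw : T.parent w = v), e (T.parent w) ⟨w, rfl⟩ = e v ⟨w, hw⟩ := by
      rintro w rfl; rfl
    change e (T.parent _) ⟨_, rfl⟩ = j
    rw [key _ ((e v).symm j).2]
    exact (e v).apply_symm_apply j

/-- The ascending lines of the tree are parametrized by the `m`-adics. -/
theorem exists_mAdic_equiv (hm : 2 ≤ m) : ∃ L : MAdic m ≃ AscendingLine T, ∀ x y, x ≠ y →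
    ∃ σ : ℤ, mAdicDist x y = (m : ℝ) ^ σ ∧ ∀ i, (L x).vertex i = (L y).vertex i ↔ σ < i := by
  obtain ⟨ℓ₀⟩ := T.nonempty_ascendingLine hm
  obtain ⟨lab, hinj, hsurj, h0⟩ := T.exists_label hm ℓ₀
  -- The digit at index `i` is the label of the vertex at height `-i`, so going down adds digits of
  -- higher index. Far up every line coincides with `ℓ₀`, whose labels vanish, which makes the very
  -- negative digits zero.
  let A : AscendingLine T → MAdic m := fun ℓ => ⟨fun i => lab (ℓ.vertex (-i)), by
    obtain ⟨k, hk⟩ := ℓ.exists_eq ℓ₀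
    refine ⟨-k, fun i hi => ?_⟩
    dsimp only
    rw [AscendingLine.eq_of_le hk (by omega : k ≤ -i), h0]⟩
  have hA : ∀ (ℓ ℓ' : AscendingLine T) (n : ℤ), (∀ i < n, (A ℓ).1 i = (A ℓ').1 i) →
      ∀ i < n, ℓ.vertex (-i) = ℓ'.vertex (-i) := by
    intro ℓ ℓ' n hn i hi
    obtain ⟨k, hk⟩ := ℓ.exists_eq ℓ'
    rcases le_total k (-i) with h | h
    · exact AscendingLine.eq_of_le hk h
    -- Induction downwards from a height `k` where the lines have merged: equal parents and equal
    -- labels force equal vertices.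
    have key : ∀ j : ℕ, -k + j < n → ℓ.vertex (k - j) = ℓ'.vertex (k - j) := by
      intro j
      induction j with
      | zero => intro _; simpa using hk
      | succ j ih =>
        intro hj
        push_cast at hj
        refine hinj _ _ ?_ ?_
        · rw [ℓ.parent_vertex, ℓ'.parent_vertex]
          have e : k - ((j + 1 : ℕ) : ℤ) + 1 = k - j := by push_cast; ring
          rw [e]
          exact ih (by omega)
        · have := hn (-k + j + 1) (by omega)
          have e : -(-k + j + 1) = k - ((j + 1 : ℕ) : ℤ) := by push_cast; ring
          change lab (ℓ.vertex (-(-k + j + 1))) = lab (ℓ'.vertex (-(-k + j + 1))) at this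
          rwa [e] at this
    have := key (k + i).toNat (by omega)
    have e : k - ((k + i).toNat : ℤ) = -i := by omega
    rwa [e] at this
  have hAi : Function.Injective A := by
    intro ℓ ℓ' h
    refine AscendingLine.ext (funext fun i => ?_)
    have := hA ℓ ℓ' (-i + 1) (fun i _ => by rw [h]) (-i) (by omega)
    simpa using this
  have hAs : Function.Surjective A := by
    rintro ⟨a, k, hk⟩
    choose ch hch1 hch2 using hsurj
    -- The sequence starts on `ℓ₀` at height `-k + 1`, one above the first digit that may be
    -- nonzero. Thus `d (n + 1)` has height `-(k + n)` and label `a (k + n)`.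
    let d : ℕ → V := fun n => Nat.rec (ℓ₀.vertex (-k + 1)) (fun n v => ch v (a (k + n))) n
    have hd : ∀ n, d (n + 1) = ch (d n) (a (k + n)) := fun n => rfl
    obtain ⟨ℓ, h1, h2⟩ := T.exists_ascendingLine d (fun n => by rw [hd, hch1]) ℓ₀.vertex (-k + 1)
      (ℓ₀.height_vertex _) rfl (fun i _ => ℓ₀.parent_vertex i)
    refine ⟨ℓ, Subtype.ext (funext fun i => ?_)⟩
    change lab (ℓ.vertex (-i)) = a i
    rcases lt_or_ge i k with h | h
    · rw [h1 _ (by omega)]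
      exact Fin.ext ((h0 _).trans (hk i h).symm)
    · have := h2 ((i - k).toNat + 1)
      have e : -k + 1 - (((i - k).toNat + 1 : ℕ) : ℤ) = -i := by push_cast; omega
      rw [e] at this
      rw [this, hd, hch2]
      congr 1
      omega
  let L := (Equiv.ofBijective A ⟨hAi, hAs⟩).symm
  have hL : ∀ x, A (L x) = x := fun x => (Equiv.ofBijective A ⟨hAi, hAs⟩).apply_symm_apply x
  refine ⟨L, fun x y hxy => ?_⟩
  have hne : {i : ℤ | x.1 i ≠ y.1 i}.Nonempty := by
    by_contra h
    rw [Set.not_nonempty_iff_eq_empty, Set.eq_empty_iff_forall_notMem] at h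
    exact hxy (Subtype.ext (funext fun i => not_not.1 (h i)))
  have hbdd : BddBelow {i : ℤ | x.1 i ≠ y.1 i} := by
    obtain ⟨k, hk⟩ := x.2
    obtain ⟨l, hl⟩ := y.2
    refine ⟨min k l, fun i hi => ?_⟩
    by_contra h
    rw [not_le, lt_min_iff] at h
    exact hi (Fin.ext ((hk i h.1).trans (hl i h.2).symm))
  set n := sInf {i : ℤ | x.1 i ≠ y.1 i} with hn
  have hmem : x.1 n ≠ y.1 n := Int.csInf_mem hne hbdd
  have hlt : ∀ i < n, x.1 i = y.1 i := fun i hi => by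
    by_contra h
    exact absurd (csInf_le hbdd h) (not_le.2 hi)
  refine ⟨-n, by rw [mAdicDist, if_neg hxy], fun i => ⟨fun h => ?_, fun h => ?_⟩⟩
  · by_contra hi
    have h1 := AscendingLine.eq_of_le h (not_lt.1 hi)
    apply hmem
    rw [← hL x, ← hL y]
    change lab _ = lab _
    rw [h1]
  · have := hA (L x) (L y) n (fun j hj => by rw [hL, hL]; exact hlt j hj) (-i) (by omega)
    simpa using this

end OrientedRegularTree

end TreeLines

/-! ### Geodesic rays and lines as functions on `ℝ` -/

section Rays

variable {X : Type*} [PseudoEMetricSpace X]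

/-- A geodesic ray, given as a function on `ℝ` whose values at negative numbers do not matter. -/
def IsRay (f : ℝ → X) : Prop :=
  ∀ s t, 0 ≤ s → s ≤ t → edist (f s) (f t) = ENNReal.ofReal (t - s)

/-- Two rays stay at bounded distance. -/
def RaysAsymptotic (f f' : ℝ → X) : Prop :=
  ∃ C : ℝ, ∀ t, 0 ≤ t → edist (f t) (f' t) ≤ ENNReal.ofReal C

theorem RaysAsymptotic.symm {f f' : ℝ → X} (h : RaysAsymptotic f f') : RaysAsymptotic f' f := by
  obtain ⟨C, h⟩ := h
  exact ⟨C, fun t ht => by rw [edist_comm]; exact h t ht⟩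

theorem Isometry.edist_eq_ofReal {f : ℝ → X} (h : Isometry f) {s t : ℝ} (hst : s ≤ t) :
    edist (f s) (f t) = ENNReal.ofReal (t - s) := by
  rw [h.edist_eq, edist_dist, Real.dist_eq, abs_sub_comm, abs_of_nonneg (sub_nonneg.2 hst)]

theorem isometry_of_le {f : ℝ → X}
    (h : ∀ s t, s ≤ t → edist (f s) (f t) = ENNReal.ofReal (t - s)) : Isometry f := by
  intro s t
  rcases le_total s t with hst | hst
  · rw [h s t hst, edist_dist, Real.dist_eq, abs_sub_comm, abs_of_nonneg (sub_nonneg.2 hst)]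
  · rw [edist_comm, h t s hst, edist_dist, Real.dist_eq, abs_of_nonneg (sub_nonneg.2 hst)]

theorem Isometry.isRay {f : ℝ → X} (h : Isometry f) : IsRay f :=
  fun _ _ _ hst => h.edist_eq_ofReal hst

namespace GeodesicRay

/-- The ray as a function on `ℝ`. -/
def extend (ρ : GeodesicRay X) (t : ℝ) : X := ρ.1 t.toNNReal

theorem isRay_extend (ρ : GeodesicRay X) : IsRay ρ.extend := by
  intro s t hs hst
  rw [extend, extend, ρ.2.edist_eq, edist_dist, NNReal.dist_eq, Real.coe_toNNReal _ hs,
    Real.coe_toNNReal _ (hs.trans hst), abs_sub_comm, abs_of_nonneg (sub_nonneg.2 hst)]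

theorem extend_coe (ρ : GeodesicRay X) (t : ℝ≥0) : ρ.extend t = ρ.1 t := by
  rw [extend, Real.toNNReal_coe]

theorem endpoint_eq_iff (ρ σ : GeodesicRay X) :
    ρ.endpoint = σ.endpoint ↔ RaysAsymptotic ρ.extend σ.extend := by
  have e : ρ.endpoint = σ.endpoint ↔ ∃ C : ℝ≥0, ∀ t, edist (ρ.1 t) (σ.1 t) ≤ C := Quotient.eq
  rw [e]
  constructor
  · rintro ⟨C, h⟩
    exact ⟨C, fun t _ => by rw [ENNReal.ofReal_coe_nnreal]; exact h _⟩
  · rintro ⟨C, h⟩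
    refine ⟨C.toNNReal, fun t => ?_⟩
    rw [← ρ.extend_coe, ← σ.extend_coe]
    exact h t t.2

end GeodesicRay

theorem RaysAsymptotic.congr {f f' g g' : ℝ → X} (h : RaysAsymptotic f g)
    (hf : ∀ t, 0 ≤ t → f t = f' t) (hg : ∀ t, 0 ≤ t → g t = g' t) : RaysAsymptotic f' g' := by
  obtain ⟨C, h⟩ := h
  exact ⟨C, fun t ht => by rw [← hf t ht, ← hg t ht]; exact h t ht⟩

/-- The positive half of a geodesic line. -/
def Isometry.toGeodesicRay {γ : ℝ → X} (hγ : Isometry γ) : GeodesicRay X :=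
  ⟨fun t => γ t, hγ.comp isometry_subtype_coe⟩

theorem Isometry.extend_toGeodesicRay {γ : ℝ → X} (hγ : Isometry γ) {t : ℝ} (ht : 0 ≤ t) :
    hγ.toGeodesicRay.extend t = γ t :=
  congrArg γ (Real.coe_toNNReal t ht)

theorem posEnd_eq {γ : ℝ → X} (hγ : Isometry γ) : posEnd γ hγ = hγ.toGeodesicRay.endpoint := rfl

theorem Isometry.comp_neg {γ : ℝ → X} (hγ : Isometry γ) : Isometry fun t => γ (-t) :=
  hγ.comp (IsometryEquiv.neg ℝ).isometry

theorem negEnd_eq {γ : ℝ → X} (hγ : Isometry γ) : negEnd γ hγ = posEnd _ hγ.comp_neg := rfl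

theorem posEnd_eq_endpoint_iff {γ : ℝ → X} (hγ : Isometry γ) (σ : GeodesicRay X) :
    posEnd γ hγ = σ.endpoint ↔ RaysAsymptotic γ σ.extend := by
  rw [posEnd_eq, GeodesicRay.endpoint_eq_iff]
  exact ⟨fun h => h.congr (fun t ht => hγ.extend_toGeodesicRay ht) fun _ _ => rfl,
    fun h => h.congr (fun t ht => (hγ.extend_toGeodesicRay ht).symm) fun _ _ => rfl⟩

theorem posEnd_eq_posEnd_iff {γ γ' : ℝ → X} (hγ : Isometry γ) (hγ' : Isometry γ') :
    posEnd γ hγ = posEnd γ' hγ' ↔ RaysAsymptotic γ γ' := by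
  rw [posEnd_eq hγ', posEnd_eq_endpoint_iff]
  exact ⟨fun h => h.congr (fun _ _ => rfl) fun t ht => hγ'.extend_toGeodesicRay ht,
    fun h => h.congr (fun _ _ => rfl) fun t ht => (hγ'.extend_toGeodesicRay ht).symm⟩

theorem negEnd_eq_negEnd_iff {γ γ' : ℝ → X} (hγ : Isometry γ) (hγ' : Isometry γ') :
    negEnd γ hγ = negEnd γ' hγ' ↔ RaysAsymptotic (fun t => γ (-t)) (fun t => γ' (-t)) := by
  rw [negEnd_eq, negEnd_eq, posEnd_eq_posEnd_iff]

end Rays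

/-! ### Merging at the limiting height -/

section TreePoints

variable {V : Type*} {m : ℕ} {T : OrientedRegularTree V m}

theorem TreePoint.ancestor_congr (x : TreePoint T) {r s : ℝ} (h : ⌊r⌋ = ⌊s⌋) :
    x.ancestor r = x.ancestor s := by
  rw [TreePoint.ancestor, TreePoint.ancestor, h]

/-- Edges are half-open, closed at the lower end, so ancestors are constant on `[⌊r⌋, ⌊r⌋ + 1)` and
merging passes to the limit from above. This makes the strict inequality in `meetAt_of_edist_le`
weak. -/
theorem TreePoint.meetAt_of_forall_gt {x y : TreePoint T} {r : ℝ}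
    (h : ∀ s, r < s → x.MeetAt y s) : x.MeetAt y r := by
  refine ⟨le_of_forall_gt_imp_ge_of_dense fun s hs => (h s hs).1,
    le_of_forall_gt_imp_ge_of_dense fun s hs => (h s hs).2.1, ?_⟩
  have h1 := Int.lt_floor_add_one r
  have h2 := Int.floor_le r
  have e : ⌊r⌋ = ⌊(r + (⌊r⌋ + 1)) / 2⌋ := by
    symm
    rw [Int.floor_eq_iff]
    constructor <;> linarith
  rw [x.ancestor_congr e, y.ancestor_congr e]
  exact (h _ (by linarith)).2.2

end TreePoints

/-! ### Vertical lines, ascending rays and the upper end -/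

namespace Millefeuille

variable {E N V : Type*} [NormedAddCommGroup E] [NormedSpace ℝ E] [FiniteDimensional ℝ E]
  [TopologicalSpace N] [ChartedSpace E N] [Group N] [LieGroup 𝓘(ℝ, E) ∞ N] [ConnectedSpace N]
  {m : ℕ} {φ : ExpandingFlow E N} {qG q : LieInner E N} {T : OrientedRegularTree V m}

theorem abs_height_sub_le {x y : Millefeuille φ qG T} {d : ℝ} (hd : 0 ≤ d)
    (h : edist x y ≤ ENNReal.ofReal d) : |y.height - x.height| ≤ d :=
  abs_height_le_of_chord hd ((chordEDist_le_edist x y).trans h)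

theorem meetAt_of_edist_le_of_le {x y : Millefeuille φ qG T} {L r : ℝ}
    (h : edist x y ≤ ENNReal.ofReal L) (hr : (x.height + y.height + L) / 2 ≤ r) (hL : 0 ≤ L) :
    x.leaf.MeetAt y.leaf r :=
  TreePoint.meetAt_of_forall_gt fun _ hs => meetAt_of_edist_le h (hr.trans_lt hs) hL

variable (φ qG) in
/-- The vertical line over `g ∈ N` and an ascending line of the tree. -/
def vert (g : N) (ℓ : AscendingLine T) (t : ℝ) : Millefeuille φ qG T := of φ qG g (ℓ.point t)

theorem height_vert (g : N) (ℓ : AscendingLine T) (t : ℝ) : (vert φ qG g ℓ t).height = t := rfl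

theorem base_vert (g : N) (ℓ : AscendingLine T) (t : ℝ) : (vert φ qG g ℓ t).base = g := rfl

theorem leaf_vert (g : N) (ℓ : AscendingLine T) (t : ℝ) :
    (vert φ qG g ℓ t).leaf = ℓ.point t := rfl

/-- The vertical path realizes the lower bound given by the 1-Lipschitz height. -/
theorem isometry_vert (g : N) (ℓ : AscendingLine T) : Isometry (vert φ qG g ℓ) := by
  refine isometry_of_le fun s t hst => le_antisymm ?_ ?_
  · have := edist_vertical_le (φ := φ) (qG := qG) g (ℓ.point s) (r := t) hst
    rwa [ℓ.up_point hst] at this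
  · refine le_trans (ENNReal.ofReal_le_ofReal ?_) (ofReal_abs_height_le_edist _ _)
    rw [height_vert, height_vert]
    exact le_abs_self _

/-- Along a ray on which the height increases at unit speed the base is constant, and the component
in the tree ascends. -/
theorem base_eq_of_ascending {f : ℝ → Millefeuille φ qG T} (hf : IsRay f)
    (hh : ∀ t, 0 ≤ t → (f t).height = (f 0).height + t) {t : ℝ} (ht : 0 ≤ t) :
    (f t).base = (f 0).base ∧ (f 0).leaf.MeetAt (f t).leaf (f t).height := by
  constructor
  · obtain ⟨κ, hκ, hloc⟩ := exists_chord_local_bound φ qG T qG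
    have key : ∀ (n : ℕ) (t : ℝ), 0 ≤ t → t ≤ n / 2 → (f t).base = (f 0).base := by
      intro n
      induction n with
      | zero =>
        intro t ht0 ht
        have : t = 0 := le_antisymm (by simpa using ht) ht0
        rw [this]
      | succ n ih =>
        intro t ht0 ht
        push_cast at ht
        rcases le_total t (n / 2) with h | h
        · exact ih t ht0 h
        have hn : (0 : ℝ) ≤ n / 2 := by positivity
        rw [← ih (n / 2) hn le_rfl]
        have h1 := hloc (f (n / 2)) (f t) (t - n / 2) (by linarith) (by linarith)
          ((chordEDist_le_edist _ _).trans (hf _ _ hn h).le)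
        rw [hh t ht0, hh _ hn] at h1
        -- The change of height exhausts the whole distance in the local bound and leaves nothing
        -- for the gap. Steps of length `1/2` keep within the range of that bound.
        have h2 : (κ * φ.gap qG (f (n / 2)).base (f t).base ((f 0).height + n / 2)) ^ 2 = 0 :=
          le_antisymm (by nlinarith) (sq_nonneg _)
        rw [sq_eq_zero_iff, mul_eq_zero, or_iff_right hκ.ne'] at h2
        exact (φ.eq_of_gap_eq_zero qG h2).symm
    obtain ⟨n, hn⟩ := exists_nat_ge (2 * t)
    exact key n t ht (by linarith)
  · refine meetAt_of_edist_le_of_le (L := t) ?_ (by rw [hh t ht]; linarith) ht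
    rw [hf 0 t le_rfl ht, sub_zero]

variable {δ : ℝ}

theorem _root_.ExpandingFlow.ContractsBy.exists_gap_le_of_ge (h : φ.ContractsBy q δ) (hδ : δ ≤ 1)
    (g g' : N) (H : ℝ) : ∃ B : ℝ, ∀ H', H ≤ H' → φ.gap q g g' H' ≤ B := by
  obtain ⟨C, hC, hexp⟩ := h.exists_gap_le_exp hδ
  refine ⟨C * φ.gap q g g' H, fun H' hH => (hexp g g' H H' hH).trans ?_⟩
  have h1 : Real.exp (H - H') ≤ 1 := Real.exp_le_one_iff.2 (by linarith)
  have h2 := φ.gap_nonneg q g g' H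
  calc C * Real.exp (H - H') * φ.gap q g g' H ≤ C * 1 * φ.gap q g g' H := by gcongr
    _ = _ := by ring

/-- Rays that ascend up to a bounded error are asymptotic. -/
theorem raysAsymptotic_of_coarsely_ascending (h : φ.ContractsBy q δ) (hδ : δ ≤ 1)
    {f f' : ℝ → Millefeuille φ qG T} (hf : IsRay f) (hf' : IsRay f') {C : ℝ}
    (hh : ∀ t, 0 ≤ t → t - C ≤ (f t).height) (hh' : ∀ t, 0 ≤ t → t - C ≤ (f' t).height) :
    RaysAsymptotic f f' := by
  obtain ⟨K, hK, hgap⟩ := exists_gap_bound (qG := qG) (T := T) h hδ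
  obtain ⟨A, hA, hup⟩ := exists_edist_le_of_meetAt φ qG q T
  obtain ⟨r, hr⟩ := (f 0).leaf.exists_meetAt (f' 0).leaf
  obtain ⟨B, hB⟩ := h.exists_gap_le_of_ge hδ (f 0).base (f' 0).base r
  -- A geodesic of length `t` from `f 0` stays below height `(f 0).height + t`. At height `R + t`
  -- both rays therefore have merged with their starting points up to a bounded gap, and the
  -- starting points have merged with each other.
  set R := max (max (f 0).height (f' 0).height + 1) r with hR
  have hR1 : (f 0).height + 1 ≤ R := by
    rw [hR]
    exact le_max_of_le_left (by linarith [le_max_left (f 0).height (f' 0).height])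
  have hR2 : (f' 0).height + 1 ≤ R := by
    rw [hR]
    exact le_max_of_le_left (by linarith [le_max_right (f 0).height (f' 0).height])
  have hR3 : r ≤ R := le_max_right _ _
  have key : ∀ (f : ℝ → Millefeuille φ qG T), IsRay f → (f 0).height + 1 ≤ R → ∀ t, 0 ≤ t →
      (f 0).leaf.MeetAt (f t).leaf (R + t) ∧ φ.gap q (f 0).base (f t).base (R + t) ≤ K := by
    intro f hf hR t ht
    have h1 := (hf 0 t le_rfl ht).le
    rw [sub_zero] at h1
    have h2 := (abs_le.1 (abs_height_sub_le ht h1)).2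
    exact ⟨meetAt_of_edist_le h1 (by linarith) ht, hgap _ _ _ _ h1 ht (by linarith)⟩
  refine ⟨2 * (R + C) + A * (K + B + K), fun t ht => ?_⟩
  obtain ⟨a1, a2⟩ := key f hf hR1 t ht
  obtain ⟨b1, b2⟩ := key f' hf' hR2 t ht
  refine (hup _ _ (R + t) ((a1.symm.trans (hr.mono (by linarith))).trans b1)).trans
    (ENNReal.ofReal_le_ofReal ?_)
  have t1 := φ.gap_triangle q (f t).base (f 0).base (f' t).base (R + t)
  have t2 := φ.gap_triangle q (f 0).base (f' 0).base (f' t).base (R + t)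
  rw [φ.gap_comm q (f t).base (f 0).base] at t1
  have t3 := hB (R + t) (by linarith)
  have t4 : A * φ.gap q (f t).base (f' t).base (R + t) ≤ A * (K + B + K) := by
    gcongr
    linarith
  have := hh t ht
  have := hh' t ht
  linarith

/-- On a ray whose height differs from unit speed by at most `η ^ 2`, the base moves by a multiple
of `η`. -/
theorem exists_drift_bound (h : φ.ContractsBy q δ) (hδ : δ ≤ 1) : ∃ A : ℝ, 0 < A ∧
    ∀ (f : ℝ → Millefeuille φ qG T) (s η : ℝ), IsRay f → 0 ≤ s → 0 ≤ η →
      (∀ t t', s ≤ t → t ≤ t' → t' - t - η ^ 2 ≤ (f t').height - (f t).height) →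
      ∀ n : ℕ, φ.gap q (f s).base (f (s + n / 2)).base ((f s).height + n / 2) ≤ A * η := by
  obtain ⟨C, hC, hexp⟩ := h.exists_gap_le_exp hδ
  obtain ⟨κ, hκ, hloc⟩ := exists_chord_local_bound φ qG T q
  refine ⟨2 * (C / κ), by positivity, fun f s η hf hs hη hloss n => ?_⟩
  have hCκ : 0 < C / κ := by positivity
  have key : ∀ (n : ℕ) (P : ℝ), (f s).height + n / 2 ≤ P →
      φ.gap q (f s).base (f (s + n / 2)).base P ≤
        2 * (C / κ) * η * (Real.exp ((f s).height + n / 2 - P) - Real.exp ((f s).height - P)) := by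
    intro n
    induction n with
    | zero => intro P _; simp [φ.gap_self]
    | succ n ih =>
      intro P hP
      have hn : (0 : ℝ) ≤ n / 2 := by positivity
      push_cast at hP ⊢
      set x := f (s + n / 2) with hx
      set y := f (s + (n + 1) / 2) with hy
      have h1 := ih P (by linarith)
      have h2 := hf (s + n / 2) (s + (n + 1) / 2) (by linarith) (by linarith)
      have e2 : s + (n + 1) / 2 - (s + n / 2) = (1 / 2 : ℝ) := by ring
      rw [e2] at h2
      have h3 := hloc x y (1 / 2) (by norm_num) le_rfl ((chordEDist_le_edist _ _).trans h2.le)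
      have h4 := hloss (s + n / 2) (s + (n + 1) / 2) (by linarith) (by linarith)
      rw [e2, ← hx, ← hy] at h4
      have h5 := abs_le.1 (abs_height_sub_le (by norm_num) h2.le)
      -- With `a` the height gained in time `1/2`, one has `a ≥ 1/2 - η²` and `a² ≥ a - 1/4`. Hence
      -- the local bound leaves at most `η²` for the square of the gap term.
      have h6 : κ * φ.gap q x.base y.base x.height ≤ η := by
        refine abs_le_of_sq_le_sq' ?_ hη |>.2
        nlinarith
      have h7 := hf s (s + n / 2) hs (by linarith)
      have h8 := (abs_le.1 (abs_height_sub_le (d := n / 2) hn (h7.le.trans_eq (by ring_nf)))).2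
      rw [← hx] at h8
      have h9 : φ.gap q x.base y.base P ≤ C / κ * η * Real.exp ((f s).height + n / 2 - P) := by
        calc φ.gap q x.base y.base P
            ≤ C * Real.exp (x.height - P) * φ.gap q x.base y.base x.height :=
              hexp _ _ _ _ (by linarith)
          _ = C / κ * Real.exp (x.height - P) * (κ * φ.gap q x.base y.base x.height) := by
            field_simp
          _ ≤ C / κ * Real.exp ((f s).height + n / 2 - P) * η := by
            have h60 : 0 ≤ κ * φ.gap q x.base y.base x.height :=
              mul_nonneg hκ.le (φ.gap_nonneg q _ _ _)
            gcongr
            linarith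
          _ = _ := by ring
      have h10 : Real.exp ((f s).height + (n + 1) / 2 - P) =
          Real.exp ((f s).height + n / 2 - P) * Real.exp (1 / 2) := by
        rw [← Real.exp_add]; congr 1; ring
      have h11 := Real.add_one_le_exp (1 / 2 : ℝ)
      have h12 := Real.exp_pos ((f s).height + n / 2 - P)
      -- Since `e ^ (1/2) - 1 ≥ 1/2`, the contribution of each step is dominated by an increment of
      -- the exponential, and the sum telescopes as in `exists_gap_bound`.
      have h13 : Real.exp ((f s).height + n / 2 - P) / 2 ≤
          Real.exp ((f s).height + (n + 1) / 2 - P) - Real.exp ((f s).height + n / 2 - P) := by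
        rw [h10]
        nlinarith
      have h14 : 2 * (C / κ) * η * (Real.exp ((f s).height + n / 2 - P) / 2) ≤ 2 * (C / κ) * η *
          (Real.exp ((f s).height + (n + 1) / 2 - P) - Real.exp ((f s).height + n / 2 - P)) := by
        gcongr
      have := φ.gap_triangle q (f s).base x.base y.base P
      linarith
  refine (key n _ le_rfl).trans ?_
  have h1 : Real.exp ((f s).height + n / 2 - ((f s).height + n / 2)) = 1 := by simp
  have h2 := Real.exp_pos ((f s).height - ((f s).height + n / 2))
  rw [h1]
  have : 0 ≤ 2 * (C / κ) * η := by positivity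
  nlinarith

/-- A ray that ascends up to a bounded error ascends at unit speed. -/
theorem height_eq_of_coarsely_ascending (h : φ.ContractsBy q δ) (hδ : δ ≤ 1)
    {f : ℝ → Millefeuille φ qG T} (hf : IsRay f) {C : ℝ}
    (hh : ∀ t, 0 ≤ t → t - C ≤ (f t).height) {t : ℝ} (ht : 0 ≤ t) :
    (f t).height = (f 0).height + t := by
  obtain ⟨A, hA, hdrift⟩ := exists_drift_bound (qG := qG) (T := T) h hδ
  obtain ⟨B, hB, hup⟩ := exists_edist_le_of_meetAt φ qG q T
  have hlip : ∀ s t, 0 ≤ s → s ≤ t → (f t).height - (f s).height ≤ t - s := fun s t hs hst =>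
    (abs_le.1 (abs_height_sub_le (sub_nonneg.2 hst) (hf s t hs hst).le)).2
  -- The loss of height up to time `t`. It is monotone because the height is 1-Lipschitz, and
  -- bounded by hypothesis, so beyond some time `s` at most `η²` remains to be lost.
  set lam : ℝ → ℝ := fun t => t - (f t).height with hlam
  have hmono : ∀ s t, 0 ≤ s → s ≤ t → lam s ≤ lam t := fun s t hs hst => by
    have := hlip s t hs hst
    simp only [hlam]
    linarith
  have hbdd : BddAbove (lam '' Ici 0) := by
    refine ⟨C, ?_⟩
    rintro _ ⟨t, ht, rfl⟩
    have := hh t ht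
    simp only [hlam]
    linarith
  have hmain : ∀ η : ℝ, 0 < η → lam t - lam 0 ≤ 2 * η ^ 2 + B * A * η := by
    intro η hη
    obtain ⟨_, ⟨s', hs', rfl⟩, hsup⟩ := exists_lt_of_lt_csSup
      (nonempty_Ici.image lam)
      (sub_lt_self (sSup (lam '' Ici 0)) (by positivity : 0 < η ^ 2))
    set s := max s' t with hs
    have hs0 : 0 ≤ s := ht.trans (le_max_right _ _)
    have hs1 := hmono s' s hs' (le_max_left _ _)
    have hloss : ∀ t t', s ≤ t → t ≤ t' → t' - t - η ^ 2 ≤ (f t').height - (f t).height := by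
      intro u u' hu huu
      have h1 := hmono s u hs0 hu
      have h2 : lam u' ≤ sSup (lam '' Ici 0) := le_csSup hbdd ⟨u', by
        rw [mem_Ici]; linarith, rfl⟩
      simp only [hlam] at *
      linarith
    obtain ⟨r, hr⟩ := (f 0).leaf.exists_meetAt (f s).leaf
    -- A competing path from `f 0` to `f u` with `u = s + n / 2` rises to `P = (f s).height + n /
    -- 2`, crosses the leaf and descends by at most `η²`. Since `f` is geodesic, the loss up to `u`
    -- is at most `2 η²` plus the crossing. The crossing consists of the drift `O(η)` and the gap of
    -- `f 0` and `f s` at `P`, which tends to zero with `n`.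
    have hev : ∀ᶠ n : ℕ in atTop, lam t - lam 0 ≤ 2 * η ^ 2 + B * A * η +
        B * φ.gap q (f 0).base (f s).base ((f s).height + n / 2) := by
      obtain ⟨n₀, hn₀⟩ := exists_nat_ge (2 * (r - (f s).height))
      filter_upwards [eventually_ge_atTop n₀] with n hn
      have hn1 : (n₀ : ℝ) ≤ n := by exact_mod_cast hn
      have hn0 : (0 : ℝ) ≤ n / 2 := by positivity
      set u := s + n / 2 with hu
      set P := (f s).height + n / 2 with hP
      have hsu : s ≤ u := by linarith
      have d1 := hdrift f s η hf hs0 hη.le hloss n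
      rw [← hu, ← hP] at d1
      have d2 := hf s u hs0 hsu
      have d3 := hlip s u hs0 hsu
      have m1 : (f s).leaf.MeetAt (f u).leaf P :=
        meetAt_of_edist_le_of_le d2.le (by linarith) (by linarith)
      have d4 := hup (f 0) (f u) P ((hr.mono (by linarith)).trans m1)
      have t1 := φ.gap_triangle q (f 0).base (f s).base (f u).base P
      have hg0 := φ.gap_nonneg q (f 0).base (f u).base P
      have hu0 : 0 ≤ u := by linarith
      have hr1 := hr.1
      rw [leaf_height] at hr1
      have m2 := m1.2.1
      rw [leaf_height] at m2
      rw [hf 0 u le_rfl hu0, ENNReal.ofReal_le_ofReal_iff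
        (by have := mul_nonneg hB.le hg0; linarith)] at d4
      have d5 := hloss s u le_rfl hsu
      have d6 := hmono t u ht ((le_max_right _ _).trans hsu)
      have t2 : B * φ.gap q (f 0).base (f u).base P ≤
          B * (φ.gap q (f 0).base (f s).base P + A * η) := by
        gcongr
        linarith
      simp only [hlam] at d6 ⊢
      linarith
    refine ge_of_tendsto ?_ hev
    have hlim : Tendsto (fun n : ℕ => φ.gap q (f 0).base (f s).base ((f s).height + n / 2)) atTop
        (𝓝 0) := by
      refine (h.tendsto_gap_atTop hδ _ _).comp ?_
      exact tendsto_atTop_add_const_left _ _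
        (tendsto_natCast_atTop_atTop.atTop_div_const (by norm_num))
    have := (hlim.const_mul B).const_add (2 * η ^ 2 + B * A * η)
    rwa [mul_zero, add_zero] at this
  have hle : lam t - lam 0 ≤ 0 := by
    have hlim : Tendsto (fun η : ℝ => 2 * η ^ 2 + B * A * η) (𝓝[>] 0) (𝓝 0) := by
      have : Continuous fun η : ℝ => 2 * η ^ 2 + B * A * η := by fun_prop
      have h0 := this.tendsto 0
      simp only [ne_eq, OfNat.ofNat_ne_zero, not_false_eq_true, zero_pow, mul_zero, add_zero] at h0
      exact h0.mono_left nhdsWithin_le_nhds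
    refine ge_of_tendsto hlim ?_
    filter_upwards [self_mem_nhdsWithin] with η hη using hmain η hη
  have := hmono 0 t le_rfl ht
  simp only [hlam] at *
  linarith

/-- The endpoint of a vertical line at infinite height is the upper end. -/
theorem isUpperEnd_posEnd_vert (h : φ.ContractsBy q δ) (hδ : δ ≤ 1) (g : N)
    (ℓ : AscendingLine T) :
    IsUpperEnd Millefeuille.height (posEnd (vert φ qG g ℓ) (isometry_vert g ℓ)) := by
  intro ρ
  rw [eq_comm, posEnd_eq_endpoint_iff]
  constructor
  · rintro ⟨C, hC⟩ t
    have := height_eq_of_coarsely_ascending h hδ ρ.isRay_extend (C := max C 0) (fun s hs => by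
      have h1 := (abs_le.1 (abs_height_sub_le (le_max_right C 0)
        ((hC s hs).trans (ENNReal.ofReal_le_ofReal (le_max_left _ _))))).1
      rw [height_vert] at h1
      linarith) t.2
    have e0 : ρ.extend 0 = ρ.1 0 := ρ.extend_coe 0
    rw [e0] at this
    exact (congrArg Millefeuille.height (ρ.extend_coe t).symm).trans this
  · intro hρ
    refine raysAsymptotic_of_coarsely_ascending h hδ (isometry_vert g ℓ).isRay ρ.isRay_extend
      (C := max 0 (-(ρ.1 0).height)) (fun t _ => ?_) (fun t ht => ?_)
    · rw [height_vert]
      linarith [le_max_left 0 (-(ρ.1 0).height)]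
    · have := hρ t.toNNReal
      rw [Real.coe_toNNReal _ ht] at this
      rw [GeodesicRay.extend, this]
      linarith [le_max_right 0 (-(ρ.1 0).height)]

end Millefeuille

/-! ### Classification of the boundary points by vertical lines -/

namespace Millefeuille

variable {E N V : Type*} [NormedAddCommGroup E] [NormedSpace ℝ E] [FiniteDimensional ℝ E]
  [TopologicalSpace N] [ChartedSpace E N] [Group N] [LieGroup 𝓘(ℝ, E) ∞ N] [ConnectedSpace N]
  {m : ℕ} {φ : ExpandingFlow E N} {qG q : LieInner E N} {T : OrientedRegularTree V m} {δ : ℝ}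

/-- A line on which the height increases at unit speed is vertical. -/
theorem exists_eq_vert {γ : ℝ → Millefeuille φ qG T} (hγ : Isometry γ)
    (hh : ∀ t, (γ t).height = t) : ∃ g ℓ, γ = vert φ qG g ℓ := by
  have key : ∀ s t, s ≤ t → (γ t).base = (γ s).base ∧ (γ s).leaf.MeetAt (γ t).leaf t := by
    intro s t hst
    have h1 : IsRay fun u => γ (s + u) := fun u v _ huv => by
      rw [hγ.edist_eq_ofReal (by linarith)]
      congr 1
      ring
    have h2 := base_eq_of_ascending h1 (fun u _ => by rw [hh, hh]; ring) (sub_nonneg.2 hst)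
    have e : s + (t - s) = t := by ring
    simpa only [e, add_zero, hh] using h2
  have hv : ∀ s t, s ≤ t → (γ s).leaf.ancestor t = (γ t).leaf.vertex := fun s t hst => by
    rw [(key s t hst).2.2.2]
    have := (γ t).leaf.ancestor_self
    rwa [leaf_height, hh] at this
  have hfl : ∀ t, T.height (γ t).leaf.vertex = ⌊t⌋ := fun t => by
    rw [← (γ t).leaf.floor_height, leaf_height, hh]
  let ℓ : AscendingLine T := ⟨fun i => (γ i).leaf.vertex, fun i => by
    rw [← hv i ((i + 1 : ℤ) : ℝ) (by push_cast; linarith), TreePoint.ancestor, hfl]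
    simp, fun i => by rw [hfl, Int.floor_intCast]⟩
  refine ⟨(γ 0).base, ℓ, funext fun t => ?_⟩
  have e1 : (γ t).base = (γ 0).base := by
    rcases le_total 0 t with h | h
    · exact (key 0 t h).1
    · exact (key t 0 h).1.symm
  have e2 : (γ t).leaf = ℓ.point t := by
    refine TreePoint.ext ?_ (by rw [leaf_height, hh]; rfl)
    have h1 := hv (⌊t⌋ : ℝ) t (Int.floor_le t)
    rw [← h1, TreePoint.ancestor, hfl]
    simp [ℓ, AscendingLine.point]
  rw [← of_base_leaf (γ t), e1, e2, vert]

/-- The geodesic lines that end at the upper end are vertical. -/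
theorem exists_eq_vert_of_posEnd (h : φ.ContractsBy q δ) (hδ : δ ≤ 1) {g₀ : N}
    {ℓ₀ : AscendingLine T} {γ : ℝ → Millefeuille φ qG T} (hγ : Isometry γ)
    (hpos : posEnd γ hγ = posEnd (vert φ qG g₀ ℓ₀) (isometry_vert g₀ ℓ₀))
    (h0 : (γ 0).height = 0) : ∃ g ℓ, γ = vert φ qG g ℓ := by
  obtain ⟨C, hC⟩ := (posEnd_eq_posEnd_iff _ _).1 hpos
  refine exists_eq_vert hγ ?_
  have key : ∀ s t, s ≤ 0 → s ≤ t → (γ t).height = (γ s).height + (t - s) := by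
    intro s t hs hst
    have h1 : IsRay fun u => γ (s + u) := fun u v _ huv => by
      rw [hγ.edist_eq_ofReal (by linarith)]
      congr 1
      ring
    -- The ray starting at parameter `s ≤ 0` also ascends up to a bounded error. The error constant
    -- depends on `s`, which is harmless because the conclusion is exact.
    have h2 := height_eq_of_coarsely_ascending h hδ h1 (C := max C 0 - s - s) (fun u hu => ?_)
      (sub_nonneg.2 hst)
    · simpa using h2
    · rcases le_total 0 (s + u) with hsu | hsu
      · have h3 := (abs_le.1 (abs_height_sub_le (le_max_right C 0)
          ((hC (s + u) hsu).trans (ENNReal.ofReal_le_ofReal (le_max_left _ _))))).2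
        rw [height_vert] at h3
        linarith
      · have h3 := (abs_le.1 (abs_height_sub_le (sub_nonneg.2 hsu)
          (hγ.edist_eq_ofReal hsu).le)).2
        rw [h0] at h3
        linarith [le_max_right C 0]
  intro t
  rcases le_total 0 t with ht | ht
  · rw [key 0 t le_rfl ht, h0]
    ring
  · have := key t 0 ht ht
    rw [h0] at this
    linarith

/-- A ray either ascends or descends, up to a bounded error, after a bounded time. -/
theorem exists_coarse_dichotomy (h : φ.ContractsBy q δ) (hδ : δ ≤ 1) : ∃ C : ℝ, 0 < C ∧
    ∀ f : ℝ → Millefeuille φ qG T, IsRay f → (∀ t, 0 ≤ t → t - C ≤ (f t).height - (f 0).height) ∨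
      ∃ s, 0 ≤ s ∧ ∀ t, s ≤ t → t - s - C ≤ (f s).height - (f t).height := by
  obtain ⟨K, hK, hgap⟩ := exists_gap_bound (qG := qG) (T := T) h hδ
  obtain ⟨A, hA, hup⟩ := exists_edist_le_of_meetAt φ qG q T
  refine ⟨2 * (1 + A * K), by positivity, fun f hf => ?_⟩
  by_contra! hcon
  obtain ⟨⟨s, hs, h1⟩, h2⟩ := hcon
  obtain ⟨t, hst, h2⟩ := h2 s hs
  have e1 := (hf 0 s le_rfl hs).le
  have e2 := (hf s t hs hst).le
  have l1 := abs_le.1 (abs_height_sub_le (by linarith) e1)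
  have l2 := abs_le.1 (abs_height_sub_le (by linarith) e2)
  -- The larger of the two heights that bound the pieces from `f 0` to `f s` and from `f s` to `f
  -- t`. Joining `f 0` to `f t` over `P` has length at least `t`. If the first bound is larger this
  -- forces coarse descent from `s` to `t`, otherwise coarse ascent from `0` to `s`; both contradict
  -- the choice of `s` and `t`.
  set P := max (((f 0).height + (f s).height + (s - 0)) / 2)
    (((f s).height + (f t).height + (t - s)) / 2) + 1 with hP
  have p1 : ((f 0).height + (f s).height + (s - 0)) / 2 < P := by
    rw [hP]; linarith [le_max_left (((f 0).height + (f s).height + (s - 0)) / 2)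
      (((f s).height + (f t).height + (t - s)) / 2)]
  have p2 : ((f s).height + (f t).height + (t - s)) / 2 < P := by
    rw [hP]; linarith [le_max_right (((f 0).height + (f s).height + (s - 0)) / 2)
      (((f s).height + (f t).height + (t - s)) / 2)]
  have m1 := meetAt_of_edist_le e1 p1 (by linarith)
  have m2 := meetAt_of_edist_le e2 p2 (by linarith)
  have g1 := hgap _ _ _ _ e1 (by linarith) p1
  have g2 := hgap _ _ _ _ e2 (by linarith) p2
  have t1 := φ.gap_triangle q (f 0).base (f s).base (f t).base P
  have hg0 := φ.gap_nonneg q (f 0).base (f t).base P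
  have d1 := hup _ _ P (m1.trans m2)
  rw [hf 0 t le_rfl (by linarith), ENNReal.ofReal_le_ofReal_iff
    (by have := mul_nonneg hA.le hg0; linarith)] at d1
  have t2 : A * φ.gap q (f 0).base (f t).base P ≤ A * (K + K) := by
    gcongr
    linarith
  rcases max_choice (((f 0).height + (f s).height + (s - 0)) / 2)
    (((f s).height + (f t).height + (t - s)) / 2) with hm | hm
  · rw [hm] at hP
    linarith
  · rw [hm] at hP
    linarith

/-- Points at height going to `-∞` whose ascending rays in the tree merge follow an ascending
line. -/
theorem exists_ascendingLine_of_meetAt {y : ℝ → TreePoint T} {s₀ c : ℝ}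
    (hy : ∀ s t, s₀ ≤ s → s ≤ t → (y s).MeetAt (y t) (c - s)) :
    ∃ ℓ : AscendingLine T, ∀ s, s₀ ≤ s → (y s).ancestor (c - s + 1) = ℓ.vertex ⌊c - s + 1⌋ := by
  -- From this time on all the points have the same ancestor at height `i`, and this ancestor is the
  -- vertex of the line.
  let S : ℤ → ℝ := fun i => max s₀ (c - i)
  have hS : ∀ i s, S i ≤ s → (y (S i)).MeetAt (y s) i := fun i s hs =>
    (hy (S i) s (le_max_left _ _) hs).mono (by linarith [le_max_right s₀ (c - i)])
  have hm : ∀ i, S (i + 1) ≤ S i := fun i => by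
    refine max_le_max le_rfl ?_
    push_cast
    linarith
  let ℓ : AscendingLine T := ⟨fun i => (y (S i)).ancestor i, fun i => by
    rw [(hS (i + 1) (S i) (hm i)).2.2,
      (y (S i)).ancestor_mono (hS i (S i) le_rfl).1 (s := ((i + 1 : ℤ) : ℝ)) (by push_cast; linarith),
      Int.floor_intCast, Int.floor_intCast]
    simp, fun i => by
      rw [← (y (S i)).height_ancestor (hS i (S i) le_rfl).1, Int.floor_intCast]⟩
  refine ⟨ℓ, fun s hs => ?_⟩
  have h1 : S ⌊c - s + 1⌋ ≤ s := by
    refine max_le hs ?_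
    linarith [Int.lt_floor_add_one (c - s + 1)]
  have h2 := (hS _ s h1).2.2
  rw [(y s).ancestor_congr (s := ((⌊c - s + 1⌋ : ℤ) : ℝ)) (by rw [Int.floor_intCast])]
  exact h2.symm

/-- A ray that descends up to a bounded error is asymptotic to a vertical line. -/
theorem exists_asymptotic_of_coarsely_descending (h : φ.ContractsBy q δ) (hδ : δ ≤ 1)
    {f : ℝ → Millefeuille φ qG T} (hf : IsRay f) {s₀ C : ℝ} (hs₀ : 0 ≤ s₀) (hC : 0 ≤ C)
    (hd : ∀ t, s₀ ≤ t → t - s₀ - C ≤ (f s₀).height - (f t).height) :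
    ∃ g ℓ, RaysAsymptotic f fun t => vert φ qG g ℓ (-t) := by
  obtain ⟨K, hK, hgap⟩ := exists_gap_bound (qG := qG) (T := T) h hδ
  obtain ⟨A, hA, hup⟩ := exists_edist_le_of_meetAt φ qG q T
  obtain ⟨B, hB, hexp⟩ := h.exists_gap_le_exp hδ
  -- With this normalization the height of `f t` lies between `b - t` and `b - t + C`, and the
  -- geodesic from `f s` to a later point stays below `b + C + 1 - s`.
  set b := (f s₀).height + s₀ with hb
  have hlow : ∀ t, s₀ ≤ t → b - t ≤ (f t).height := fun t ht => by
    have := (abs_le.1 (abs_height_sub_le (by linarith) (hf s₀ t hs₀ ht).le)).1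
    linarith
  have hupp : ∀ t, s₀ ≤ t → (f t).height ≤ b - t + C := fun t ht => by
    have := hd t ht
    linarith
  have hP : ∀ s t, s₀ ≤ s → s ≤ t →
      ((f s).height + (f t).height + (t - s)) / 2 < b + C + 1 - s := fun s t hs hst => by
    have := hupp s hs
    have := hupp t (hs.trans hst)
    linarith
  have hmeet : ∀ s t, s₀ ≤ s → s ≤ t → (f s).leaf.MeetAt (f t).leaf (b + C + 1 - s) :=
    fun s t hs hst => meetAt_of_edist_le (hf s t (hs₀.trans hs) hst).le (hP s t hs hst)
      (sub_nonneg.2 hst)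
  have hK' : ∀ s t P, s₀ ≤ s → s ≤ t → b + C + 1 - s ≤ P → φ.gap q (f s).base (f t).base P ≤ K :=
    fun s t P hs hst hPs => hgap _ _ _ _ (hf s t (hs₀.trans hs) hst).le (sub_nonneg.2 hst)
      ((hP s t hs hst).trans_le hPs)
  have hgap0 : ∀ g g' : N, φ.gap q g g' 0 = q.rdist g g' := fun g g' => by
    rw [ExpandingFlow.gap, neg_zero, φ.apply_zero, φ.apply_zero]
  obtain ⟨ℓ, hℓ⟩ := exists_ascendingLine_of_meetAt (y := fun s => (f s).leaf) hmeet
  -- The bases at times `k ≤ l` have gap at most `K` at height `b + C + 1 - k`, which tends to `-∞`.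
  -- Seen from height `0` the gap is exponentially small in `k`.
  obtain ⟨g, hg⟩ := q.exists_limit_of_cauchy (fun n => (f n).base) (by
    intro ε hε
    have hlim : Tendsto (fun n : ℕ => B * Real.exp (b + C + 1 - n) * K) atTop (𝓝 0) := by
      have h1 : Tendsto (fun n : ℕ => b + C + 1 - (n : ℝ)) atTop atBot :=
        tendsto_atBot_add_const_left _ _ (tendsto_neg_atTop_atBot.comp tendsto_natCast_atTop_atTop)
      have := ((Real.tendsto_exp_atBot.comp h1).const_mul B).mul_const K
      simpa using this
    obtain ⟨n₁, hn₁⟩ := exists_nat_ge (max s₀ (b + C + 1))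
    obtain ⟨n₀, hn₀⟩ := eventually_atTop.1 (hlim.eventually (gt_mem_nhds hε))
    have key : ∀ k l : ℕ, max n₀ n₁ ≤ k → k ≤ l → q.rdist (f k).base (f l).base < ε := by
      intro k l hk hkl
      have hk1 : (n₁ : ℝ) ≤ k := by exact_mod_cast (le_max_right n₀ n₁).trans hk
      have hk2 : s₀ ≤ k := (le_max_left _ _).trans (hn₁.trans hk1)
      have hk3 : b + C + 1 ≤ k := (le_max_right _ _).trans (hn₁.trans hk1)
      rw [← hgap0]
      refine lt_of_le_of_lt ?_ (hn₀ k ((le_max_left n₀ n₁).trans hk))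
      refine (hexp _ _ (b + C + 1 - k) 0 (by linarith)).trans ?_
      rw [sub_zero]
      have := hK' k l (b + C + 1 - k) hk2 (by exact_mod_cast hkl) le_rfl
      gcongr
    refine ⟨max n₀ n₁, fun k hk l hl => ?_⟩
    rcases le_total k l with hkl | hkl
    · exact key k l hk hkl
    · rw [q.rdist_comm]
      exact key l k hl hkl)
  have hlim : ∀ s P, s₀ ≤ s → b + C + 1 - s ≤ P → φ.gap q (f s).base g P ≤ K := by
    intro s P hs hPs
    obtain ⟨D, hD, hDle⟩ := φ.exists_gap_le q q |P|
    have h1 : Tendsto (fun n : ℕ => K + D * q.rdist (f n).base g) atTop (𝓝 K) := by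
      have := (hg.const_mul D).const_add K
      rwa [mul_zero, add_zero] at this
    refine ge_of_tendsto h1 ?_
    obtain ⟨n₁, hn₁⟩ := exists_nat_ge s
    filter_upwards [eventually_ge_atTop n₁] with n hn
    have hn' : (n₁ : ℝ) ≤ n := by exact_mod_cast hn
    have e1 := φ.gap_triangle q (f s).base (f n).base g P
    have e2 := hK' s n P hs (by linarith) hPs
    have e3 := hDle (f n).base g 0 P (by rw [sub_zero])
    rw [hgap0] at e3
    linarith
  refine ⟨g, ℓ, ?_⟩
  set M := C + 2 + (C + 2) + A * K with hM
  have hlate : ∀ s, s₀ ≤ s → edist (f s) (vert φ qG g ℓ (b - s)) ≤ ENNReal.ofReal M := by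
    intro s hs
    have h1 := hlow s hs
    have h2 := hupp s hs
    have hm : (f s).leaf.MeetAt (vert φ qG g ℓ (b - s)).leaf (b + C + 1 - s + 1) := by
      refine ⟨by rw [leaf_height]; linarith, by rw [leaf_height, height_vert]; linarith, ?_⟩
      rw [leaf_vert, ℓ.ancestor_point (by linarith)]
      exact hℓ s hs
    refine (hup _ _ _ hm).trans (ENNReal.ofReal_le_ofReal ?_)
    rw [height_vert, base_vert]
    have h3 := hlim s (b + C + 1 - s + 1) hs (by linarith)
    have h4 : A * φ.gap q (f s).base g (b + C + 1 - s + 1) ≤ A * K := by gcongr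
    rw [hM]
    linarith
  have hM0 : 0 ≤ M := by positivity
  have hshift : ∀ t, edist (vert φ qG g ℓ (b - t)) (vert φ qG g ℓ (-t)) ≤ ENNReal.ofReal |b| := by
    intro t
    rw [(isometry_vert g ℓ).edist_eq, edist_dist, Real.dist_eq]
    exact ENNReal.ofReal_le_ofReal (by ring_nf; exact le_rfl)
  refine ⟨s₀ + M + s₀ + |b|, fun t ht => ?_⟩
  have hb0 := abs_nonneg b
  have hmain : edist (f t) (vert φ qG g ℓ (b - t)) ≤ ENNReal.ofReal (s₀ + M + s₀) := by
    rcases le_total s₀ t with hs | hs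
    · exact (hlate t hs).trans (ENNReal.ofReal_le_ofReal (by linarith))
    · have h1 := hf t s₀ ht hs
      have h2 := (isometry_vert (φ := φ) (qG := qG) g ℓ).edist_eq_ofReal
        (sub_le_sub_left hs b)
      rw [ENNReal.ofReal_add (by linarith) hs₀, ENNReal.ofReal_add hs₀ hM0]
      refine (edist_triangle4 _ (f s₀) (vert φ qG g ℓ (b - s₀)) _).trans
        (add_le_add (add_le_add ?_ (hlate s₀ le_rfl)) ?_)
      · rw [h1]
        exact ENNReal.ofReal_le_ofReal (by linarith)
      · rw [h2]
        exact ENNReal.ofReal_le_ofReal (by linarith)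
  rw [ENNReal.ofReal_add (by linarith) hb0]
  exact (edist_triangle _ _ _).trans (add_le_add hmain (hshift t))

/-- Every boundary point other than the upper end is the endpoint of a vertical line at height
`-∞`. -/
theorem exists_negEnd_vert_eq (h : φ.ContractsBy q δ) (hδ : δ ≤ 1) (g₀ : N)
    (ℓ₀ : AscendingLine T) (b : VisualBoundary (Millefeuille φ qG T))
    (hb : b ≠ posEnd (vert φ qG g₀ ℓ₀) (isometry_vert g₀ ℓ₀)) :
    ∃ g ℓ, negEnd (vert φ qG g ℓ) (isometry_vert g ℓ) = b := by
  obtain ⟨ρ, rfl⟩ : ∃ ρ : GeodesicRay (Millefeuille φ qG T), ρ.endpoint = b :=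
    Quotient.exists_rep b
  obtain ⟨C, hC, hdich⟩ := exists_coarse_dichotomy (qG := qG) (T := T) h hδ
  rcases hdich ρ.extend ρ.isRay_extend with hasc | ⟨s, hs, hdesc⟩
  · refine absurd ?_ hb
    rw [eq_comm, posEnd_eq_endpoint_iff]
    refine raysAsymptotic_of_coarsely_ascending h hδ (isometry_vert g₀ ℓ₀).isRay ρ.isRay_extend
      (C := max 0 (C - (ρ.extend 0).height)) (fun t _ => ?_) (fun t ht => ?_)
    · rw [height_vert]
      linarith [le_max_left 0 (C - (ρ.extend 0).height)]
    · have := hasc t ht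
      linarith [le_max_right 0 (C - (ρ.extend 0).height)]
  · obtain ⟨g, ℓ, has⟩ := exists_asymptotic_of_coarsely_descending h hδ ρ.isRay_extend hs hC.le hdesc
    exact ⟨g, ℓ, (posEnd_eq_endpoint_iff (isometry_vert g ℓ).comp_neg _).2 has.symm⟩

/-- The endpoint of a vertical line at height `-∞` is not the upper end. -/
theorem negEnd_vert_ne_posEnd_vert (g g₀ : N) (ℓ ℓ₀ : AscendingLine T) :
    negEnd (vert φ qG g ℓ) (isometry_vert g ℓ) ≠ posEnd (vert φ qG g₀ ℓ₀) (isometry_vert g₀ ℓ₀) := by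
  rw [negEnd_eq, Ne, posEnd_eq_posEnd_iff]
  rintro ⟨C, hC⟩
  have h1 := (abs_le.1 (abs_height_sub_le (le_max_right C 0) ((hC (max C 0 + 1)
    (by positivity)).trans (ENNReal.ofReal_le_ofReal (le_max_left _ _))))).2
  rw [height_vert, height_vert] at h1
  linarith [le_max_right C 0]

/-- Different vertical lines have different endpoints at height `-∞`. -/
theorem eq_of_negEnd_vert_eq (h : φ.ContractsBy q δ) (hδ : δ ≤ 1) {g g' : N}
    {ℓ ℓ' : AscendingLine T} (he : negEnd (vert φ qG g ℓ) (isometry_vert g ℓ) =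
      negEnd (vert φ qG g' ℓ') (isometry_vert g' ℓ')) : g = g' ∧ ℓ = ℓ' := by
  obtain ⟨C, hC⟩ := (negEnd_eq_negEnd_iff _ _).1 he
  obtain ⟨K, hK, hgap⟩ := exists_gap_bound (qG := qG) (T := T) h hδ
  set D := max C 0 with hD
  have hD0 : 0 ≤ D := le_max_right _ _
  have hdist : ∀ t, 0 ≤ t → edist (vert φ qG g ℓ (-t)) (vert φ qG g' ℓ' (-t)) ≤ ENNReal.ofReal D :=
    fun t ht => (hC t ht).trans (ENNReal.ofReal_le_ofReal (le_max_left _ _))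
  constructor
  · by_contra hne
    have h1 := (h.tendsto_gap_atBot hδ hne).eventually (eventually_gt_atTop K)
    obtain ⟨P, hP, hP'⟩ := (h1.and (eventually_le_atBot (D + 1))).exists
    have := hgap _ _ D P (hdist (D + 1 - P) (by linarith)) hD0
      (by rw [height_vert, height_vert]; linarith)
    rw [base_vert, base_vert] at this
    linarith
  · refine AscendingLine.ext (funext fun i => ?_)
    set t := max 0 (D - i) with ht
    have h1 : D - i ≤ t := le_max_right _ _
    have := meetAt_of_edist_le_of_le (r := i) (hdist t (le_max_left _ _))
      (by rw [height_vert, height_vert]; linarith) hD0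
    rw [leaf_vert, leaf_vert, AscendingLine.meetAt_point_iff _ _ (by linarith) (by linarith),
      Int.floor_intCast] at this
    exact this

end Millefeuille

/-! ### Merge heights and the two boundary metrics -/

namespace Millefeuille

variable {E N V : Type*} [NormedAddCommGroup E] [NormedSpace ℝ E] [FiniteDimensional ℝ E]
  [TopologicalSpace N] [ChartedSpace E N] [Group N] [LieGroup 𝓘(ℝ, E) ∞ N] [ConnectedSpace N]
  {m : ℕ} {φ : ExpandingFlow E N} {qG q : LieInner E N} {T : OrientedRegularTree V m} {δ : ℝ}

variable (φ q) in
/-- Up to a bounded error, `τ` is the height at which the vertical lines over `(g, ℓ)` and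
`(g', ℓ')` become close to each other. -/
structure IsMergeHeight (g g' : N) (ℓ ℓ' : AscendingLine T) (τ : ℝ) : Prop where
  le : ∀ H : ℝ, ℓ.vertex ⌊H⌋ = ℓ'.vertex ⌊H⌋ → φ.gap q g g' H ≤ 1 → τ ≤ H
  merged : ∀ H : ℝ, τ + 1 ≤ H → ℓ.vertex ⌊H⌋ = ℓ'.vertex ⌊H⌋ ∧ φ.gap q g g' H ≤ 1

/-- The merge height is the larger of the critical height in `N` and the exponent of the `m`-adic
distance, and `r ↦ m ^ r` commutes with maxima. The margin of one covers both `δ ≤ 1` and the step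
from `σ` to the first integer height at which the lines coincide. -/
theorem exists_isMergeHeight (h : φ.ContractsBy q δ) (hδ : δ ≤ 1) (hm : 2 ≤ m)
    {L : MAdic m → AscendingLine T} (hL : ∀ x y, x ≠ y →
      ∃ σ : ℤ, mAdicDist x y = (m : ℝ) ^ σ ∧ ∀ i, (L x).vertex i = (L y).vertex i ↔ σ < i)
    {x y : N × MAdic m} (hxy : x ≠ y) : ∃ τ : ℝ, maxDist (dPhi φ q m) x y = (m : ℝ) ^ τ ∧
      IsMergeHeight φ q x.1 y.1 (L x.2) (L y.2) τ := by
  have hm1 : (1 : ℝ) ≤ m := by exact_mod_cast (by omega : 1 ≤ m)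
  have hpos : ∀ r : ℝ, 0 < (m : ℝ) ^ r := fun r => Real.rpow_pos_of_pos (by linarith) r
  obtain ⟨g, a⟩ := x
  obtain ⟨g', a'⟩ := y
  rw [maxDist]
  by_cases hg : g = g'
  · subst hg
    have ha : a ≠ a' := fun ha => hxy (by rw [ha])
    obtain ⟨σ, hσ, hiff⟩ := hL a a' ha
    refine ⟨σ, ?_, fun H hH _ => ?_, fun H hH => ⟨?_, ?_⟩⟩
    · rw [hσ, dPhi, if_pos rfl, Real.rpow_intCast, max_eq_right]
      rw [← Real.rpow_intCast]
      exact (hpos _).le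
    · exact (Int.cast_le.2 ((hiff _).1 hH).le).trans (Int.floor_le H)
    · refine (hiff _).2 (Int.lt_of_add_one_le (Int.le_floor.2 ?_))
      push_cast
      exact hH
    · rw [φ.gap_self]
      exact zero_le_one
  obtain ⟨τ, hτ, -, hle, hge⟩ := h.exists_critical hδ hg (m : ℝ)
  by_cases ha : a = a'
  · subst ha
    refine ⟨τ, ?_, fun H _ hH => hle H hH, fun H hH => ⟨rfl, ?_⟩⟩
    · rw [hτ, mAdicDist, if_pos rfl, max_eq_left (hpos _).le]
    · exact (hge H (by linarith)).trans (by norm_num)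
  · obtain ⟨σ, hσ, hiff⟩ := hL a a' ha
    refine ⟨max τ σ, ?_, fun H h1 h2 => max_le (hle H h2) ?_, fun H hH => ⟨?_, ?_⟩⟩
    · rw [hτ, hσ, ← Real.rpow_intCast]
      exact ((Real.monotone_rpow_of_base_ge_one hm1).map_max).symm
    · exact (Int.cast_le.2 ((hiff _).1 h1).le).trans (Int.floor_le H)
    · refine (hiff _).2 (Int.lt_of_add_one_le (Int.le_floor.2 ?_))
      push_cast
      linarith [le_max_right τ (σ : ℝ)]
    · exact (hge H (by linarith [le_max_left τ (σ : ℝ)])).trans (by norm_num)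

theorem continuous_edist_vert (g g' : N) (ℓ ℓ' : AscendingLine T) :
    Continuous fun t => edist (vert φ qG g ℓ t) (vert φ qG g' ℓ' t) :=
  (isometry_vert g ℓ).continuous.edist (isometry_vert g' ℓ').continuous

/-- The distance between two vertical lines at a given height. -/
def vertDist (φ : ExpandingFlow E N) (qG : LieInner E N) (g g' : N) (ℓ ℓ' : AscendingLine T)
    (t : ℝ) : ℝ := (edist (vert φ qG g ℓ t) (vert φ qG g' ℓ' t)).toReal

theorem ofReal_vertDist (g g' : N) (ℓ ℓ' : AscendingLine T) (t : ℝ) :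
    ENNReal.ofReal (vertDist φ qG g g' ℓ ℓ' t) = edist (vert φ qG g ℓ t) (vert φ qG g' ℓ' t) :=
  ENNReal.ofReal_toReal (edist_ne_top _ _)

theorem vertDist_nonneg (g g' : N) (ℓ ℓ' : AscendingLine T) (t : ℝ) :
    0 ≤ vertDist φ qG g g' ℓ ℓ' t := ENNReal.toReal_nonneg

theorem vertDist_self (g : N) (ℓ : AscendingLine T) (t : ℝ) : vertDist φ qG g g ℓ ℓ t = 0 := by
  rw [vertDist, edist_self, ENNReal.toReal_zero]

/-- Lowering both points by `u` lengthens their distance by at most `2 u`. The limit defining the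
Euclid–Cygan metric is therefore an infimum. -/
theorem monotone_two_mul_add_vertDist (g g' : N) (ℓ ℓ' : AscendingLine T) :
    Monotone fun t => 2 * t + vertDist φ qG g g' ℓ ℓ' t := by
  intro s t hst
  have h1 := (isometry_vert (φ := φ) (qG := qG) g ℓ).edist_eq_ofReal hst
  have h2 := (isometry_vert (φ := φ) (qG := qG) g' ℓ').edist_eq_ofReal hst
  have h3 := edist_triangle4 (vert φ qG g ℓ s) (vert φ qG g ℓ t) (vert φ qG g' ℓ' t)
    (vert φ qG g' ℓ' s)
  have h4 := vertDist_nonneg (φ := φ) (qG := qG) g g' ℓ ℓ' t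
  rw [edist_comm (vert φ qG g' ℓ' t), h1, h2, ← ofReal_vertDist, ← ofReal_vertDist,
    ← ENNReal.ofReal_add (by linarith) h4, ← ENNReal.ofReal_add (by linarith) (by linarith),
    ENNReal.ofReal_le_ofReal_iff (by linarith)] at h3
  dsimp only
  linarith

/-- The distance between two vertical lines, in terms of the height where they merge. -/
theorem exists_vertDist_bounds (h : φ.ContractsBy q δ) (hδ : δ ≤ 1) : ∃ R : ℝ, 0 < R ∧
    ∀ (g g' : N) (ℓ ℓ' : AscendingLine T) (τ : ℝ), IsMergeHeight φ q g g' ℓ ℓ' τ →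
      (∀ t, τ + R ≤ t → vertDist φ qG g g' ℓ ℓ' t ≤ 1 / 2) ∧
      2 * (τ + 1) + vertDist φ qG g g' ℓ ℓ' (τ + 1) ≤ 2 * (τ + R) ∧
      ∀ t, 2 * (τ - R) ≤ 2 * t + vertDist φ qG g g' ℓ ℓ' t := by
  obtain ⟨K, hK, hgap⟩ := exists_gap_bound (qG := qG) (T := T) h hδ
  obtain ⟨A, hA, hup⟩ := exists_edist_le_of_meetAt φ qG q T
  obtain ⟨B, hB, hexp⟩ := h.exists_gap_le_exp hδ
  have hsmall : ∀ (M ε : ℝ), 0 < ε → ∃ r, 0 ≤ r ∧ ∀ s, r ≤ s → M * Real.exp (-s) ≤ ε := by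
    intro M ε hε
    have h1 : Tendsto (fun s : ℝ => M * Real.exp (-s)) atTop (𝓝 (M * 0)) :=
      (Real.tendsto_exp_neg_atTop_nhds_zero).const_mul M
    rw [mul_zero] at h1
    obtain ⟨r, hr⟩ := eventually_atTop.1 (h1.eventually (gt_mem_nhds hε))
    exact ⟨max r 0, le_max_right _ _, fun s hs => (hr s ((le_max_left _ _).trans hs)).le⟩
  obtain ⟨r₁, hr₁, hr₁'⟩ := hsmall (A * B) (1 / 2) (by norm_num)
  obtain ⟨r₂, hr₂, hr₂'⟩ := hsmall (B * K) 1 one_pos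
  -- Here `r₁` is the time in which the crossing cost above `τ + 1` falls to `1/2`, `A` bounds the
  -- crossing cost at `τ + 1`, and `r₂` is the time in which a gap `K` falls to 1.
  refine ⟨1 + r₁ + A + r₂ + 1, by positivity, fun g g' ℓ ℓ' τ hτ => ?_⟩
  have hdist : ∀ t, τ + 1 ≤ t → vertDist φ qG g g' ℓ ℓ' t ≤ A * φ.gap q g g' t := by
    intro t ht
    have h1 := hup (vert φ qG g ℓ t) (vert φ qG g' ℓ' t) t
      ((ℓ.meetAt_point_iff ℓ' le_rfl le_rfl).2 (hτ.merged t ht).1)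
    rw [height_vert, height_vert, base_vert, base_vert, sub_self, zero_add, zero_add,
      ← ofReal_vertDist, ENNReal.ofReal_le_ofReal_iff
        (mul_nonneg hA.le (φ.gap_nonneg q _ _ _))] at h1
    exact h1
  refine ⟨fun t ht => ?_, ?_, fun t => ?_⟩
  · refine (hdist t (by linarith)).trans ?_
    have h1 := hexp g g' (τ + 1) t (by linarith)
    have h2 := (hτ.merged (τ + 1) le_rfl).2
    calc A * φ.gap q g g' t ≤ A * (B * Real.exp (τ + 1 - t) * φ.gap q g g' (τ + 1)) := by gcongr
      _ ≤ A * (B * Real.exp (τ + 1 - t) * 1) := by gcongr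
      _ = A * B * Real.exp (-(t - τ - 1)) := by
        rw [show -(t - τ - 1) = τ + 1 - t by ring]
        ring
      _ ≤ 1 / 2 := hr₁' _ (by linarith)
  · have h1 := hdist (τ + 1) le_rfl
    have h2 : A * φ.gap q g g' (τ + 1) ≤ A * 1 := by
      gcongr
      exact (hτ.merged (τ + 1) le_rfl).2
    linarith
  · have hd0 := vertDist_nonneg (φ := φ) (qG := qG) g g' ℓ ℓ' t
    have hle := (ofReal_vertDist (φ := φ) (qG := qG) g g' ℓ ℓ' t).ge
    set d := vertDist φ qG g g' ℓ ℓ' t with hd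
    -- At height `t + d / 2 + 1` the tree lines have merged and the gap is at most `K`; after a
    -- further `r₂` it is at most 1. By definition of the merge height, `τ ≤ t + d / 2 + 1 + r₂`.
    have hP : ((vert φ qG g ℓ t).height + (vert φ qG g' ℓ' t).height + d) / 2 < t + d / 2 + 1 := by
      rw [height_vert, height_vert]
      linarith
    have hm1 := (meetAt_of_edist_le hle hP hd0).mono
      (show t + d / 2 + 1 ≤ t + d / 2 + 1 + r₂ by linarith)
    rw [leaf_vert, leaf_vert, AscendingLine.meetAt_point_iff _ _ (by linarith) (by linarith)] at hm1
    have hg1 := hgap _ _ _ _ hle hd0 hP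
    rw [base_vert, base_vert] at hg1
    have hg2 : φ.gap q g g' (t + d / 2 + 1 + r₂) ≤ 1 := by
      calc φ.gap q g g' (t + d / 2 + 1 + r₂)
          ≤ B * Real.exp (t + d / 2 + 1 - (t + d / 2 + 1 + r₂)) * φ.gap q g g' (t + d / 2 + 1) :=
            hexp _ _ _ _ (by linarith)
        _ ≤ B * Real.exp (t + d / 2 + 1 - (t + d / 2 + 1 + r₂)) * K := by gcongr
        _ = B * K * Real.exp (-r₂) := by
          rw [show t + d / 2 + 1 - (t + d / 2 + 1 + r₂) = -r₂ by ring]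
          ring
        _ ≤ 1 := hr₂' _ le_rfl
    have := hτ.le _ hm1 hg2
    linarith

/-- The parabolic visual metric, on pairs of vertical lines. -/
theorem exists_isLeast_vertDist_eq_one (h : φ.ContractsBy q δ) (hδ : δ ≤ 1) : ∃ R : ℝ,
    ∀ (g g' : N) (ℓ ℓ' : AscendingLine T) (τ : ℝ), IsMergeHeight φ q g g' ℓ ℓ' τ → ∃ t₀,
      IsLeast {t : ℝ | edist (vert φ qG g ℓ t) (vert φ qG g' ℓ' t) = 1} t₀ ∧
      τ - R ≤ t₀ ∧ t₀ ≤ τ + R := by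
  obtain ⟨R, hR, hbd⟩ := exists_vertDist_bounds (qG := qG) (T := T) h hδ
  refine ⟨R + 1, fun g g' ℓ ℓ' τ hτ => ?_⟩
  obtain ⟨h1, -, h3⟩ := hbd g g' ℓ ℓ' τ hτ
  set S := {t : ℝ | edist (vert φ qG g ℓ t) (vert φ qG g' ℓ' t) = 1} with hS
  have hmem : ∀ t, t ∈ S ↔ vertDist φ qG g g' ℓ ℓ' t = 1 := fun t => by
    rw [hS, mem_ofPred_eq, ← ofReal_vertDist, ENNReal.ofReal_eq_one]
  have hclosed : IsClosed S := isClosed_eq (continuous_edist_vert g g' ℓ ℓ') continuous_const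
  have hlow : ∀ t ∈ S, τ - R - 1 / 2 ≤ t := fun t ht => by
    have := h3 t
    rw [(hmem t).1 ht] at this
    linarith
  have hne : S.Nonempty := by
    -- Intermediate values: the distance is at most `1/2` at `τ + R`, and at `τ - R - 1` it is at
    -- least 2 by the lower bound on `2 t + d`.
    refine mem_range_of_exists_le_of_exists_ge (continuous_edist_vert g g' ℓ ℓ')
      ⟨τ + R, ?_⟩ ⟨τ - R - 1, ?_⟩
    · rw [← ofReal_vertDist, ENNReal.ofReal_le_one]
      exact (h1 _ le_rfl).trans (by norm_num)
    · rw [← ofReal_vertDist, ENNReal.one_le_ofReal]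
      linarith [h3 (τ - R - 1)]
  have hleast := hclosed.isLeast_csInf hne ⟨_, hlow⟩
  refine ⟨_, hleast, by linarith [hlow _ hleast.1], ?_⟩
  by_contra hcon
  have := h1 (sInf S) (by linarith)
  rw [(hmem _).1 hleast.1] at this
  norm_num at this

/-- The Euclid-Cygan metric, on pairs of vertical lines. -/
theorem tendsto_rpow_vertDist (hm : 2 ≤ m) (g g' : N) (ℓ ℓ' : AscendingLine T) :
    Tendsto (fun t : ℝ => (m : ℝ) ^ ((1 / 2 : ℝ) * (2 * t + vertDist φ qG g g' ℓ ℓ' t))) atBot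
      (𝓝 (⨅ t : ℝ, (m : ℝ) ^ ((1 / 2 : ℝ) * (2 * t + vertDist φ qG g g' ℓ ℓ' t)))) := by
  have hm1 : (1 : ℝ) ≤ m := by exact_mod_cast (by omega : 1 ≤ m)
  refine tendsto_atBot_ciInf ((Real.monotone_rpow_of_base_ge_one hm1).comp
    ((monotone_two_mul_add_vertDist g g' ℓ ℓ').const_mul (by norm_num))) ⟨0, ?_⟩
  rintro _ ⟨t, rfl⟩
  positivity

/-- An additive error `R` in the exponent is a multiplicative factor `a ^ R`. -/
theorem isBilipschitz_of_rpow {Y Z : Type*} {d : Y → Y → ℝ} {d' : Z → Z → ℝ} {F : Y → Z} {a R : ℝ}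
    (ha : 0 < a) (hd : ∀ x, d x x = 0) (hd' : ∀ x, d' (F x) (F x) = 0)
    (h : ∀ x y, x ≠ y → ∃ τ : ℝ, d x y = a ^ τ ∧ a ^ (τ - R) ≤ d' (F x) (F y) ∧
      d' (F x) (F y) ≤ a ^ (τ + R)) : IsBilipschitz d d' F := by
  refine ⟨a ^ (-R), a ^ R, Real.rpow_pos_of_pos ha _, Real.rpow_pos_of_pos ha _, fun x y => ?_⟩
  by_cases hxy : x = y
  · rw [hxy, hd, hd', mul_zero, mul_zero]
    exact ⟨le_rfl, le_rfl⟩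
  · obtain ⟨τ, h1, h2, h3⟩ := h x y hxy
    rw [h1, ← Real.rpow_add ha, ← Real.rpow_add ha, neg_add_eq_sub, add_comm R τ]
    exact ⟨h2, h3⟩

/-- For a flow that contracts fast enough, the boundary of the millefeuille space with its parabolic
visual metric or its Euclid-Cygan metric is bilipschitz equivalent to the product of `N` and the
`m`-adics. -/
theorem exists_boundary_parametrization (h : φ.ContractsBy q δ) (hδ : δ ≤ 1) (hm : 2 ≤ m) :
    ∃ (ξ : VisualBoundary (Millefeuille φ qG T)) (D D' : {b // b ≠ ξ} → {b // b ≠ ξ} → ℝ),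
      IsUpperEnd Millefeuille.height ξ ∧ IsParabolicVisualMetric Millefeuille.height ξ m D ∧
      IsEuclidCyganMetric Millefeuille.height ξ m D' ∧ ∃ F : N × MAdic m ≃ {b // b ≠ ξ},
        IsBilipschitz (maxDist (dPhi φ q m)) D F ∧ IsBilipschitz (maxDist (dPhi φ q m)) D' F := by
  classical
  have hm1 : (1 : ℝ) ≤ m := by exact_mod_cast (by omega : 1 ≤ m)
  have hm0 : (0 : ℝ) < m := by linarith
  have hrpow : ∀ r s : ℝ, r ≤ s → (m : ℝ) ^ r ≤ (m : ℝ) ^ s := fun r s hrs =>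
    Real.rpow_le_rpow_of_exponent_le hm1 hrs
  obtain ⟨L, hL⟩ := T.exists_mAdic_equiv hm
  obtain ⟨ℓ₀⟩ := T.nonempty_ascendingLine hm
  set ξ := posEnd (vert φ qG 1 ℓ₀) (isometry_vert 1 ℓ₀) with hξ
  have hupper : IsUpperEnd Millefeuille.height ξ := isUpperEnd_posEnd_vert h hδ 1 ℓ₀
  have hposEnd : ∀ (g : N) (ℓ : AscendingLine T),
      posEnd (vert φ qG g ℓ) (isometry_vert g ℓ) = ξ := fun g ℓ =>
    (hupper (isometry_vert g ℓ).toGeodesicRay).2 fun t => by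
      change (t : ℝ) = ((0 : ℝ≥0) : ℝ) + t
      simp
  let line : N × MAdic m → ℝ → Millefeuille φ qG T := fun p => vert φ qG p.1 (L p.2)
  let F₀ : N × MAdic m → {b // b ≠ ξ} := fun p =>
    ⟨negEnd (line p) (isometry_vert _ _), negEnd_vert_ne_posEnd_vert _ _ _ _⟩
  have hinj : F₀.Injective := by
    rintro ⟨g, a⟩ ⟨g', a'⟩ he
    obtain ⟨h1, h2⟩ := eq_of_negEnd_vert_eq h hδ (congrArg Subtype.val he)
    exact Prod.ext h1 (L.injective h2)
  have hsurj : F₀.Surjective := by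
    rintro ⟨b, hb⟩
    obtain ⟨g, ℓ, hgl⟩ := exists_negEnd_vert_eq h hδ 1 ℓ₀ b hb
    refine ⟨(g, L.symm ℓ), Subtype.ext ?_⟩
    simp only [F₀, line, Equiv.apply_symm_apply]
    exact hgl
  let F := Equiv.ofBijective F₀ ⟨hinj, hsurj⟩
  have hvert : ∀ p β, IsVerticalGeodesic Millefeuille.height ξ (F p).1 β ↔ β = line p := by
    intro p β
    constructor
    · rintro ⟨hβ, h1, h2, h3⟩
      obtain ⟨g, ℓ, rfl⟩ := exists_eq_vert_of_posEnd h hδ hβ h2 h3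
      obtain ⟨rfl, rfl⟩ := eq_of_negEnd_vert_eq h hδ h1
      rfl
    · rintro rfl
      exact ⟨isometry_vert _ _, rfl, hposEnd _ _, rfl⟩
  have hex : ∀ b : {b // b ≠ ξ}, ∃! β, IsVerticalGeodesic Millefeuille.height ξ b.1 β := by
    intro b
    obtain ⟨p, rfl⟩ := F.surjective b
    exact ⟨line p, (hvert p _).2 rfl, fun β hβ => (hvert p β).1 hβ⟩
  let D₀ : N × MAdic m → N × MAdic m → ℝ := fun p p' =>
    if p = p' then 0 else (m : ℝ) ^ sInf {t : ℝ | edist (line p t) (line p' t) = 1}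
  let D₁ : N × MAdic m → N × MAdic m → ℝ := fun p p' =>
    ⨅ t : ℝ, (m : ℝ) ^ ((1 / 2 : ℝ) * (2 * t + vertDist φ qG p.1 p'.1 (L p.2) (L p'.2) t))
  have hself : ∀ p : N × MAdic m, maxDist (dPhi φ q m) p p = 0 := fun p => by
    rw [maxDist, dPhi, if_pos rfl, mAdicDist, if_pos rfl, max_self]
  obtain ⟨R, hR⟩ := exists_isLeast_vertDist_eq_one (qG := qG) (T := T) h hδ
  obtain ⟨R', -, hR'⟩ := exists_vertDist_bounds (qG := qG) (T := T) h hδ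
  refine ⟨ξ, fun b c => D₀ (F.symm b) (F.symm c), fun b c => D₁ (F.symm b) (F.symm c), hupper,
    ⟨hex, fun b => if_pos rfl, ?_⟩, ⟨hex, ?_, ?_⟩, F, ?_, ?_⟩
  · intro b c hbc β γ hβ hγ
    obtain ⟨p, rfl⟩ := F.surjective b
    obtain ⟨p', rfl⟩ := F.surjective c
    rw [hvert] at hβ hγ
    subst hβ hγ
    have hne : p ≠ p' := fun he => hbc (by rw [he])
    obtain ⟨τ, -, hτ⟩ := exists_isMergeHeight h hδ hm hL hne
    obtain ⟨t₀, ht₀, -, -⟩ := hR _ _ _ _ τ hτ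
    refine ⟨t₀, ht₀, ?_⟩
    simp only [Equiv.symm_apply_apply, D₀, if_neg hne]
    rw [show sInf {t : ℝ | edist (line p t) (line p' t) = 1} = t₀ from ht₀.csInf_eq]
  · intro b c β γ _ _ t
    exact edist_ne_top _ _
  · intro b c β γ hβ hγ
    obtain ⟨p, rfl⟩ := F.surjective b
    obtain ⟨p', rfl⟩ := F.surjective c
    rw [hvert] at hβ hγ
    subst hβ hγ
    simp only [Equiv.symm_apply_apply, D₁]
    exact tendsto_rpow_vertDist hm _ _ _ _
  · refine isBilipschitz_of_rpow (R := R) hm0 hself (fun p => if_pos rfl) fun p p' hne => ?_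
    obtain ⟨τ, h1, hτ⟩ := exists_isMergeHeight h hδ hm hL hne
    obtain ⟨t₀, ht₀, h2, h3⟩ := hR _ _ _ _ τ hτ
    refine ⟨τ, h1, ?_⟩
    simp only [Equiv.symm_apply_apply, D₀, if_neg hne]
    rw [show sInf {t : ℝ | edist (line p t) (line p' t) = 1} = t₀ from ht₀.csInf_eq]
    exact ⟨hrpow _ _ h2, hrpow _ _ h3⟩
  · refine isBilipschitz_of_rpow (R := R') hm0 hself (fun p => ?_) fun p p' hne => ?_
    · simp only [D₁]
      have h1 := tendsto_rpow_vertDist (φ := φ) (qG := qG) hm (F.symm (F p)).1 (F.symm (F p)).1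
        (L (F.symm (F p)).2) (L (F.symm (F p)).2)
      refine tendsto_nhds_unique h1 ?_
      -- On the diagonal the distance of the lines is zero and the expression is `m ^ t`, whose
      -- limit at `-∞` is zero.
      have h2 := tendsto_rpow_atBot_of_base_gt_one (m : ℝ) (by exact_mod_cast (by omega : 1 < m))
      refine h2.congr fun t => ?_
      rw [vertDist_self]
      congr 1
      ring
    · obtain ⟨τ, h1, hτ⟩ := exists_isMergeHeight h hδ hm hL hne
      obtain ⟨-, h2, h3⟩ := hR' _ _ _ _ τ hτ
      refine ⟨τ, h1, ?_⟩
      simp only [Equiv.symm_apply_apply, D₁]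
      constructor
      · refine le_ciInf fun t => hrpow _ _ ?_
        linarith [h3 t]
      -- The infimum is tested at `τ + 1`, where the lines have merged and their distance is
      -- bounded.
      · refine (ciInf_le ⟨0, ?_⟩ (τ + 1)).trans (hrpow _ _ ?_)
        · rintro _ ⟨t, rfl⟩
          positivity
        · linarith

end Millefeuille

/-! ### Choice of the rescaling -/

theorem mainTheorem8
    {E N V : Type*} [NormedAddCommGroup E] [NormedSpace ℝ E] [FiniteDimensional ℝ E]
    [TopologicalSpace N] [ChartedSpace E N] [Group N] [LieGroup 𝓘(ℝ, E) ∞ N]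
    [SimplyConnectedSpace N] [Group.IsNilpotent N]
    (φ : ExpandingFlow E N) (qG qN : LieInner E N)
    (m : ℕ) (hm : 2 ≤ m) (T : OrientedRegularTree V m) :
    ∃ c₀ : ℝ, 0 < c₀ ∧ ∀ (c : ℝ) (hc : 0 < c), c₀ ≤ c →
      (∃ ρ : N → N → ℝ, IsMetric ρ ∧ IsBilipschitz ρ (dPhi (φ.rescale c hc) qN m) id) ∧
      ∃ (ξ : VisualBoundary (Millefeuille (φ.rescale c hc) qG T))
        (D D' : {b // b ≠ ξ} → {b // b ≠ ξ} → ℝ),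
        IsUpperEnd Millefeuille.height ξ ∧
        IsParabolicVisualMetric Millefeuille.height ξ m D ∧
        IsEuclidCyganMetric Millefeuille.height ξ m D' ∧
        ∃ F : N × MAdic m ≃ {b // b ≠ ξ},
          IsBilipschitz (maxDist (dPhi (φ.rescale c hc) qN m)) D F ∧
          IsBilipschitz (maxDist (dPhi (φ.rescale c hc) qN m)) D' F := by
  have hm1 : (1 : ℝ) < m := by exact_mod_cast (by omega : 1 < m)
  have hm2 : (2 : ℝ) ≤ m := by exact_mod_cast hm
  have hlog : 0 < Real.log m := Real.log_pos hm1
  -- Chosen so that `m ^ δ = 2`, the largest factor that the metrization lemma allows; `m ≥ 2` gives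
  -- `δ ≤ 1`.
  set δ := Real.log 2 / Real.log m with hδ
  have hδ0 : 0 < δ := div_pos (Real.log_pos one_lt_two) hlog
  have hδ1 : δ ≤ 1 := (div_le_one hlog).2 (Real.log_le_log two_pos hm2)
  have hmδ : (m : ℝ) ^ δ ≤ 2 := by
    rw [Real.rpow_def_of_pos (by linarith), hδ, mul_div_cancel₀ _ hlog.ne',
      Real.exp_log two_pos]
  obtain ⟨t, ht, hcontr⟩ := φ.exists_contractsBy qN
  -- The original flow contracts by the factor 6 in time `t`, so speeding it up by `c ≥ t / δ` makes
  -- it do so in time `δ`.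
  refine ⟨t / δ, div_pos ht hδ0, fun c hc hle => ?_⟩
  have hψ : (φ.rescale c hc).ContractsBy qN δ := hcontr.rescale hc ((div_le_iff₀ hδ0).1 hle)
  exact ⟨hψ.exists_metric hδ1 hm1 hmδ,
    Millefeuille.exists_boundary_parametrization hψ hδ1 hm⟩
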